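/- Consider a Fisher market with $n$ perfectly divisible goods, each in unit supply, and $m\ge 1$ buyers. Buyer $i$ has a budget $e_i>0$ and a CES utility $u_i(\mathbf x)=\bigl(\sum_{j=1}^n a_{ij}x_j^{\rho_i}\bigr)^{1/\rho_i}$ on $\mathbb R_+^n$, where $-\infty<\rho_i<1$, $a_{ij}\ge 0$, and $a_{ij}>0$ for at least one $j$; for $\rho_i<0$ this is read as $0$ if $x_j=0$ for some $j$ with $a_{ij}>0$, and for $\rho_i=0$ it is the Cobb–Douglas utility $\prod_j x_j^{a_{ij}}$ with $\sum_j a_{ij}=1$. Substitutes ($\rho_i\ge0$) and complements ($\rho_i\le0$) may be mixed. At prices $\mathbf p\in\mathbb R_+^n$, a demand of buyer $i$ is a bundle $\mathbf x_i\in\mathbb R_+^n$ maximizing $u_i$ subject to $\mathbf x_i\cdot\mathbf p\le e_i$, and $z_j(\mathbf p)=\sum_i x_{ij}-1$ is the excess demand for good $j$. A market equilibrium is a vector $\mathbf p^*\in\mathbb R_+^n$ for which there are demands $\mathbf x_i$ with $\sum_i x_{ij}=1$ whenever $p_j^*>0$ and $\sum_i x_{ij}\le 1$ whenever $p^*_j=0$.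 Let $\phi(\mathbf p)=\sum_k p_k+\sum_i e_i\log\hat u_i(\mathbf p)$, where $\hat u_i(\mathbf p)$ is the optimal utility of buyer $i$ at prices $\mathbf p$ with one unit of spending. Asynchronous tatonnement with step size $\lambda>0$ starts at time $0$ from a positive price vector $\mathbf p^\circ$. The price of each good $j$ is updated at its own sequence of times, with finitely many updates in bounded time, and is constant between consecutive updates to it. Let $\alpha_j(t)$ be the time of the latest update to $p_j$ strictly before $t$ (time $0$ if there is none); it is assumed that $t-\alpha_j(t)\le 1$ at all times $t\ge 0$. An update to $p_j$ at time $t$ is $$p_j\leftarrow p_j\cdot\bigl[1+\lambda\cdot\min\{\tilde z_j,1\}\cdot(t-\alpha_j(t))\bigr],$$ where $\tilde z_j$ is an arbitrary value between the minimum and the maximum of the instantaneous excess demands for good $j$ during the time interval $(\alpha_j(t),t)$. Let $\rho=\max_i\rho_i<1$ and $E=\max\{1/(1-\rho),1\}$, and let $0<\lambda\le 1/(26E)$. Then the market has exactly one market equilibrium $\mathbf p^*$, and asynchronous tatonnement converges linearly toward it: for every positive $\mathbf p^\circ$ there are constants $C>0$ and $\gamma\in(0,1)$, depending only on the market, $\lambda$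 and $\mathbf p^\circ$, such that in every asynchronous tatonnement from $\mathbf p^\circ$, whatever the update times and the values $\tilde z_j$, the prices $\mathbf p^t$ at each time $t\ge 0$ satisfy $$\phi(\mathbf p^t)-\phi(\mathbf p^*)\le C\gamma^t\,\bigl(\phi(\mathbf p^\circ)-\phi(\mathbf p^*)\bigr)\quad\text{and}\quad |p_j^t-p_j^*|\le C\gamma^t\ \text{ for all goods } j.$$ -/

import Mathlib

open Set Filter

noncomputable section

namespace FisherMarket

/-- The CES utility with parameter `ρ < 1` and coefficients `a ≥ 0` of a bundle `x ≥ 0`: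
`(∑ j, a j * x j ^ ρ) ^ (1 / ρ)` for `ρ ≠ 0`, and the Cobb-Douglas utility `∏ j, x j ^ a j` for
`ρ = 0`. For `ρ < 0` a bundle that contains none of some good `j` with `a j > 0` has utility `0`
(there `x j ^ ρ = ∞`, and the outer exponent `1 / ρ` is negative). -/
def cesUtility {n : ℕ} (ρ : ℝ) (a x : Fin n → ℝ) : ℝ :=
  open Classical in
  if ρ = 0 then ∏ j, x j ^ a j
  else if ρ < 0 ∧ ∃ j, 0 < a j ∧ x j = 0 then 0
  else (∑ j, a j * x j ^ ρ) ^ (1 / ρ)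

/-- A Fisher market with `n` goods, each in unit supply, and `m` buyers with CES utilities.
All parameters `rho i` are real, so Leontief buyers (`rho i = -∞`) are excluded; the condition
`rho i < 1` is left to the results about such markets. -/
structure CESMarket (n m : ℕ) where
  /-- the budgets of the buyers -/
  budget : Fin m → ℝ
  /-- the coefficients of the CES utilities -/
  coeff : Fin m → Fin n → ℝ
  /-- the exponents of the CES utilities -/
  rho : Fin m → ℝ
  budget_pos : ∀ i, 0 < budget i
  coeff_nonneg : ∀ i j, 0 ≤ coeff i j
  /-- every buyer wants some good -/
  exists_coeff_pos : ∀ i, ∃ j, 0 < coeff i j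
  /-- the usual normalization of Cobb-Douglas utilities -/
  cobbDouglas_sum : ∀ i, rho i = 0 → ∑ j, coeff i j = 1

variable {n m : ℕ}

/-- The utility function of buyer `i`. -/
def CESMarket.utility (M : CESMarket n m) (i : Fin m) (x : Fin n → ℝ) : ℝ :=
  cesUtility (M.rho i) (M.coeff i) x

/-- The bundles that cost at most `b` at the prices `p`. -/
def affordable (p : Fin n → ℝ) (b : ℝ) : Set (Fin n → ℝ) :=
  {x | (∀ j, 0 ≤ x j) ∧ ∑ j, x j * p j ≤ b}

/-- `x` is a demand of buyer `i` at the prices `p`: an affordable bundle of maximum utility. -/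
def CESMarket.IsDemand (M : CESMarket n m) (p : Fin n → ℝ) (i : Fin m) (x : Fin n → ℝ) : Prop :=
  x ∈ affordable p (M.budget i) ∧
    ∀ y ∈ affordable p (M.budget i), M.utility i y ≤ M.utility i x

/-- `z` is the vector of excess demands at the prices `p`. -/
def CESMarket.IsExcessDemand (M : CESMarket n m) (p z : Fin n → ℝ) : Prop :=
  ∃ x : Fin m → Fin n → ℝ, (∀ i, M.IsDemand p i (x i)) ∧ ∀ j, z j = ∑ i, x i j - 1

/-- `p` is a market equilibrium. -/
def CESMarket.IsEquilibrium (M : CESMarket n m) (p : Fin n → ℝ) : Prop :=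
  (∀ j, 0 ≤ p j) ∧ ∃ x : Fin m → Fin n → ℝ, (∀ i, M.IsDemand p i (x i)) ∧
    ∀ j, (0 < p j → ∑ i, x i j = 1) ∧ (p j = 0 → ∑ i, x i j ≤ 1)

/-- The optimal utility that buyer `i` attains at the prices `p` with a unit of spending. -/
def CESMarket.indirectUtility (M : CESMarket n m) (i : Fin m) (p : Fin n → ℝ) : ℝ :=
  sSup (M.utility i '' affordable p 1)

/-- The convex function `φ p = ∑ k, p k + ∑ i, e i * log (û i p)`, whose gradient is minus the
excess demand. -/
def CESMarket.phi (M : CESMarket n m) (p : Fin n → ℝ) : ℝ :=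
  ∑ k, p k + ∑ i, M.budget i * Real.log (M.indirectUtility i p)

/-- `(time, p)` is a run of asynchronous tatonnement with step size `lam` from the initial prices
`p₀`. For each good `j`, `time j 1 < time j 2 < ⋯` are the times of the updates to its price
and `time j 0 = 0` is the start; `p t` is the price vector at time `t ≥ 0`, after the updates
at time `t`, if any. Updates of different goods need not be coordinated in any way. -/
structure CESMarket.IsAsyncTatonnement (M : CESMarket n m) (lam : ℝ) (p₀ : Fin n → ℝ)
    (time : Fin n → ℕ → ℝ) (p : ℝ → Fin n → ℝ) : Prop where
  time_zero : ∀ j, time j 0 = 0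
  time_strictMono : ∀ j, StrictMono (time j)
  /-- only finitely many updates in bounded time -/
  time_tendsto : ∀ j, Tendsto (time j) atTop atTop
  time_gap : ∀ j k, time j (k + 1) - time j k ≤ 1
  initial : p 0 = p₀
  /-- a price does not change between updates to it -/
  const : ∀ j k t, t ∈ Ico (time j k) (time j (k + 1)) → p t j = p (time j k) j
  /-- the update rule, with some value `zt` between the minimum and the maximum of the
  instantaneous excess demands for good `j` since the previous update to its price -/
  update : ∀ j k, ∃ zt : ℝ,
    (∃ s ∈ Ioo (time j k) (time j (k + 1)), ∃ z, M.IsExcessDemand (p s) z ∧ z j ≤ zt) ∧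
    (∃ s ∈ Ioo (time j k) (time j (k + 1)), ∃ z, M.IsExcessDemand (p s) z ∧ zt ≤ z j) ∧
    p (time j (k + 1)) j =
      p (time j k) j * (1 + lam * min zt 1 * (time j (k + 1) - time j k))

end FisherMarket

end

/-!
# Linear convergence of asynchronous tatonnement in CES Fisher markets

A CES buyer with exponent `ρ` spends on good `j` a share of the budget proportional to
`a j ^ (1 / (1 - ρ)) * p j ^ c`, where `c = -ρ / (1 - ρ) < 1`. This gives closed forms for the
demands and for the indirect utility. Under a price change with ratios `y j = p' j / p j`, the
logarithm of the indirect utility changes by `-(1 / c) * log (∑ j, share j * y j ^ c)`, and one-line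
inequalities (Jensen's inequality and tangent lines) bound this expression from both sides.
Hence `φ` is convex with gradient minus the excess demand `z`, is strongly convex in the
square roots of the prices (`phi_sub_ge`), and has a second order upper bound with the error term
`E * p j * x j * (y j - 1) ^ 2`, where `x = z + 1` is the total demand (`phi_sub_le`). Equilibria
are the points at which `z` vanishes on the goods wanted by some buyer and the other goods are free.
One exists since the minimum of `φ` on a suitable box lies in the interior
(`exists_isEquilibrium`), and strong convexity makes it unique and gives quadratic growth of `φ`
around it.

An update with exact information would decrease `φ` by a fixed fraction of its energy
`p j * (1 + x j) * r ^ 2 / (lam * d)`, where `r` is the relative price change and `d` the time since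
the previous update of that price. An actual update uses an outdated excess demand. The error is
caused by the updates of other prices since the previous update of `p j`; its square is bounded by
the Cauchy-Schwarz inequality, and is charged to the energies of these updates
(`stepBound_le`). The charge of good `k` to good `j` is weighted by
`∑ i, e i * share i j * share i k`, which sums over `j` to the spending on good `k`, and an
update lies in at most one window between consecutive updates of good `j`. So all charges to
one update amount to at most a fortieth of its energy (`sum_sum_charge_le`); here the
condition `lam ≤ 1 / (26 * E)` enters. Therefore `φ` decreases along a run by a multiple of the
energy spent, up to a boundary term from the last unit of time (`phi_le_sub_totalEnergy`).

Prices stay in a box bounded away from `0` for the wanted goods (`exists_inBox`): prices above the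
total budget do not rise, and a wanted good that is nearly the cheapest, and cheap enough, is in
such demand that its price rises. In the box the error `φ - φ*` is bounded by the squared excess
demands, and these by the energy spent in a window of three units of time
(`exists_price_mul_sq_excess_le`). So `φ - φ*` decays geometrically, and quadratic growth
transfers the rate to the prices.
-/

noncomputable section

namespace FisherMarket

variable {n m : ℕ}

/-! ### Scalar inequalities -/

lemma abs_log_one_add_sub_le {r : ℝ} (hr : |r| ≤ 1 / 26) :
    |Real.log (1 + r) - r| ≤ 11 / 20 * r ^ 2 := by
  have h := Real.abs_log_sub_add_sum_range_le (x := -r) (by rw [abs_neg]; linarith) 2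
  simp only [Finset.sum_range_succ, Finset.sum_range_zero, abs_neg, sub_neg_eq_add] at h
  norm_num at h
  have h3 : |r| ^ 3 / (1 - |r|) ≤ 1 / 25 * r ^ 2 := by
    rw [div_le_iff₀ (by linarith), ← sq_abs r]
    nlinarith [sq_nonneg |r|, abs_nonneg r]
  rw [abs_le] at h ⊢
  constructor <;> nlinarith [sq_nonneg r, h.1, h.2]

lemma abs_log_one_add_le {r : ℝ} (hr : |r| ≤ 1 / 26) :
    |Real.log (1 + r)| ≤ 21 / 20 * |r| := by
  have h := abs_log_one_add_sub_le hr
  have h2 : |Real.log (1 + r)| ≤ |Real.log (1 + r) - r| + |r| := by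
    simpa using abs_add_le (Real.log (1 + r) - r) r
  have : r ^ 2 ≤ 1 / 26 * |r| := by
    rw [← sq_abs]; nlinarith [abs_nonneg r]
  nlinarith [abs_nonneg r]

lemma exp_le_quadratic {w : ℝ} (hw : |w| ≤ 1 / 24) :
    Real.exp w ≤ 1 + w + 51 / 100 * w ^ 2 := by
  have h := Real.exp_bound (x := w) (by linarith) (n := 3) (by norm_num)
  simp only [Finset.sum_range_succ, Finset.sum_range_zero] at h
  norm_num [Nat.factorial] at h
  rw [abs_le] at h
  have : |w| ^ 3 ≤ 1 / 24 * w ^ 2 := by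
    rw [← sq_abs w]; nlinarith [sq_nonneg |w|, abs_nonneg w]
  nlinarith [h.2, sq_nonneg w]

/-- The second order upper bound for the power function with a negative exponent. -/
lemma rpow_neg_le_quadratic {α E y : ℝ} (hα : 0 ≤ α) (hE : 1 + α ≤ E)
    (hy : |y - 1| ≤ 1 / (26 * E)) :
    y ^ (-α) ≤ 1 + α * (-(y - 1) + E * (y - 1) ^ 2) := by
  obtain ⟨r, rfl⟩ : ∃ r, y = 1 + r := ⟨y - 1, by ring⟩
  simp only [add_sub_cancel_left] at hy ⊢
  have hE0 : 0 < E := by linarith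
  have hEr : E * |r| ≤ 1 / 26 := by
    rw [le_div_iff₀ (by positivity)] at hy; linarith
  have hr : |r| ≤ 1 / 26 := by nlinarith [abs_nonneg r]
  have har : α * |r| ≤ 1 / 26 := by nlinarith [abs_nonneg r]
  have hpos : 0 < 1 + r := by linarith [(abs_le.1 hr).1]
  have hlog := abs_log_one_add_sub_le hr
  have hlog1 := abs_log_one_add_le hr
  have hab : |-(α * Real.log (1 + r))| ≤ 21 / 20 * (α * |r|) := by
    rw [abs_neg, abs_mul, abs_of_nonneg hα]
    nlinarith
  have h := exp_le_quadratic (w := -(α * Real.log (1 + r))) (by linarith)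
  rw [Real.rpow_def_of_pos hpos,
    show Real.log (1 + r) * -α = -(α * Real.log (1 + r)) by ring]
  refine h.trans ?_
  have hsq : (-(α * Real.log (1 + r))) ^ 2 ≤ (21 / 20) ^ 2 * (α ^ 2 * r ^ 2) := by
    rw [← sq_abs, ← sq_abs r]
    calc _ ≤ (21 / 20 * (α * |r|)) ^ 2 := by gcongr
      _ = _ := by ring
  have h1 : -(α * Real.log (1 + r)) ≤ α * (-r + 11 / 20 * r ^ 2) := by
    nlinarith [(abs_le.1 hlog).1]
  have h2 : α * (1 + α) * r ^ 2 ≤ α * E * r ^ 2 := by gcongr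
  nlinarith [mul_nonneg hα (sq_nonneg r), mul_nonneg (sq_nonneg α) (sq_nonneg r)]

lemma neg_log_le_quadratic {E y : ℝ} (hE : 1 ≤ E) (hy : |y - 1| ≤ 1 / (26 * E)) :
    -Real.log y ≤ -(y - 1) + E * (y - 1) ^ 2 := by
  obtain ⟨r, rfl⟩ : ∃ r, y = 1 + r := ⟨y - 1, by ring⟩
  simp only [add_sub_cancel_left] at hy ⊢
  have hr : |r| ≤ 1 / 26 := hy.trans (by gcongr; linarith)
  have := (abs_le.1 (abs_log_one_add_sub_le hr)).1
  nlinarith [sq_nonneg r]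

/-- A quadratic improvement of `log y ≤ y - 1`. -/
lemma sub_one_sub_log_ge {y : ℝ} (hy : 0 < y) :
    (√y - 1) ^ 2 ≤ (y - 1) - Real.log y := by
  have h := Real.log_le_sub_one_of_pos (Real.sqrt_pos.2 hy)
  rw [Real.log_sqrt hy.le] at h
  nlinarith [Real.sq_sqrt hy.le]

/-- A quadratic improvement of the Bernoulli inequality `y ^ c ≤ 1 + c * (y - 1)`. -/
lemma sub_one_sub_rpow_div_ge {c y : ℝ} (hc : 0 < c) (hc1 : c < 1) (hy : 0 < y) :
    (1 - c) * (√y - 1) ^ 2 ≤ (y - 1) - (y ^ c - 1) / c := by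
  have hs := Real.sqrt_pos.2 hy
  have hyy := Real.sq_sqrt hy.le
  rw [le_sub_iff_add_le, ← le_sub_iff_add_le', div_le_iff₀ hc]
  rcases le_total c (1 / 2) with h | h
  · have h1 := rpow_one_add_le_one_add_mul_self (s := √y - 1) (by linarith)
      (p := 2 * c) (by linarith) (by linarith)
    have h2 : (1 + (√y - 1)) ^ (2 * c) = y ^ c := by
      rw [add_sub_cancel, Real.rpow_mul hs.le, Real.rpow_two, hyy]
    rw [h2] at h1
    nlinarith [mul_nonneg hc.le (mul_nonneg hc.le (sq_nonneg (√y - 1)))]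
  -- `y ^ c` is the weighted geometric mean of `y` and `√y`
  · have h1 := Real.geom_mean_le_arith_mean2_weighted (w₁ := 2 * c - 1) (w₂ := 2 * (1 - c))
      (by linarith) (by linarith) hy.le hs.le (by ring)
    have h2 : y ^ (2 * c - 1) * √y ^ (2 * (1 - c)) = y ^ c := by
      rw [Real.rpow_mul hs.le, Real.rpow_two, hyy, ← Real.rpow_add hy]
      congr 1; ring
    rw [h2] at h1
    nlinarith [mul_nonneg hc.le (mul_nonneg (sub_nonneg.2 hc1.le) (sq_nonneg (√y - 1))),
      mul_nonneg (sub_nonneg.2 hc1.le) (mul_nonneg (sub_nonneg.2 hc1.le) (sq_nonneg (√y - 1)))]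

lemma one_add_mul_lt_rpow_of_neg {ρ y : ℝ} (hρ : ρ < 0) (hy : 0 < y) (hy1 : y ≠ 1) :
    1 + ρ * (y - 1) < y ^ ρ := by
  rw [Real.rpow_def_of_pos hy]
  have h1 := Real.log_lt_sub_one_of_pos hy hy1
  have h2 := Real.add_one_le_exp (Real.log y * ρ)
  nlinarith

lemma one_add_mul_le_rpow_of_neg {ρ y : ℝ} (hρ : ρ < 0) (hy : 0 < y) :
    1 + ρ * (y - 1) ≤ y ^ ρ := by
  by_cases h : y = 1
  · simp [h]
  · exact (one_add_mul_lt_rpow_of_neg hρ hy h).le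

lemma rpow_lt_one_add_mul {ρ y : ℝ} (hρ : 0 < ρ) (hρ1 : ρ < 1) (hy : 0 ≤ y) (hy1 : y ≠ 1) :
    y ^ ρ < 1 + ρ * (y - 1) := by
  have := rpow_one_add_lt_one_add_mul_self (s := y - 1) (by linarith)
    (sub_ne_zero.2 hy1) hρ hρ1
  simpa using this

lemma rpow_le_one_add_mul {ρ y : ℝ} (hρ : 0 < ρ) (hρ1 : ρ < 1) (hy : 0 ≤ y) :
    y ^ ρ ≤ 1 + ρ * (y - 1) := by
  by_cases h : y = 1
  · simp [h]
  · exact (rpow_lt_one_add_mul hρ hρ1 hy h).le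

/-! ### The spending shares of a CES buyer -/

/-- The standing assumptions on the parameters of a CES utility. -/
structure IsCES (ρ : ℝ) (a : Fin n → ℝ) : Prop where
  lt_one : ρ < 1
  nonneg : ∀ j, 0 ≤ a j
  exists_pos : ∃ j, 0 < a j
  sum_eq_one : ρ = 0 → ∑ j, a j = 1

/-- The exponent `c = -ρ / (1 - ρ)` such that a CES buyer spends on good `j` a share of the budget
proportional to `a j ^ (1 / (1 - ρ)) * p j ^ c`. -/
def priceExp (ρ : ℝ) : ℝ := -ρ / (1 - ρ)

/-- The unnormalized spending of a CES buyer on good `j`. -/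
def weight (ρ : ℝ) (a p : Fin n → ℝ) (j : Fin n) : ℝ := a j ^ (1 / (1 - ρ)) * p j ^ priceExp ρ

/-- The normalizing factor of the spending shares. -/
def weightSum (ρ : ℝ) (a p : Fin n → ℝ) : ℝ := ∑ j, weight ρ a p j

/-- The share of the budget that a CES buyer spends on good `j` at the prices `p`. -/
def share (ρ : ℝ) (a p : Fin n → ℝ) (j : Fin n) : ℝ := weight ρ a p j / weightSum ρ a p

section Buyer

variable {ρ : ℝ} {a p p' : Fin n → ℝ}

lemma one_sub_priceExp (h : IsCES ρ a) : 1 - priceExp ρ = 1 / (1 - ρ) := by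
  have : 1 - ρ ≠ 0 := by linarith [h.lt_one]
  unfold priceExp; field_simp; ring

lemma priceExp_lt_one (h : IsCES ρ a) : priceExp ρ < 1 := by
  have := one_sub_priceExp h
  have h2 : 0 < 1 / (1 - ρ) := by have := h.lt_one; apply one_div_pos.2; linarith
  linarith

lemma weight_of_eq_zero (h : IsCES ρ a) {j : Fin n} (hj : a j = 0) : weight ρ a p j = 0 := by
  have : 1 - ρ ≠ 0 := by linarith [h.lt_one]
  rw [weight, hj, Real.zero_rpow (one_div_ne_zero this), zero_mul]

lemma weight_pos (hp : ∀ j, 0 < a j → 0 < p j) {j : Fin n} (hj : 0 < a j) :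
    0 < weight ρ a p j :=
  mul_pos (Real.rpow_pos_of_pos hj _) (Real.rpow_pos_of_pos (hp j hj) _)

lemma weight_nonneg (h : IsCES ρ a) (hp : ∀ j, 0 < a j → 0 < p j) (j : Fin n) :
    0 ≤ weight ρ a p j := by
  rcases (h.nonneg j).eq_or_lt with h0 | h0
  · rw [weight_of_eq_zero h h0.symm]
  · exact (weight_pos hp h0).le

lemma weightSum_pos (h : IsCES ρ a) (hp : ∀ j, 0 < a j → 0 < p j) : 0 < weightSum ρ a p := by
  obtain ⟨j, hj⟩ := h.exists_pos
  exact Finset.sum_pos' (fun k _ => weight_nonneg h hp k) ⟨j, Finset.mem_univ j, weight_pos hp hj⟩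

lemma share_of_eq_zero (h : IsCES ρ a) {j : Fin n} (hj : a j = 0) : share ρ a p j = 0 := by
  rw [share, weight_of_eq_zero h hj, zero_div]

lemma share_pos (h : IsCES ρ a) (hp : ∀ j, 0 < a j → 0 < p j) {j : Fin n} (hj : 0 < a j) :
    0 < share ρ a p j := div_pos (weight_pos hp hj) (weightSum_pos h hp)

lemma share_nonneg (h : IsCES ρ a) (hp : ∀ j, 0 < a j → 0 < p j) (j : Fin n) :
    0 ≤ share ρ a p j := div_nonneg (weight_nonneg h hp j) (weightSum_pos h hp).le

lemma share_sum (h : IsCES ρ a) (hp : ∀ j, 0 < a j → 0 < p j) : ∑ j, share ρ a p j = 1 := by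
  simp only [share, ← Finset.sum_div]
  exact div_self (weightSum_pos h hp).ne'

lemma share_le_one (h : IsCES ρ a) (hp : ∀ j, 0 < a j → 0 < p j) (j : Fin n) :
    share ρ a p j ≤ 1 := by
  rw [← share_sum h hp]
  exact Finset.single_le_sum (fun k _ => share_nonneg h hp k) (Finset.mem_univ j)

lemma weight_change (h : IsCES ρ a) (hp : ∀ j, 0 < a j → 0 < p j)
    (hp' : ∀ j, 0 < a j → 0 < p' j) (j : Fin n) :
    weight ρ a p' j = weight ρ a p j * (p' j / p j) ^ priceExp ρ := by
  rcases (h.nonneg j).eq_or_lt with h0 | h0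
  · rw [weight_of_eq_zero h h0.symm, weight_of_eq_zero h h0.symm, zero_mul]
  · have := Real.rpow_pos_of_pos (hp j h0) (priceExp ρ)
    rw [weight, weight, Real.div_rpow (hp' j h0).le (hp j h0).le]
    field_simp

lemma weightSum_change (h : IsCES ρ a) (hp : ∀ j, 0 < a j → 0 < p j)
    (hp' : ∀ j, 0 < a j → 0 < p' j) :
    weightSum ρ a p' =
      weightSum ρ a p * ∑ k, share ρ a p k * (p' k / p k) ^ priceExp ρ := by
  rw [Finset.mul_sum, weightSum]
  refine Finset.sum_congr rfl fun j _ => ?_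
  have := (weightSum_pos h hp).ne'
  rw [weight_change h hp hp', share]
  field_simp

lemma share_change (h : IsCES ρ a) (hp : ∀ j, 0 < a j → 0 < p j)
    (hp' : ∀ j, 0 < a j → 0 < p' j) (j : Fin n) :
    share ρ a p' j = share ρ a p j * (p' j / p j) ^ priceExp ρ /
      ∑ k, share ρ a p k * (p' k / p k) ^ priceExp ρ := by
  rw [share, weightSum_change h hp hp', weight_change h hp hp', share]
  rw [div_mul_eq_mul_div, div_div]

lemma share_change_denom_pos (h : IsCES ρ a) (hp : ∀ j, 0 < a j → 0 < p j)
    (hp' : ∀ j, 0 < a j → 0 < p' j) :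
    0 < ∑ k, share ρ a p k * (p' k / p k) ^ priceExp ρ := by
  have h1 := weightSum_change h hp hp'
  have h2 := weightSum_pos h hp'
  rw [h1] at h2
  exact pos_of_mul_pos_right h2 (weightSum_pos h hp).le

/-! ### The logarithm of the indirect utility -/

/-- The logarithm of the optimal utility with a unit of spending, in closed form. -/
def logIndirect (ρ : ℝ) (a p : Fin n → ℝ) : ℝ :=
  open Classical in
  if ρ = 0 then ∑ j, a j * (Real.log (a j) - Real.log (p j))
  else (1 - ρ) / ρ * Real.log (weightSum ρ a p)

lemma share_of_rho_zero (h : IsCES ρ a) (hρ : ρ = 0) (j : Fin n) : share ρ a p j = a j := by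
  subst hρ
  simp [share, weight, weightSum, priceExp, h.sum_eq_one rfl]

lemma logIndirect_sub_of_rho_zero (h : IsCES ρ a) (hρ : ρ = 0) (hp : ∀ j, 0 < a j → 0 < p j)
    (hp' : ∀ j, 0 < a j → 0 < p' j) :
    logIndirect ρ a p' - logIndirect ρ a p = ∑ j, share ρ a p j * -Real.log (p' j / p j) := by
  rw [logIndirect, logIndirect, if_pos hρ, if_pos hρ, ← Finset.sum_sub_distrib]
  refine Finset.sum_congr rfl fun j _ => ?_
  rw [share_of_rho_zero h hρ]
  rcases (h.nonneg j).eq_or_lt with h0 | h0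
  · simp [← h0]
  · rw [Real.log_div (hp' j h0).ne' (hp j h0).ne']; ring

lemma logIndirect_sub_of_ne_zero (h : IsCES ρ a) (hρ : ρ ≠ 0) (hp : ∀ j, 0 < a j → 0 < p j)
    (hp' : ∀ j, 0 < a j → 0 < p' j) :
    logIndirect ρ a p' - logIndirect ρ a p =
      -(1 / priceExp ρ) * Real.log (∑ k, share ρ a p k * (p' k / p k) ^ priceExp ρ) := by
  rw [logIndirect, logIndirect, if_neg hρ, if_neg hρ, weightSum_change h hp hp',
    Real.log_mul (weightSum_pos h hp).ne' (share_change_denom_pos h hp hp').ne']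
  have : 1 - ρ ≠ 0 := by linarith [h.lt_one]
  unfold priceExp; field_simp; ring

/-- Jensen's inequality for the logarithm, applied to powers of price ratios. -/
lemma sum_share_log_le (h : IsCES ρ a) (hp : ∀ j, 0 < a j → 0 < p j)
    (hp' : ∀ j, 0 < a j → 0 < p' j) :
    priceExp ρ * ∑ k, share ρ a p k * Real.log (p' k / p k) ≤
      Real.log (∑ k, share ρ a p k * (p' k / p k) ^ priceExp ρ) := by
  set Q := ∑ k, share ρ a p k * (p' k / p k) ^ priceExp ρ with hQ
  have hQ0 : 0 < Q := share_change_denom_pos h hp hp'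
  -- the tangent line of the logarithm at `Q`
  have key : ∀ k, share ρ a p k * (priceExp ρ * Real.log (p' k / p k)) ≤
      share ρ a p k * (Real.log Q + ((p' k / p k) ^ priceExp ρ / Q - 1)) := by
    intro k
    rcases (h.nonneg k).eq_or_lt with h0 | h0
    · simp [share_of_eq_zero h h0.symm]
    · have hy : 0 < p' k / p k := div_pos (hp' k h0) (hp k h0)
      have hyc := Real.rpow_pos_of_pos hy (priceExp ρ)
      have := Real.log_le_sub_one_of_pos (div_pos hyc hQ0)
      rw [Real.log_div hyc.ne' hQ0.ne', Real.log_rpow hy] at this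
      exact mul_le_mul_of_nonneg_left (by linarith) (share_nonneg h hp k)
  have hs := Finset.sum_le_sum (fun k (_ : k ∈ Finset.univ) => key k)
  have e1 : ∑ k, share ρ a p k * (Real.log Q + ((p' k / p k) ^ priceExp ρ / Q - 1)) =
      Real.log Q := by
    have : ∀ k, share ρ a p k * (Real.log Q + ((p' k / p k) ^ priceExp ρ / Q - 1)) =
        share ρ a p k * (Real.log Q - 1) + share ρ a p k * (p' k / p k) ^ priceExp ρ / Q := by
      intro k; ring
    simp only [this, Finset.sum_add_distrib, ← Finset.sum_mul, ← Finset.sum_div,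
      share_sum h hp, ← hQ]
    rw [div_self hQ0.ne']; ring
  rw [e1] at hs
  rw [Finset.mul_sum]
  refine le_trans (le_of_eq ?_) hs
  exact Finset.sum_congr rfl fun k _ => by ring

lemma log_sum_share_le (h : IsCES ρ a) (hp : ∀ j, 0 < a j → 0 < p j)
    (hp' : ∀ j, 0 < a j → 0 < p' j) :
    Real.log (∑ k, share ρ a p k * (p' k / p k) ^ priceExp ρ) ≤
      ∑ k, share ρ a p k * ((p' k / p k) ^ priceExp ρ - 1) := by
  refine (Real.log_le_sub_one_of_pos (share_change_denom_pos h hp hp')).trans (le_of_eq ?_)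
  simp only [mul_sub, mul_one, Finset.sum_sub_distrib, share_sum h hp]

lemma priceExp_ne_zero (h : IsCES ρ a) (hρ : ρ ≠ 0) : priceExp ρ ≠ 0 := by
  have : 1 - ρ ≠ 0 := by linarith [h.lt_one]
  exact div_ne_zero (neg_ne_zero.2 hρ) this

/-- The first order upper bound for the change of the logarithmic indirect utility under a small
price change, with a quadratic error term. -/
lemma logIndirect_sub_le (h : IsCES ρ a) (hp : ∀ j, 0 < a j → 0 < p j)
    {E : ℝ} (hE : 1 ≤ E) (hρE : 1 / (1 - ρ) ≤ E)
    (hy : ∀ j, 0 < a j → |p' j / p j - 1| ≤ 1 / (26 * E)) :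
    logIndirect ρ a p' - logIndirect ρ a p ≤
      ∑ j, share ρ a p j * (-(p' j / p j - 1) + E * (p' j / p j - 1) ^ 2) := by
  have hyp : ∀ j, 0 < a j → 0 < p' j / p j := by
    intro j hj
    have h1 := (abs_le.1 (hy j hj)).1
    have : 1 / (26 * E) ≤ 1 / 26 := by gcongr; linarith
    linarith
  have hp' : ∀ j, 0 < a j → 0 < p' j := by
    intro j hj
    have := mul_pos (hyp j hj) (hp j hj)
    rwa [div_mul_cancel₀ _ (hp j hj).ne'] at this
  have hlog : ∑ j, share ρ a p j * -Real.log (p' j / p j) ≤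
      ∑ j, share ρ a p j * (-(p' j / p j - 1) + E * (p' j / p j - 1) ^ 2) := by
    refine Finset.sum_le_sum fun j _ => ?_
    rcases (h.nonneg j).eq_or_lt with h0 | h0
    · simp [share_of_eq_zero h h0.symm]
    · exact mul_le_mul_of_nonneg_left (neg_log_le_quadratic hE (hy j h0)) (share_nonneg h hp j)
  by_cases hρ : ρ = 0
  · rw [logIndirect_sub_of_rho_zero h hρ hp hp']; exact hlog
  rw [logIndirect_sub_of_ne_zero h hρ hp hp']
  rcases lt_or_gt_of_ne (priceExp_ne_zero h hρ) with hc | hc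
  · have h1 := log_sum_share_le h hp hp'
    have h2 : 0 ≤ -(1 / priceExp ρ) := by
      rw [neg_nonneg]; exact (one_div_neg.2 hc).le
    refine (mul_le_mul_of_nonneg_left h1 h2).trans ?_
    rw [Finset.mul_sum]
    refine Finset.sum_le_sum fun j _ => ?_
    rcases (h.nonneg j).eq_or_lt with h0 | h0
    · simp [share_of_eq_zero h h0.symm]
    · have hq := rpow_neg_le_quadratic (α := -priceExp ρ) (E := E) (by linarith)
        (by have := one_sub_priceExp h; linarith) (hy j h0)
      rw [neg_neg] at hq
      have : -(1 / priceExp ρ) * ((p' j / p j) ^ priceExp ρ - 1) ≤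
          -(p' j / p j - 1) + E * (p' j / p j - 1) ^ 2 := by
        rw [show -(1 / priceExp ρ) * ((p' j / p j) ^ priceExp ρ - 1) =
          ((p' j / p j) ^ priceExp ρ - 1) / -priceExp ρ by field_simp,
          div_le_iff₀ (by linarith)]
        linarith
      calc _ = share ρ a p j * (-(1 / priceExp ρ) * ((p' j / p j) ^ priceExp ρ - 1)) := by ring
        _ ≤ _ := mul_le_mul_of_nonneg_left this (share_nonneg h hp j)
  · refine le_trans ?_ hlog
    have h1 := sum_share_log_le h hp hp'
    simp only [mul_neg, Finset.sum_neg_distrib]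
    rw [neg_mul, neg_le_neg_iff, one_div, ← div_eq_inv_mul, le_div_iff₀ hc]
    linarith

/-- The logarithmic indirect utility is convex in the prices, strongly so in the directions of the
goods on which the buyer spends money. -/
lemma logIndirect_sub_ge (h : IsCES ρ a) (hp : ∀ j, 0 < a j → 0 < p j)
    (hp' : ∀ j, 0 < a j → 0 < p' j) {κ : ℝ} (hκ : κ ≤ 1) (hκρ : κ ≤ 1 / (1 - ρ)) :
    ∑ j, share ρ a p j * (-(p' j / p j - 1) + κ * (√(p' j / p j) - 1) ^ 2) ≤
      logIndirect ρ a p' - logIndirect ρ a p := by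
  have hlog : ∑ j, share ρ a p j * (-(p' j / p j - 1) + κ * (√(p' j / p j) - 1) ^ 2) ≤
      ∑ j, share ρ a p j * -Real.log (p' j / p j) := by
    refine Finset.sum_le_sum fun j _ => ?_
    rcases (h.nonneg j).eq_or_lt with h0 | h0
    · simp [share_of_eq_zero h h0.symm]
    · refine mul_le_mul_of_nonneg_left ?_ (share_nonneg h hp j)
      have := sub_one_sub_log_ge (div_pos (hp' j h0) (hp j h0))
      nlinarith [sq_nonneg (√(p' j / p j) - 1)]
  by_cases hρ : ρ = 0
  · rw [logIndirect_sub_of_rho_zero h hρ hp hp']; exact hlog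
  rw [logIndirect_sub_of_ne_zero h hρ hp hp']
  rcases lt_or_gt_of_ne (priceExp_ne_zero h hρ) with hc | hc
  · refine hlog.trans ?_
    have h1 := sum_share_log_le h hp hp'
    simp only [mul_neg, Finset.sum_neg_distrib]
    rw [neg_mul, neg_le_neg_iff, one_div, ← div_eq_inv_mul, div_le_iff_of_neg hc]
    linarith
  · have h1 := log_sum_share_le h hp hp'
    have h2 : -(1 / priceExp ρ) ≤ 0 := by
      rw [neg_nonpos]; exact (one_div_pos.2 hc).le
    refine le_trans ?_ (mul_le_mul_of_nonpos_left h1 h2)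
    rw [Finset.mul_sum]
    refine Finset.sum_le_sum fun j _ => ?_
    rcases (h.nonneg j).eq_or_lt with h0 | h0
    · simp [share_of_eq_zero h h0.symm]
    · have hq := sub_one_sub_rpow_div_ge hc (priceExp_lt_one h) (div_pos (hp' j h0) (hp j h0))
      rw [one_sub_priceExp h] at hq
      have h3 : κ * (√(p' j / p j) - 1) ^ 2 ≤ 1 / (1 - ρ) * (√(p' j / p j) - 1) ^ 2 := by gcongr
      calc _ ≤ share ρ a p j * (-(((p' j / p j) ^ priceExp ρ - 1) / priceExp ρ)) :=
            mul_le_mul_of_nonneg_left (by linarith) (share_nonneg h hp j)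
        _ = _ := by ring

/-! ### Sensitivity of the spending shares -/

lemma rpow_le_exp_of_abs_log_le {y c r : ℝ} (hy : 0 < y) (hr : |Real.log y| ≤ r) :
    Real.exp (-(|c| * r)) ≤ y ^ c ∧ y ^ c ≤ Real.exp (|c| * r) := by
  rw [Real.rpow_def_of_pos hy]
  have : |Real.log y * c| ≤ |c| * r := by
    rw [abs_mul, mul_comm]; gcongr
  exact ⟨Real.exp_le_exp.2 (abs_le.1 this).1, Real.exp_le_exp.2 (abs_le.1 this).2⟩

/-- If the prices change by factors between `exp (-r)` and `exp r`, the spending shares change at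
most by the factor `exp (2 * |c| * r)`. -/
lemma share_le_exp_mul (h : IsCES ρ a) (hp : ∀ j, 0 < a j → 0 < p j)
    (hp' : ∀ j, 0 < a j → 0 < p' j) {r : ℝ}
    (hr : ∀ j, 0 < a j → |Real.log (p' j / p j)| ≤ r) (j : Fin n) :
    share ρ a p' j ≤ Real.exp (2 * |priceExp ρ| * r) * share ρ a p j := by
  rcases (h.nonneg j).eq_or_lt with h0 | h0
  · simp [share_of_eq_zero h h0.symm]
  have hb : ∀ k, 0 < a k → _ := fun k hk =>
    rpow_le_exp_of_abs_log_le (c := priceExp ρ) (div_pos (hp' k hk) (hp k hk)) (hr k hk)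
  have hQ : Real.exp (-(|priceExp ρ| * r)) ≤ ∑ k, share ρ a p k * (p' k / p k) ^ priceExp ρ := by
    calc Real.exp (-(|priceExp ρ| * r)) =
        ∑ k, share ρ a p k * Real.exp (-(|priceExp ρ| * r)) := by
          rw [← Finset.sum_mul, share_sum h hp, one_mul]
      _ ≤ _ := by
          refine Finset.sum_le_sum fun k _ => ?_
          rcases (h.nonneg k).eq_or_lt with h0 | h0
          · simp [share_of_eq_zero h h0.symm]
          · exact mul_le_mul_of_nonneg_left (hb k h0).1 (share_nonneg h hp k)
  rw [share_change h hp hp', div_le_iff₀ (share_change_denom_pos h hp hp')]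
  have hs := share_nonneg h hp j
  calc share ρ a p j * (p' j / p j) ^ priceExp ρ
      ≤ share ρ a p j * Real.exp (|priceExp ρ| * r) := by gcongr; exact (hb j h0).2
    _ = Real.exp (2 * |priceExp ρ| * r) * share ρ a p j * Real.exp (-(|priceExp ρ| * r)) := by
        rw [mul_right_comm, ← Real.exp_add, mul_comm]; congr 2; ring
    _ ≤ _ := by gcongr

/-- The change of the spending share of a good whose own price does not change, to first order. -/
lemma abs_share_sub_le (h : IsCES ρ a) (hp : ∀ j, 0 < a j → 0 < p j)
    (hp' : ∀ j, 0 < a j → 0 < p' j) {E r : ℝ} {R : Fin n → ℝ} (hE : |priceExp ρ| ≤ E)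
    (hEr : E * r ≤ 1 / 12) (hRr : ∀ k, R k ≤ r)
    (hR : ∀ k, |Real.log (p' k / p k)| ≤ R k) {j : Fin n} (hj : p' j = p j) :
    |share ρ a p' j - share ρ a p j| ≤
      share ρ a p j * (3 / 2 * E * ∑ k, share ρ a p k * R k) := by
  rcases (h.nonneg j).eq_or_lt with h0 | h0
  · simp [share_of_eq_zero h h0.symm]
  have hE0 : 0 ≤ E := (abs_nonneg _).trans hE
  set Q := ∑ k, share ρ a p k * (p' k / p k) ^ priceExp ρ with hQ
  set A := ∑ k, share ρ a p k * R k with hA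
  have hQ0 : 0 < Q := share_change_denom_pos h hp hp'
  have hb : ∀ k, 0 < a k → |(p' k / p k) ^ priceExp ρ - 1| ≤ 13 / 12 * E * R k := by
    intro k hk
    have hy : 0 < p' k / p k := div_pos (hp' k hk) (hp k hk)
    rw [Real.rpow_def_of_pos hy]
    set w := Real.log (p' k / p k) * priceExp ρ
    have hR0 : 0 ≤ R k := (abs_nonneg _).trans (hR k)
    have hw : |w| ≤ E * R k := by
      rw [abs_mul, mul_comm]
      exact mul_le_mul hE (hR k) (abs_nonneg _) hE0
    have hw1 : E * R k ≤ 1 / 12 := (mul_le_mul_of_nonneg_left (hRr k) hE0).trans hEr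
    have h1 := Real.abs_exp_sub_one_sub_id_le (x := w) (by linarith)
    have h2 : |Real.exp w - 1| ≤ |Real.exp w - 1 - w| + |w| := by
      simpa using abs_add_le (Real.exp w - 1 - w) w
    have h3 : w ^ 2 ≤ 1 / 12 * |w| := by
      rw [← sq_abs]; nlinarith [abs_nonneg w]
    nlinarith
  have hQ1 : |Q - 1| ≤ 13 / 12 * E * A := by
    have : Q - 1 = ∑ k, share ρ a p k * ((p' k / p k) ^ priceExp ρ - 1) := by
      simp only [mul_sub, mul_one, Finset.sum_sub_distrib, share_sum h hp, ← hQ]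
    rw [this, hA, Finset.mul_sum]
    refine (Finset.abs_sum_le_sum_abs _ _).trans (Finset.sum_le_sum fun k _ => ?_)
    rw [abs_mul, abs_of_nonneg (share_nonneg h hp k)]
    rcases (h.nonneg k).eq_or_lt with h0 | h0
    · simp [share_of_eq_zero h h0.symm]
    · calc _ ≤ share ρ a p k * (13 / 12 * E * R k) :=
          mul_le_mul_of_nonneg_left (hb k h0) (share_nonneg h hp k)
        _ = _ := by ring
  have hAr : A ≤ r := by
    calc A ≤ ∑ k, share ρ a p k * r :=
          Finset.sum_le_sum fun k _ => mul_le_mul_of_nonneg_left (hRr k) (share_nonneg h hp k)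
      _ = r := by rw [← Finset.sum_mul, share_sum h hp, one_mul]
  have hA0 : 0 ≤ A := Finset.sum_nonneg fun k _ =>
    mul_nonneg (share_nonneg h hp k) ((abs_nonneg _).trans (hR k))
  have hEA : E * A ≤ 1 / 12 := (mul_le_mul_of_nonneg_left hAr hE0).trans hEr
  have hone : (p' j / p j) ^ priceExp ρ = 1 := by rw [hj, div_self (hp j h0).ne', Real.one_rpow]
  have hs := share_nonneg h hp j
  rw [share_change h hp hp', hone, mul_one, ← hQ,
    show share ρ a p j / Q - share ρ a p j = share ρ a p j * ((1 - Q) / Q) by field_simp,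
    abs_mul, abs_of_nonneg hs, abs_div, abs_of_pos hQ0, abs_sub_comm]
  refine mul_le_mul_of_nonneg_left ?_ hs
  rw [div_le_iff₀ hQ0]
  have hQl : 9 / 10 ≤ Q := by linarith [(abs_le.1 hQ1).1]
  nlinarith [mul_nonneg hE0 hA0]

end Buyer

/-! ### The demand of a CES buyer -/

section Demand

variable {ρ : ℝ} {a p x : Fin n → ℝ} {b : ℝ}

/-- The ratio of the spending on good `j` in the bundle `x` and in the optimal bundle. -/
def spendRatio (ρ : ℝ) (a p x : Fin n → ℝ) (b : ℝ) (j : Fin n) : ℝ :=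
  x j * p j / (b * share ρ a p j)

lemma spendRatio_nonneg (h : IsCES ρ a) (hp : ∀ j, 0 < a j → 0 < p j) (hp0 : ∀ j, 0 ≤ p j)
    (hb : 0 < b) (hx : ∀ j, 0 ≤ x j) (j : Fin n) : 0 ≤ spendRatio ρ a p x b j :=
  div_nonneg (mul_nonneg (hx j) (hp0 j)) (mul_nonneg hb.le (share_nonneg h hp j))

lemma spendRatio_pos (h : IsCES ρ a) (hp : ∀ j, 0 < a j → 0 < p j)
    (hb : 0 < b) {j : Fin n} (hj : 0 < a j) (hx : 0 < x j) : 0 < spendRatio ρ a p x b j :=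
  div_pos (mul_pos hx (hp j hj)) (mul_pos hb (share_pos h hp hj))

lemma eq_of_spendRatio_eq_one (h : IsCES ρ a) (hp : ∀ j, 0 < a j → 0 < p j)
    (hb : 0 < b) {j : Fin n} (hj : 0 < a j) (hx : spendRatio ρ a p x b j = 1) :
    x j = b * share ρ a p j / p j := by
  have h1 := mul_pos hb (share_pos h hp hj)
  rw [spendRatio, div_eq_one_iff_eq h1.ne'] at hx
  rw [← hx, mul_div_cancel_right₀ _ (hp j hj).ne']

lemma sum_share_mul_spendRatio_le (h : IsCES ρ a) (hp : ∀ j, 0 < a j → 0 < p j)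
    (hp0 : ∀ j, 0 ≤ p j) (hb : 0 < b) (hx : x ∈ affordable p b) :
    ∑ j, share ρ a p j * spendRatio ρ a p x b j ≤ 1 := by
  calc _ ≤ ∑ j, x j * p j / b := by
        refine Finset.sum_le_sum fun j _ => ?_
        rcases (h.nonneg j).eq_or_lt with h0 | h0
        · rw [share_of_eq_zero h h0.symm, zero_mul]
          exact div_nonneg (mul_nonneg (hx.1 j) (hp0 j)) hb.le
        · have := share_pos h hp h0
          rw [spendRatio]; apply le_of_eq; field_simp
    _ ≤ 1 := by
        rw [← Finset.sum_div, div_le_one hb]; exact hx.2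

/-- The first order condition of the optimal bundle. -/
lemma coeff_mul_rpow_share (h : IsCES ρ a) (hp : ∀ j, 0 < a j → 0 < p j) {j : Fin n}
    (hj : 0 < a j) :
    a j * (share ρ a p j / p j) ^ ρ = weightSum ρ a p ^ (1 - ρ) * share ρ a p j := by
  have hS := weightSum_pos h hp
  have hw := weight_pos (ρ := ρ) hp hj
  have hpj := hp j hj
  have h1ρ : 1 - ρ ≠ 0 := by linarith [h.lt_one]
  have key : weight ρ a p j ^ (1 - ρ) = a j * p j ^ (-ρ) := by
    rw [weight, Real.mul_rpow (Real.rpow_nonneg hj.le _) (Real.rpow_nonneg hpj.le _),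
      ← Real.rpow_mul hj.le, ← Real.rpow_mul hpj.le, one_div_mul_cancel h1ρ, Real.rpow_one,
      priceExp, div_mul_cancel₀ _ h1ρ]
  have h2 : weight ρ a p j = a j * p j ^ (-ρ) * weight ρ a p j ^ ρ := by
    rw [← key, ← Real.rpow_add hw, sub_add_cancel, Real.rpow_one]
  rw [share, Real.div_rpow (div_nonneg hw.le hS.le) hpj.le, Real.div_rpow hw.le hS.le,
    Real.rpow_sub hS, Real.rpow_one]
  have hpρ := Real.rpow_pos_of_pos hpj ρ
  have hSρ := Real.rpow_pos_of_pos hS ρ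
  rw [Real.rpow_neg hpj.le] at h2
  field_simp at h2 ⊢
  linarith

lemma coeff_mul_rpow (h : IsCES ρ a) (hp : ∀ j, 0 < a j → 0 < p j) (hp0 : ∀ j, 0 ≤ p j)
    (hb : 0 < b) (hx : ∀ j, 0 ≤ x j) (j : Fin n) :
    a j * x j ^ ρ = weightSum ρ a p ^ (1 - ρ) * b ^ ρ *
      (share ρ a p j * spendRatio ρ a p x b j ^ ρ) := by
  rcases (h.nonneg j).eq_or_lt with h0 | h0
  · rw [← h0, share_of_eq_zero h h0.symm]; ring
  have hs := share_pos h hp h0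
  have hpj := hp j h0
  have hv := spendRatio_nonneg h hp hp0 hb hx j
  have e : x j = b * spendRatio ρ a p x b j * (share ρ a p j / p j) := by
    rw [spendRatio]; field_simp
  conv_lhs => rw [e]
  rw [Real.mul_rpow (mul_nonneg hb.le hv) (div_nonneg hs.le hpj.le), Real.mul_rpow hb.le hv]
  have := coeff_mul_rpow_share h hp h0
  linear_combination (b ^ ρ * spendRatio ρ a p x b j ^ ρ) * this

lemma cesUtility_of_ne_zero (h : IsCES ρ a) (hp : ∀ j, 0 < a j → 0 < p j) (hp0 : ∀ j, 0 ≤ p j)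
    (hb : 0 < b) (hx : ∀ j, 0 ≤ x j) (hρ : ρ ≠ 0) (hρx : ¬ (ρ < 0 ∧ ∃ j, 0 < a j ∧ x j = 0)) :
    cesUtility ρ a x = b * Real.exp (logIndirect ρ a p) *
      (∑ j, share ρ a p j * spendRatio ρ a p x b j ^ ρ) ^ (1 / ρ) := by
  have hS := weightSum_pos h hp
  have hM : 0 ≤ ∑ j, share ρ a p j * spendRatio ρ a p x b j ^ ρ := Finset.sum_nonneg fun j _ =>
    mul_nonneg (share_nonneg h hp j) (Real.rpow_nonneg (spendRatio_nonneg h hp hp0 hb hx j) _)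
  rw [cesUtility, if_neg hρ, if_neg hρx,
    Finset.sum_congr rfl fun j _ => coeff_mul_rpow h hp hp0 hb hx j, ← Finset.mul_sum,
    Real.mul_rpow (mul_nonneg (Real.rpow_nonneg hS.le _) (Real.rpow_nonneg hb.le _)) hM,
    Real.mul_rpow (Real.rpow_nonneg hS.le _) (Real.rpow_nonneg hb.le _), ← Real.rpow_mul hS.le,
    ← Real.rpow_mul hb.le, mul_one_div_cancel hρ, Real.rpow_one, logIndirect, if_neg hρ,
    mul_comm ((1 - ρ) / ρ), ← Real.rpow_def_of_pos hS, mul_one_div]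
  ring

lemma cesUtility_of_eq_zero (h : IsCES ρ a) (hp : ∀ j, 0 < a j → 0 < p j)
    (hb : 0 < b) (hρ : ρ = 0) (hx : ∀ j, 0 < a j → 0 < x j) :
    cesUtility ρ a x = b * Real.exp (logIndirect ρ a p) *
      Real.exp (∑ j, share ρ a p j * Real.log (spendRatio ρ a p x b j)) := by
  have e1 : ∏ j, x j ^ a j = Real.exp (∑ j, a j * Real.log (x j)) := by
    rw [Real.exp_sum]
    refine Finset.prod_congr rfl fun j _ => ?_
    rcases (h.nonneg j).eq_or_lt with h0 | h0
    · simp [← h0]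
    · rw [Real.rpow_def_of_pos (hx j h0), mul_comm]
  have e2 : ∀ t : ℝ, b * t = Real.exp (Real.log b) * t := fun t => by rw [Real.exp_log hb]
  rw [cesUtility, if_pos hρ, e1, logIndirect, if_pos hρ, e2, ← Real.exp_add, ← Real.exp_add]
  congr 1
  rw [show Real.log b = ∑ j, a j * Real.log b by
    rw [← Finset.sum_mul, h.sum_eq_one hρ, one_mul], ← Finset.sum_add_distrib,
    ← Finset.sum_add_distrib]
  refine Finset.sum_congr rfl fun j _ => ?_
  rw [share_of_rho_zero h hρ]
  rcases (h.nonneg j).eq_or_lt with h0 | h0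
  · simp [← h0]
  · rw [spendRatio, share_of_rho_zero h hρ, Real.log_div (mul_pos (hx j h0) (hp j h0)).ne'
      (mul_pos hb h0).ne', Real.log_mul (hx j h0).ne' (hp j h0).ne', Real.log_mul hb.ne' h0.ne']
    ring

/-- The bundle bought according to the spending shares has the closed-form utility; only the
wanted goods matter. -/
lemma cesUtility_optimal (h : IsCES ρ a) (hp : ∀ j, 0 < a j → 0 < p j) (hp0 : ∀ j, 0 ≤ p j)
    (hb : 0 < b) (hx : ∀ j, 0 ≤ x j) (hv : ∀ j, 0 < a j → spendRatio ρ a p x b j = 1) :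
    cesUtility ρ a x = b * Real.exp (logIndirect ρ a p) := by
  have hxp : ∀ j, 0 < a j → 0 < x j := by
    intro j hj
    rw [eq_of_spendRatio_eq_one h hp hb hj (hv j hj)]
    exact div_pos (mul_pos hb (share_pos h hp hj)) (hp j hj)
  by_cases hρ : ρ = 0
  · rw [cesUtility_of_eq_zero h hp hb hρ hxp, Finset.sum_eq_zero, Real.exp_zero, mul_one]
    intro j _
    rcases (h.nonneg j).eq_or_lt with h0 | h0
    · rw [share_of_eq_zero h h0.symm, zero_mul]
    · rw [hv j h0, Real.log_one, mul_zero]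
  · have : ¬ (ρ < 0 ∧ ∃ j, 0 < a j ∧ x j = 0) := by
      rintro ⟨-, j, hj, hj0⟩; exact (hxp j hj).ne' hj0
    rw [cesUtility_of_ne_zero h hp hp0 hb hx hρ this,
      show ∑ j, share ρ a p j * spendRatio ρ a p x b j ^ ρ = ∑ j, share ρ a p j by
        refine Finset.sum_congr rfl fun j _ => ?_
        rcases (h.nonneg j).eq_or_lt with h0 | h0
        · rw [share_of_eq_zero h h0.symm, zero_mul]
        · rw [hv j h0, Real.one_rpow, mul_one],
      share_sum h hp, Real.one_rpow, mul_one]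

/-- Every other affordable bundle is worse. -/
lemma cesUtility_lt (h : IsCES ρ a) (hp : ∀ j, 0 < a j → 0 < p j) (hp0 : ∀ j, 0 ≤ p j)
    (hb : 0 < b) (hx : x ∈ affordable p b) (hv : ∃ j, 0 < a j ∧ spendRatio ρ a p x b j ≠ 1) :
    cesUtility ρ a x < b * Real.exp (logIndirect ρ a p) := by
  obtain ⟨j₀, hj₀, hv₀⟩ := hv
  have hV : 0 < b * Real.exp (logIndirect ρ a p) := mul_pos hb (Real.exp_pos _)
  have hv0 := spendRatio_nonneg h hp hp0 hb hx.1
  have hsum := sum_share_mul_spendRatio_le h hp hp0 hb hx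
  have hlin : ∀ t : ℝ, ∑ j, share ρ a p j * (1 + t * (spendRatio ρ a p x b j - 1)) =
      1 + t * (∑ j, share ρ a p j * spendRatio ρ a p x b j - 1) := by
    intro t
    have : ∀ j, share ρ a p j * (1 + t * (spendRatio ρ a p x b j - 1)) =
        share ρ a p j * (1 - t) + t * (share ρ a p j * spendRatio ρ a p x b j) := by
      intro j; ring
    simp only [this, Finset.sum_add_distrib, ← Finset.sum_mul, ← Finset.mul_sum, share_sum h hp]
    ring
  by_cases hz : ∃ j, 0 < a j ∧ x j = 0
  · rcases lt_trichotomy ρ 0 with hρ | hρ | hρ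
    · rwa [cesUtility, if_neg hρ.ne, if_pos ⟨hρ, hz⟩]
    · obtain ⟨j, hj, hj0⟩ := hz
      rw [cesUtility, if_pos hρ, Finset.prod_eq_zero (Finset.mem_univ j)]
      · exact hV
      · rw [hj0, Real.zero_rpow hj.ne']
    · have hn : ¬ (ρ < 0 ∧ ∃ j, 0 < a j ∧ x j = 0) := fun hh => by linarith [hh.1]
      rw [cesUtility_of_ne_zero h hp hp0 hb hx.1 hρ.ne' hn]
      apply mul_lt_of_lt_one_right hV
      apply Real.rpow_lt_one _ _ (by positivity)
      · exact Finset.sum_nonneg fun j _ => mul_nonneg (share_nonneg h hp j)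
          (Real.rpow_nonneg (hv0 j) _)
      · calc _ < ∑ j, share ρ a p j * (1 + ρ * (spendRatio ρ a p x b j - 1)) := by
              refine Finset.sum_lt_sum (fun j _ => mul_le_mul_of_nonneg_left
                (rpow_le_one_add_mul hρ h.lt_one (hv0 j)) (share_nonneg h hp j))
                ⟨j₀, Finset.mem_univ _, mul_lt_mul_of_pos_left
                (rpow_lt_one_add_mul hρ h.lt_one (hv0 j₀) hv₀) (share_pos h hp hj₀)⟩
          _ ≤ 1 := by rw [hlin]; nlinarith
  · have hxp : ∀ j, 0 < a j → 0 < x j := fun j hj =>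
      (hx.1 j).lt_of_ne fun h0 => hz ⟨j, hj, h0.symm⟩
    have hvp : ∀ j, 0 < a j → 0 < spendRatio ρ a p x b j := fun j hj =>
      spendRatio_pos h hp hb hj (hxp j hj)
    have hn : ¬ (ρ < 0 ∧ ∃ j, 0 < a j ∧ x j = 0) := fun hh => hz hh.2
    rcases lt_trichotomy ρ 0 with hρ | hρ | hρ
    · rw [cesUtility_of_ne_zero h hp hp0 hb hx.1 hρ.ne hn]
      apply mul_lt_of_lt_one_right hV
      apply Real.rpow_lt_one_of_one_lt_of_neg _ (one_div_neg.2 hρ)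
      calc 1 ≤ ∑ j, share ρ a p j * (1 + ρ * (spendRatio ρ a p x b j - 1)) := by
            rw [hlin]; nlinarith
        _ < _ := by
            refine Finset.sum_lt_sum (fun j _ => ?_)
                ⟨j₀, Finset.mem_univ _, mul_lt_mul_of_pos_left
                (one_add_mul_lt_rpow_of_neg hρ (hvp j₀ hj₀) hv₀) (share_pos h hp hj₀)⟩
            rcases (h.nonneg j).eq_or_lt with h0 | h0
            · simp [share_of_eq_zero h h0.symm]
            · exact mul_le_mul_of_nonneg_left
                (one_add_mul_le_rpow_of_neg hρ (hvp j h0)) (share_nonneg h hp j)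
    · rw [cesUtility_of_eq_zero h hp hb hρ hxp]
      apply mul_lt_of_lt_one_right hV
      rw [Real.exp_lt_one_iff]
      calc _ < ∑ j, share ρ a p j * (spendRatio ρ a p x b j - 1) := by
            refine Finset.sum_lt_sum (fun j _ => ?_)
                ⟨j₀, Finset.mem_univ _, mul_lt_mul_of_pos_left
                (Real.log_lt_sub_one_of_pos (hvp j₀ hj₀) hv₀) (share_pos h hp hj₀)⟩
            rcases (h.nonneg j).eq_or_lt with h0 | h0
            · simp [share_of_eq_zero h h0.symm]
            · exact mul_le_mul_of_nonneg_left
                (Real.log_le_sub_one_of_pos (hvp j h0)) (share_nonneg h hp j)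
        _ ≤ 0 := by
            simp only [mul_sub, mul_one, Finset.sum_sub_distrib, share_sum h hp]
            linarith
    · rw [cesUtility_of_ne_zero h hp hp0 hb hx.1 hρ.ne' hn]
      apply mul_lt_of_lt_one_right hV
      apply Real.rpow_lt_one _ _ (by positivity)
      · exact Finset.sum_nonneg fun j _ => mul_nonneg (share_nonneg h hp j)
          (Real.rpow_nonneg (hv0 j) _)
      · calc _ < ∑ j, share ρ a p j * (1 + ρ * (spendRatio ρ a p x b j - 1)) := by
              refine Finset.sum_lt_sum (fun j _ => mul_le_mul_of_nonneg_left
                (rpow_le_one_add_mul hρ h.lt_one (hv0 j)) (share_nonneg h hp j))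
                ⟨j₀, Finset.mem_univ _, mul_lt_mul_of_pos_left
                (rpow_lt_one_add_mul hρ h.lt_one (hv0 j₀) hv₀) (share_pos h hp hj₀)⟩
          _ ≤ 1 := by rw [hlin]; nlinarith

lemma cesUtility_le (h : IsCES ρ a) (hp : ∀ j, 0 < a j → 0 < p j) (hp0 : ∀ j, 0 ≤ p j)
    (hb : 0 < b) (hx : x ∈ affordable p b) :
    cesUtility ρ a x ≤ b * Real.exp (logIndirect ρ a p) := by
  by_cases hv : ∃ j, 0 < a j ∧ spendRatio ρ a p x b j ≠ 1
  · exact (cesUtility_lt h hp hp0 hb hx hv).le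
  · push Not at hv
    exact (cesUtility_optimal h hp hp0 hb hx.1 hv).le

/-- The bundle that spends the share `share ρ a p j` of the budget on good `j` is optimal. -/
lemma optimal_mem_affordable (h : IsCES ρ a) (hp : ∀ j, 0 < a j → 0 < p j) (hp0 : ∀ j, 0 ≤ p j)
    (hb : 0 < b) : (fun j => b * share ρ a p j / p j) ∈ affordable p b := by
  refine ⟨fun j => div_nonneg (mul_nonneg hb.le (share_nonneg h hp j)) (hp0 j), ?_⟩
  calc _ = ∑ j, b * share ρ a p j := by
        refine Finset.sum_congr rfl fun j _ => ?_
        rcases (h.nonneg j).eq_or_lt with h0 | h0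
        · simp [share_of_eq_zero h h0.symm]
        · exact div_mul_cancel₀ _ (hp j h0).ne'
    _ ≤ b := by rw [← Finset.mul_sum, share_sum h hp, mul_one]

lemma cesUtility_optimal_bundle (h : IsCES ρ a) (hp : ∀ j, 0 < a j → 0 < p j)
    (hp0 : ∀ j, 0 ≤ p j) (hb : 0 < b) :
    cesUtility ρ a (fun j => b * share ρ a p j / p j) = b * Real.exp (logIndirect ρ a p) := by
  refine cesUtility_optimal h hp hp0 hb (optimal_mem_affordable h hp hp0 hb).1 fun j hj => ?_
  have h1 := (hp j hj).ne'
  have h2 := (share_pos h hp hj).ne'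
  rw [spendRatio]; field_simp

/-- The utility is strictly increasing in each wanted good wherever it is positive. -/
lemma cesUtility_lt_update (h : IsCES ρ a) (hx : ∀ j, 0 ≤ x j) (hu : 0 < cesUtility ρ a x)
    {j : Fin n} (hj : 0 < a j) :
    cesUtility ρ a x < cesUtility ρ a (Function.update x j (x j + 1)) := by
  have hle : ∀ k, x k ≤ Function.update x j (x j + 1) k := by
    intro k
    by_cases hk : k = j
    · subst hk; simp
    · simp [hk]
  rcases lt_trichotomy ρ 0 with hρ | hρ | hρ
  · have hz : ¬ (ρ < 0 ∧ ∃ j, 0 < a j ∧ x j = 0) := by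
      intro hh; rw [cesUtility, if_neg hρ.ne, if_pos hh] at hu; exact hu.ne' rfl
    have hxp : ∀ k, 0 < a k → 0 < x k := fun k hk =>
      (hx k).lt_of_ne fun h0 => hz ⟨hρ, k, hk, h0.symm⟩
    have hz' : ¬ (ρ < 0 ∧ ∃ k, 0 < a k ∧ Function.update x j (x j + 1) k = 0) := by
      rintro ⟨-, k, hk, hk0⟩
      linarith [hle k, hxp k hk]
    rw [cesUtility, cesUtility, if_neg hρ.ne, if_neg hz, if_neg hρ.ne, if_neg hz']
    refine Real.rpow_lt_rpow_of_neg ?_ ?_ (one_div_neg.2 hρ)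
    · refine Finset.sum_pos' (fun k _ => mul_nonneg (h.nonneg k) (Real.rpow_nonneg
        ((hx k).trans (hle k)) _)) ⟨j, Finset.mem_univ _, mul_pos hj (Real.rpow_pos_of_pos ?_ _)⟩
      exact (hxp j hj).trans_le (hle j)
    · refine Finset.sum_lt_sum (fun k _ => ?_) ⟨j, Finset.mem_univ _, ?_⟩
      · rcases (h.nonneg k).eq_or_lt with h0 | h0
        · simp [← h0]
        · exact mul_le_mul_of_nonneg_left
            (Real.rpow_le_rpow_of_nonpos (hxp k h0) (hle k) hρ.le) h0.le
      · refine mul_lt_mul_of_pos_left (Real.rpow_lt_rpow_of_neg (hxp j hj) ?_ hρ) hj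
        simp
  · rw [cesUtility, if_pos hρ] at hu ⊢
    rw [cesUtility, if_pos hρ]
    have hxp : ∀ k, 0 < x k ^ a k := fun k => (Real.rpow_nonneg (hx k) _).lt_of_ne
      fun h0 => hu.ne' (Finset.prod_eq_zero (Finset.mem_univ k) h0.symm)
    refine Finset.prod_lt_prod (fun k _ => hxp k)
      (fun k _ => Real.rpow_le_rpow (hx k) (hle k) (h.nonneg k)) ⟨j, Finset.mem_univ _, ?_⟩
    refine Real.rpow_lt_rpow (hx j) ?_ hj
    simp
  · have hz : ∀ y : Fin n → ℝ, ¬ (ρ < 0 ∧ ∃ j, 0 < a j ∧ y j = 0) := fun y hh => by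
      linarith [hh.1]
    rw [cesUtility, cesUtility, if_neg hρ.ne', if_neg (hz _), if_neg hρ.ne', if_neg (hz _)]
    refine Real.rpow_lt_rpow ?_ ?_ (one_div_pos.2 hρ)
    · exact Finset.sum_nonneg fun k _ => mul_nonneg (h.nonneg k) (Real.rpow_nonneg (hx k) _)
    · refine Finset.sum_lt_sum (fun k _ => mul_le_mul_of_nonneg_left
        (Real.rpow_le_rpow (hx k) (hle k) hρ.le) (h.nonneg k)) ⟨j, Finset.mem_univ _, ?_⟩
      refine mul_lt_mul_of_pos_left (Real.rpow_lt_rpow (hx j) ?_ hρ) hj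
      simp

lemma cesUtility_const_pos (h : IsCES ρ a) {t : ℝ} (ht : 0 < t) :
    0 < cesUtility ρ a (fun _ => t) := by
  rw [cesUtility]
  split_ifs with h1 h2
  · exact Finset.prod_pos fun k _ => Real.rpow_pos_of_pos ht _
  · obtain ⟨-, j, -, hj⟩ := h2
    exact absurd hj ht.ne'
  · refine Real.rpow_pos_of_pos ?_ _
    obtain ⟨j, hj⟩ := h.exists_pos
    exact Finset.sum_pos' (fun k _ => mul_nonneg (h.nonneg k) (Real.rpow_nonneg ht.le _))
      ⟨j, Finset.mem_univ _, mul_pos hj (Real.rpow_pos_of_pos ht _)⟩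

end Demand

/-! ### Total demand and the function `φ` -/

namespace CESMarket

variable {M : CESMarket n m} {p p' : Fin n → ℝ}

lemma isCES (hM : ∀ i, M.rho i < 1) (i : Fin m) : IsCES (M.rho i) (M.coeff i) :=
  ⟨hM i, M.coeff_nonneg i, M.exists_coeff_pos i, M.cobbDouglas_sum i⟩

/-- Some buyer wants good `j`. -/
def Wanted (M : CESMarket n m) (j : Fin n) : Prop := ∃ i, 0 < M.coeff i j

/-- Nonnegative prices at which no wanted good is free: the prices at which demands exist. -/
structure Admissible (M : CESMarket n m) (p : Fin n → ℝ) : Prop where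
  nonneg : ∀ j, 0 ≤ p j
  pos : ∀ j, M.Wanted j → 0 < p j

lemma Admissible.of_pos (hp : ∀ j, 0 < p j) : M.Admissible p :=
  ⟨fun j => (hp j).le, fun j _ => hp j⟩

lemma Admissible.pos_of_coeff (hp : M.Admissible p) (i : Fin m) (j : Fin n)
    (hj : 0 < M.coeff i j) : 0 < p j := hp.pos j ⟨i, hj⟩

/-- The share of the budget of buyer `i` that is spent on good `j`. -/
def buyerShare (M : CESMarket n m) (i : Fin m) (p : Fin n → ℝ) (j : Fin n) : ℝ :=
  share (M.rho i) (M.coeff i) p j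

/-- The demand of buyer `i` for good `j`. It is `0` for a good that the buyer does not want. -/
def demand (M : CESMarket n m) (i : Fin m) (p : Fin n → ℝ) (j : Fin n) : ℝ :=
  M.budget i * M.buyerShare i p j / p j

/-- The total demand for good `j`. -/
def totalDemand (M : CESMarket n m) (p : Fin n → ℝ) (j : Fin n) : ℝ := ∑ i, M.demand i p j

lemma buyerShare_nonneg (hM : ∀ i, M.rho i < 1) (hp : M.Admissible p) (i : Fin m) (j : Fin n) :
    0 ≤ M.buyerShare i p j := share_nonneg (isCES hM i) (hp.pos_of_coeff i) j

lemma demand_nonneg (hM : ∀ i, M.rho i < 1) (hp : M.Admissible p) (i : Fin m) (j : Fin n) :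
    0 ≤ M.demand i p j :=
  div_nonneg (mul_nonneg (M.budget_pos i).le (buyerShare_nonneg hM hp i j)) (hp.nonneg j)

lemma totalDemand_nonneg (hM : ∀ i, M.rho i < 1) (hp : M.Admissible p) (j : Fin n) :
    0 ≤ M.totalDemand p j := Finset.sum_nonneg fun i _ => demand_nonneg hM hp i j

lemma demand_of_coeff_eq_zero (hM : ∀ i, M.rho i < 1) {i : Fin m} {j : Fin n}
    (hj : M.coeff i j = 0) : M.demand i p j = 0 := by
  rw [demand, buyerShare, share_of_eq_zero (isCES hM i) hj, mul_zero, zero_div]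

lemma totalDemand_of_not_wanted (hM : ∀ i, M.rho i < 1) {j : Fin n} (hj : ¬ M.Wanted j) :
    M.totalDemand p j = 0 := by
  refine Finset.sum_eq_zero fun i _ => demand_of_coeff_eq_zero hM ?_
  exact ((M.coeff_nonneg i j).eq_or_lt.resolve_right fun h => hj ⟨i, h⟩).symm

lemma demand_mul_price (hM : ∀ i, M.rho i < 1) (hp : M.Admissible p) (i : Fin m) (j : Fin n) :
    M.demand i p j * p j = M.budget i * M.buyerShare i p j := by
  rcases (M.coeff_nonneg i j).eq_or_lt with h0 | h0
  · rw [demand_of_coeff_eq_zero hM h0.symm, buyerShare, share_of_eq_zero (isCES hM i) h0.symm]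
    ring
  · exact div_mul_cancel₀ _ (hp.pos_of_coeff i j h0).ne'

lemma price_mul_totalDemand (hM : ∀ i, M.rho i < 1) (hp : M.Admissible p) (j : Fin n) :
    p j * M.totalDemand p j = ∑ i, M.budget i * M.buyerShare i p j := by
  rw [totalDemand, mul_comm, Finset.sum_mul]
  exact Finset.sum_congr rfl fun i _ => demand_mul_price hM hp i j

lemma price_mul_totalDemand_le (hM : ∀ i, M.rho i < 1) (hp : M.Admissible p) (j : Fin n) :
    p j * M.totalDemand p j ≤ ∑ i, M.budget i := by
  rw [price_mul_totalDemand hM hp]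
  exact Finset.sum_le_sum fun i _ => mul_le_of_le_one_right (M.budget_pos i).le
    (share_le_one (isCES hM i) (hp.pos_of_coeff i) j)

lemma isDemand_demand (hM : ∀ i, M.rho i < 1) (hp : M.Admissible p) (i : Fin m) :
    M.IsDemand p i (M.demand i p) := by
  refine ⟨optimal_mem_affordable (isCES hM i) (hp.pos_of_coeff i) hp.nonneg (M.budget_pos i),
    fun y hy => ?_⟩
  exact (cesUtility_le (isCES hM i) (hp.pos_of_coeff i) hp.nonneg (M.budget_pos i) hy).trans
    (cesUtility_optimal_bundle (isCES hM i) (hp.pos_of_coeff i) hp.nonneg (M.budget_pos i)).ge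

lemma IsDemand.eq_demand (hM : ∀ i, M.rho i < 1) (hp : M.Admissible p) {i : Fin m}
    {x : Fin n → ℝ} (hx : M.IsDemand p i x) {j : Fin n} (hj : 0 < p j) :
    x j = M.demand i p j := by
  have hC := isCES hM i
  have hpi := hp.pos_of_coeff i
  have hb := M.budget_pos i
  have hw : ∀ k, 0 < M.coeff i k → x k = M.demand i p k := by
    intro k hk
    by_contra hne
    have h1 := cesUtility_lt hC hpi hp.nonneg hb hx.1
      ⟨k, hk, fun h1 => hne (eq_of_spendRatio_eq_one hC hpi hb hk h1)⟩
    have h2 := hx.2 _ (isDemand_demand hM hp i).1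
    have h3 := cesUtility_optimal_bundle hC hpi hp.nonneg hb
    exact absurd (h3.symm.trans_le h2) (not_le.2 h1)
  rcases (M.coeff_nonneg i j).eq_or_lt with h0 | h0
  · -- the budget is used up by the wanted goods
    rw [demand_of_coeff_eq_zero hM h0.symm]
    have hsum : ∑ k, x k * p k ≤ ∑ k, M.demand i p k * p k := by
      refine hx.1.2.trans (le_of_eq ?_)
      simp only [demand_mul_price hM hp, ← Finset.mul_sum]
      rw [show ∑ k, M.buyerShare i p k = 1 from share_sum hC hpi, mul_one]
    have hle : ∀ k ∈ Finset.univ, M.demand i p k * p k ≤ x k * p k := by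
      intro k _
      rcases (M.coeff_nonneg i k).eq_or_lt with h0 | h0
      · rw [demand_of_coeff_eq_zero hM h0.symm, zero_mul]
        exact mul_nonneg (hx.1.1 k) (hp.nonneg k)
      · rw [hw k h0]
    have := (Finset.sum_eq_sum_iff_of_le hle).1 (le_antisymm (Finset.sum_le_sum hle) hsum) j
      (Finset.mem_univ j)
    rw [demand_of_coeff_eq_zero hM h0.symm, zero_mul] at this
    exact (mul_eq_zero.1 this.symm).resolve_right hj.ne'
  · exact hw j h0

lemma IsExcessDemand.eq (hM : ∀ i, M.rho i < 1) (hp : M.Admissible p) {z : Fin n → ℝ}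
    (hz : M.IsExcessDemand p z) {j : Fin n} (hj : 0 < p j) : z j = M.totalDemand p j - 1 := by
  obtain ⟨x, hx, hz⟩ := hz
  rw [hz, totalDemand, Finset.sum_congr rfl fun i _ => (hx i).eq_demand hM hp hj]

lemma IsExcessDemand.ge_neg_one {z : Fin n → ℝ}
    (hz : M.IsExcessDemand p z) (j : Fin n) : -1 ≤ z j := by
  obtain ⟨x, hx, hz⟩ := hz
  have : 0 ≤ ∑ i, x i j := Finset.sum_nonneg fun i _ => (hx i).1.1 j
  rw [hz]; linarith

lemma log_indirectUtility (hM : ∀ i, M.rho i < 1) (hp : M.Admissible p) (i : Fin m) :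
    Real.log (M.indirectUtility i p) = logIndirect (M.rho i) (M.coeff i) p := by
  have hC := isCES hM i
  have hpi := hp.pos_of_coeff i
  have hg : IsGreatest (M.utility i '' affordable p 1)
      (Real.exp (logIndirect (M.rho i) (M.coeff i) p)) := by
    refine ⟨⟨_, optimal_mem_affordable hC hpi hp.nonneg one_pos, ?_⟩, ?_⟩
    · rw [utility, cesUtility_optimal_bundle hC hpi hp.nonneg one_pos, one_mul]
    · rintro _ ⟨x, hx, rfl⟩
      have := cesUtility_le hC hpi hp.nonneg one_pos hx
      rwa [one_mul] at this
  rw [indirectUtility, hg.csSup_eq, Real.log_exp]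

lemma phi_eq (hM : ∀ i, M.rho i < 1) (hp : M.Admissible p) :
    M.phi p = ∑ k, p k + ∑ i, M.budget i * logIndirect (M.rho i) (M.coeff i) p := by
  simp only [phi, log_indirectUtility hM hp]

/-- The descent inequality of `φ`: a first order bound with a quadratic error term. -/
lemma phi_sub_le (hM : ∀ i, M.rho i < 1) {E : ℝ} (hE : 1 ≤ E) (hρE : ∀ i, 1 / (1 - M.rho i) ≤ E)
    (hp : M.Admissible p) (hp' : M.Admissible p') (h0 : ∀ j, p j = 0 → p' j = 0)
    (hy : ∀ j, M.Wanted j → |p' j / p j - 1| ≤ 1 / (26 * E)) :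
    M.phi p' - M.phi p ≤ ∑ j, p j * (-(M.totalDemand p j - 1) * (p' j / p j - 1) +
      E * M.totalDemand p j * (p' j / p j - 1) ^ 2) := by
  rw [phi_eq hM hp, phi_eq hM hp', add_sub_add_comm,
    ← Finset.sum_sub_distrib, ← Finset.sum_sub_distrib]
  have h1 : ∑ i, (M.budget i * logIndirect (M.rho i) (M.coeff i) p' -
      M.budget i * logIndirect (M.rho i) (M.coeff i) p) ≤
      ∑ i, ∑ j, M.budget i * M.buyerShare i p j *
        (-(p' j / p j - 1) + E * (p' j / p j - 1) ^ 2) := by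
    refine Finset.sum_le_sum fun i _ => ?_
    rw [← mul_sub]
    have := logIndirect_sub_le (isCES hM i) (hp.pos_of_coeff i) hE (hρE i) (p' := p')
      fun j hj => hy j ⟨i, hj⟩
    refine (mul_le_mul_of_nonneg_left this (M.budget_pos i).le).trans (le_of_eq ?_)
    rw [Finset.mul_sum]
    exact Finset.sum_congr rfl fun j _ => by rw [buyerShare]; ring
  refine (add_le_add_right h1 _).trans (le_of_eq ?_)
  rw [Finset.sum_comm, ← Finset.sum_add_distrib]
  refine Finset.sum_congr rfl fun j _ => ?_
  rw [← Finset.sum_mul, ← price_mul_totalDemand hM hp]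
  by_cases hj : p j = 0
  · simp [hj, h0 j hj]
  · field_simp
    ring

/-- `φ` is convex with gradient minus the excess demand, and strongly convex in the directions of
the goods that are bought. -/
lemma phi_sub_ge (hM : ∀ i, M.rho i < 1) {κ : ℝ} (hκ : κ ≤ 1) (hρκ : ∀ i, κ ≤ 1 / (1 - M.rho i))
    (hp : M.Admissible p) (hp' : M.Admissible p') :
    ∑ j, (-(M.totalDemand p j - 1) * (p' j - p j) +
      κ * M.totalDemand p j * (√(p' j) - √(p j)) ^ 2) ≤ M.phi p' - M.phi p := by
  rw [phi_eq hM hp, phi_eq hM hp', add_sub_add_comm,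
    ← Finset.sum_sub_distrib, ← Finset.sum_sub_distrib]
  have h1 : ∑ i, ∑ j, M.demand i p j *
        (-(p' j - p j) + κ * (√(p' j) - √(p j)) ^ 2) ≤
      ∑ i, (M.budget i * logIndirect (M.rho i) (M.coeff i) p' -
      M.budget i * logIndirect (M.rho i) (M.coeff i) p) := by
    refine Finset.sum_le_sum fun i _ => ?_
    rw [← mul_sub]
    have := logIndirect_sub_ge (isCES hM i) (hp.pos_of_coeff i) (hp'.pos_of_coeff i) hκ (hρκ i)
    refine (le_of_eq ?_).trans (mul_le_mul_of_nonneg_left this (M.budget_pos i).le)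
    rw [Finset.mul_sum]
    refine Finset.sum_congr rfl fun j _ => ?_
    rcases (M.coeff_nonneg i j).eq_or_lt with h0 | h0
    · rw [demand_of_coeff_eq_zero hM h0.symm, share_of_eq_zero (isCES hM i) h0.symm]; ring
    · have hpj := hp.pos_of_coeff i j h0
      have hs := Real.sqrt_pos.2 hpj
      have e1 : √(p' j / p j) = √(p' j) / √(p j) := Real.sqrt_div (hp'.nonneg j) _
      have e2 : p j * (√(p' j / p j) - 1) ^ 2 = (√(p' j) - √(p j)) ^ 2 := by
        rw [e1]; nth_rw 1 [← Real.sq_sqrt hpj.le]; field_simp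
      have e3 : p j * (p' j / p j - 1) = p' j - p j := by field_simp
      rw [← e2, ← e3, demand, buyerShare]
      field_simp
  refine le_trans (le_of_eq ?_) (add_le_add_right h1 _)
  rw [Finset.sum_comm, ← Finset.sum_add_distrib]
  refine Finset.sum_congr rfl fun j _ => ?_
  rw [← Finset.sum_mul, ← totalDemand]
  ring

end CESMarket

/-! ### Existence and uniqueness of the equilibrium -/

/-- Finitely many conditions that each hold for small positive numbers hold for a common one. -/
lemma exists_pos_forall {ι : Type*} [Finite ι] {P : ι → ℝ → Prop}
    (h : ∀ i, ∃ l > 0, ∀ l', 0 < l' → l' ≤ l → P i l') : ∃ l > 0, ∀ i, P i l := by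
  have h1 : ∀ i, ∀ᶠ l in nhdsWithin (0 : ℝ) (Ioi 0), P i l := by
    intro i
    obtain ⟨l, hl, hP⟩ := h i
    filter_upwards [Ioc_mem_nhdsGT hl] with l' hl'
    exact hP l' hl'.1 hl'.2
  obtain ⟨l, hl, hl0⟩ := ((eventually_all.2 h1).and self_mem_nhdsWithin).exists
  exact ⟨l, hl0, hl⟩

/-- A buyer demands a lot of a cheap wanted good, provided that no wanted good is expensive and
none is much cheaper. -/
lemma exists_price_two_le_demand {ρ b u : ℝ} {a : Fin n → ℝ} (h : IsCES ρ a) (hb : 0 < b)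
    (hu : 0 < u) {j : Fin n} (hj : 0 < a j) :
    ∃ l > 0, ∀ p : Fin n → ℝ, (∀ k, 0 < a k → 0 < p k) → (∀ k, 0 < a k → p k ≤ u) →
      (∀ k, 0 < a k → p j ≤ 2 * p k) → p j ≤ l → 2 ≤ b * share ρ a p j / p j := by
  set c := priceExp ρ with hc
  set s := 1 / (1 - ρ) with hs
  have hs0 : s ≠ 0 := by
    have : 1 - ρ ≠ 0 := by linarith [h.lt_one]
    exact one_div_ne_zero this
  have hc1 : c < 1 := priceExp_lt_one h
  set B := ∑ k, a k ^ s with hB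
  have haj : 0 < a j ^ s := Real.rpow_pos_of_pos hj _
  have hB0 : 0 < B := Finset.sum_pos' (fun k _ => Real.rpow_nonneg (h.nonneg k) _)
    ⟨j, Finset.mem_univ _, haj⟩
  have hsum : ∀ (p : Fin n → ℝ) (t : ℝ), (∀ k, 0 < a k → p k ^ c ≤ t) →
      weightSum ρ a p ≤ B * t := by
    intro p t ht
    rw [weightSum, hB, Finset.sum_mul]
    refine Finset.sum_le_sum fun k _ => ?_
    rcases (h.nonneg k).eq_or_lt with h0 | h0
    · rw [weight, ← hs, ← h0, Real.zero_rpow hs0, zero_mul, zero_mul]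
    · exact mul_le_mul_of_nonneg_left (ht k h0) (Real.rpow_nonneg h0.le _)
  rcases le_or_gt c 0 with hc0 | hc0
  · have hδ : 0 < b * (a j ^ s / (B * (1 / 2) ^ c)) := by positivity
    refine ⟨b * (a j ^ s / (B * (1 / 2) ^ c)) / 2, by positivity, fun p hp _ h2 hl => ?_⟩
    have hpj := hp j hj
    have hpc := Real.rpow_pos_of_pos hpj c
    have hS := hsum p ((p j * (1 / 2)) ^ c) fun k hk =>
      Real.rpow_le_rpow_of_nonpos (by positivity) (by linarith [h2 k hk]) hc0
    rw [Real.mul_rpow hpj.le (by norm_num)] at hS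
    have hsh : a j ^ s / (B * (1 / 2) ^ c) ≤ share ρ a p j := by
      rw [share, weight, le_div_iff₀ (weightSum_pos h hp)]
      calc a j ^ s / (B * (1 / 2) ^ c) * weightSum ρ a p
          ≤ a j ^ s / (B * (1 / 2) ^ c) * (B * (p j ^ c * (1 / 2) ^ c)) := by gcongr
        _ = a j ^ s * p j ^ c := by field_simp
    rw [le_div_iff₀ hpj]
    calc 2 * p j ≤ b * (a j ^ s / (B * (1 / 2) ^ c)) := by linarith
      _ ≤ _ := by gcongr
  · have hK : 0 < b * (a j ^ s / (B * u ^ c)) := by positivity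
    set K := b * (a j ^ s / (B * u ^ c)) with hKdef
    refine ⟨(2 / K) ^ (1 / (c - 1)), by positivity, fun p hp hpu _ hl => ?_⟩
    have hpj := hp j hj
    have hS := hsum p (u ^ c) fun k hk => Real.rpow_le_rpow (hp k hk).le (hpu k hk) hc0.le
    have h1 : 2 / K ≤ p j ^ (c - 1) := by
      have := Real.rpow_le_rpow_of_nonpos hpj hl (by linarith : c - 1 ≤ 0)
      rwa [← Real.rpow_mul (by positivity), one_div_mul_cancel (by linarith), Real.rpow_one]
        at this
    have hsh : a j ^ s * p j ^ c / (B * u ^ c) ≤ share ρ a p j := by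
      rw [share, weight]
      exact div_le_div_of_nonneg_left (by positivity) (weightSum_pos h hp) hS
    rw [div_le_iff₀ hK] at h1
    calc 2 ≤ p j ^ (c - 1) * K := h1
      _ = b * (a j ^ s * p j ^ c / (B * u ^ c)) / p j := by
          rw [Real.rpow_sub hpj, Real.rpow_one, hKdef]; ring
      _ ≤ _ := by gcongr

/-- First order condition at a one-sided minimum. -/
lemma nonpos_of_forall_quadratic_nonneg {z A r₀ : ℝ} (hA : 0 ≤ A) (hr₀ : 0 < r₀)
    (h : ∀ r, 0 < r → r ≤ r₀ → 0 ≤ -z * r + A * r ^ 2) : z ≤ 0 := by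
  by_contra! hz
  have hA1 : 0 < A + 1 := by linarith
  have hr : 0 < min r₀ (z / (2 * (A + 1))) := lt_min hr₀ (by positivity)
  have h1 := h _ hr (min_le_left _ _)
  set r := min r₀ (z / (2 * (A + 1)))
  have h2 : r ≤ z / (2 * (A + 1)) := min_le_right _ _
  rw [le_div_iff₀ (by positivity)] at h2
  have h3 : 0 ≤ r * (-z + A * r) := by linarith
  have h4 := nonneg_of_mul_nonneg_right h3 hr
  nlinarith

namespace CESMarket

variable {M : CESMarket n m} {p p' : Fin n → ℝ}

lemma exists_price_two_le_totalDemand (hM : ∀ i, M.rho i < 1) {u : ℝ} (hu : 0 < u) :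
    ∃ l > 0, ∀ p, M.Admissible p → (∀ k, M.Wanted k → p k ≤ u) →
      ∀ j, M.Wanted j → (∀ k, M.Wanted k → p j ≤ 2 * p k) → p j ≤ l →
        2 ≤ M.totalDemand p j := by
  have h : ∀ ij : Fin m × Fin n, ∃ l > 0, ∀ l', 0 < l' → l' ≤ l →
      (0 < M.coeff ij.1 ij.2 → ∀ p, M.Admissible p → (∀ k, M.Wanted k → p k ≤ u) →
        (∀ k, M.Wanted k → p ij.2 ≤ 2 * p k) → p ij.2 ≤ l' → 2 ≤ M.demand ij.1 p ij.2) := by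
    rintro ⟨i, j⟩
    by_cases hj : 0 < M.coeff i j
    · obtain ⟨l, hl, hl2⟩ := exists_price_two_le_demand (isCES hM i) (M.budget_pos i) hu hj
      exact ⟨l, hl, fun l' _ hl' _ p hp hpu hp2 hpl => hl2 p (hp.pos_of_coeff i)
        (fun k hk => hpu k ⟨i, hk⟩) (fun k hk => hp2 k ⟨i, hk⟩) (hpl.trans hl')⟩
    · exact ⟨1, one_pos, fun _ _ _ h => absurd h hj⟩
  obtain ⟨l, hl, hP⟩ := exists_pos_forall h
  refine ⟨l, hl, fun p hp hpu j hj hp2 hpl => ?_⟩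
  obtain ⟨i, hi⟩ := hj
  exact (hP (i, j) hi p hp hpu hp2 hpl).trans (Finset.single_le_sum
    (fun k _ => demand_nonneg hM hp k j) (Finset.mem_univ i))

lemma exists_convexity_constant (hM : ∀ i, M.rho i < 1) :
    ∃ κ > 0, κ ≤ 1 ∧ ∀ i, κ ≤ 1 / (1 - M.rho i) := by
  obtain ⟨κ, hκ, h⟩ := exists_pos_forall (ι := Fin m)
    (P := fun i κ => κ ≤ 1 / (1 - M.rho i)) fun i => by
      have : 0 < 1 - M.rho i := by linarith [hM i]
      exact ⟨1 / (1 - M.rho i), by positivity, fun _ _ h => h⟩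
  exact ⟨min κ 1, lt_min hκ one_pos, min_le_right _ _, fun i => (min_le_left _ _).trans (h i)⟩

lemma exists_elasticity_bound (hM : ∀ i, M.rho i < 1) :
    ∃ E : ℝ, 1 ≤ E ∧ ∀ i, 1 / (1 - M.rho i) ≤ E := by
  refine ⟨1 + ∑ i, 1 / (1 - M.rho i), ?_, fun i => ?_⟩
  · have : 0 ≤ ∑ i, 1 / (1 - M.rho i) := Finset.sum_nonneg fun i _ => by
      have : 0 < 1 - M.rho i := by linarith [hM i]
      positivity
    linarith
  · have : 1 / (1 - M.rho i) ≤ ∑ i, 1 / (1 - M.rho i) :=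
      Finset.single_le_sum (f := fun i => 1 / (1 - M.rho i)) (fun i _ => by
        have : 0 < 1 - M.rho i := by linarith [hM i]
        positivity) (Finset.mem_univ i)
    linarith

/-- Wanted goods have positive prices in equilibrium: a free wanted good would have infinite
demand. -/
lemma IsEquilibrium.admissible (hM : ∀ i, M.rho i < 1) (hp : M.IsEquilibrium p) :
    M.Admissible p := by
  obtain ⟨hp0, x, hx, -⟩ := hp
  refine ⟨hp0, fun j ⟨i, hi⟩ => ?_⟩
  by_contra hj
  have hj0 : p j = 0 := le_antisymm (not_lt.1 hj) (hp0 j)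
  have hC := isCES hM i
  have hsum : 0 ≤ ∑ k, p k := Finset.sum_nonneg fun k _ => hp0 k
  have ht : 0 < M.budget i / (1 + ∑ k, p k) := div_pos (M.budget_pos i) (by linarith)
  have hu : 0 < M.utility i (x i) := by
    refine (cesUtility_const_pos hC ht).trans_le ((hx i).2 _ ⟨fun _ => ht.le, ?_⟩)
    rw [← Finset.mul_sum, div_mul_eq_mul_div, div_le_iff₀ (by linarith)]
    nlinarith [M.budget_pos i]
  have h1 := cesUtility_lt_update hC (hx i).1.1 hu hi
  refine absurd ((hx i).2 _ ⟨fun k => ?_, ?_⟩) (not_le.2 h1)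
  · by_cases hk : k = j
    · subst hk; simp; linarith [(hx i).1.1 k]
    · simpa [hk] using (hx i).1.1 k
  · refine le_trans (le_of_eq (Finset.sum_congr rfl fun k _ => ?_)) (hx i).1.2
    by_cases hk : k = j
    · subst hk; rw [hj0, mul_zero, mul_zero]
    · simp [hk]

/-- Equilibria are the prices at which wanted goods are fully sold and the others are free. -/
lemma isEquilibrium_iff (hM : ∀ i, M.rho i < 1) :
    M.IsEquilibrium p ↔ M.Admissible p ∧ (∀ j, M.Wanted j → M.totalDemand p j = 1) ∧
      ∀ j, ¬ M.Wanted j → p j = 0 := by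
  constructor
  · intro hp
    have hA := hp.admissible hM
    obtain ⟨hp0, x, hx, hs⟩ := hp
    have ht : ∀ j, 0 < p j → M.totalDemand p j = 1 := by
      intro j hj
      rw [totalDemand, ← (hs j).1 hj]
      exact Finset.sum_congr rfl fun i _ => ((hx i).eq_demand hM hA hj).symm
    refine ⟨hA, fun j hj => ht j (hA.pos j hj), fun j hj => ?_⟩
    by_contra h0
    have h1 := ht j ((hp0 j).lt_of_ne (Ne.symm h0))
    rw [totalDemand_of_not_wanted hM hj] at h1
    exact zero_ne_one h1
  · rintro ⟨hA, h1, h0⟩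
    refine ⟨hA.nonneg, fun i => M.demand i p, fun i => isDemand_demand hM hA i, fun j => ⟨?_, ?_⟩⟩
    · intro hj
      exact h1 j (by by_contra hw; exact hj.ne' (h0 j hw))
    · intro hj
      have hw : ¬ M.Wanted j := fun hw => (hA.pos j hw).ne' hj
      have := totalDemand_of_not_wanted (p := p) hM hw
      rw [totalDemand] at this
      rw [this]; exact zero_le_one

/-- Quadratic growth of `φ` around an equilibrium. -/
lemma IsEquilibrium.quadratic_growth (hM : ∀ i, M.rho i < 1) {κ : ℝ} (hκ : κ ≤ 1)
    (hρκ : ∀ i, κ ≤ 1 / (1 - M.rho i)) (hp : M.IsEquilibrium p) (hp' : M.Admissible p') :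
    κ * ∑ j, (√(p' j) - √(p j)) ^ 2 ≤ M.phi p' - M.phi p := by
  obtain ⟨hA, h1, h0⟩ := (isEquilibrium_iff hM).1 hp
  refine le_trans ?_ (phi_sub_ge hM hκ hρκ hA hp')
  rw [Finset.mul_sum]
  refine Finset.sum_le_sum fun j _ => ?_
  by_cases hj : M.Wanted j
  · rw [h1 j hj]; apply le_of_eq; ring
  · have := hp'.nonneg j
    rw [totalDemand_of_not_wanted hM hj, h0 j hj, Real.sqrt_zero, sub_zero,
      Real.sq_sqrt (hp'.nonneg j)]
    nlinarith

lemma IsEquilibrium.unique (hM : ∀ i, M.rho i < 1) (hp : M.IsEquilibrium p)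
    (hp' : M.IsEquilibrium p') : p' = p := by
  obtain ⟨κ, hκ, hκ1, hκρ⟩ := exists_convexity_constant hM
  have h1 := hp.quadratic_growth hM hκ1 hκρ (hp'.admissible hM)
  have h2 := hp'.quadratic_growth hM hκ1 hκρ (hp.admissible hM)
  have h3 : 0 ≤ ∑ j, (√(p j) - √(p' j)) ^ 2 := Finset.sum_nonneg fun _ _ => sq_nonneg _
  have h4 : 0 ≤ κ * ∑ j, (√(p j) - √(p' j)) ^ 2 := mul_nonneg hκ.le h3
  have h5 : ∑ j, (√(p' j) - √(p j)) ^ 2 ≤ 0 := by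
    by_contra! h
    nlinarith [mul_pos hκ h]
  funext j
  have h6 := (Finset.sum_eq_zero_iff_of_nonneg fun j _ => sq_nonneg (√(p' j) - √(p j))).1
    (le_antisymm h5 (Finset.sum_nonneg fun _ _ => sq_nonneg _)) j (Finset.mem_univ j)
  have h7 : √(p' j) = √(p j) := by nlinarith
  have := congrArg (· ^ 2) h7
  simpa [Real.sq_sqrt (hp.1 j), Real.sq_sqrt (hp'.1 j)] using this

lemma continuousOn_phi (hM : ∀ i, M.rho i < 1) {K : Set (Fin n → ℝ)}
    (hK : ∀ p ∈ K, M.Admissible p) : ContinuousOn M.phi K := by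
  refine ContinuousOn.congr (f := fun p => ∑ k, p k +
    ∑ i, M.budget i * logIndirect (M.rho i) (M.coeff i) p) ?_ fun p hp => phi_eq hM (hK p hp)
  refine ContinuousOn.add (by fun_prop) (continuousOn_finsetSum _ fun i _ =>
    continuousOn_const.mul ?_)
  have hC := isCES hM i
  by_cases hρ : M.rho i = 0
  · unfold logIndirect
    simp only [if_pos hρ]
    refine continuousOn_finsetSum _ fun j _ => ?_
    rcases (M.coeff_nonneg i j).eq_or_lt with h0 | h0
    · simp only [← h0, zero_mul]; exact continuousOn_const
    · exact continuousOn_const.mul (continuousOn_const.sub (ContinuousOn.log (by fun_prop)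
        fun p hp => ((hK p hp).pos_of_coeff i j h0).ne'))
  · unfold logIndirect
    simp only [if_neg hρ]
    refine continuousOn_const.mul (ContinuousOn.log ?_
      fun p hp => (weightSum_pos hC ((hK p hp).pos_of_coeff i)).ne')
    refine continuousOn_finsetSum _ fun j _ => ?_
    rcases (M.coeff_nonneg i j).eq_or_lt with h0 | h0
    · exact (continuousOn_const (c := (0 : ℝ))).congr fun p _ => weight_of_eq_zero hC h0.symm
    · exact continuousOn_const.mul (ContinuousOn.rpow_const (by fun_prop)
        fun p hp => Or.inl ((hK p hp).pos_of_coeff i j h0).ne')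

/-- If small changes of the price of good `j` in the direction `s = ±1` do not decrease `φ`, the
excess demand for good `j` does not point in this direction. -/
lemma excess_mul_sign_nonpos (hM : ∀ i, M.rho i < 1) (hp : M.Admissible p) {j : Fin n}
    (hj : 0 < p j) {s r₀ : ℝ} (hs : s ^ 2 = 1) (hr₀ : 0 < r₀)
    (hmin : ∀ r, 0 < r → r ≤ r₀ →
      M.phi p ≤ M.phi (Function.update p j (p j * (1 + s * r)))) :
    (M.totalDemand p j - 1) * s ≤ 0 := by
  obtain ⟨E, hE, hρE⟩ := exists_elasticity_bound hM
  have hE26 : 0 < 1 / (26 * E) := by positivity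
  have hx := totalDemand_nonneg hM hp j
  refine nonpos_of_forall_quadratic_nonneg (A := E * M.totalDemand p j)
    (r₀ := min r₀ (1 / (26 * E))) (by positivity) (lt_min hr₀ hE26) fun r hr hr' => ?_
  have hsa : |s| = 1 := by rw [← sq_abs] at hs; nlinarith [abs_nonneg s]
  have hr1 : |s * r| ≤ 1 / (26 * E) := by
    rw [abs_mul, hsa, one_mul, abs_of_pos hr]; exact hr'.trans (min_le_right _ _)
  have h26 : 1 / (26 * E) ≤ 1 / 26 := by gcongr; linarith
  have hpos : 0 < 1 + s * r := by linarith [(abs_le.1 hr1).1]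
  set p' := Function.update p j (p j * (1 + s * r)) with hp'
  have hratio : ∀ k, k ≠ j → p' k = p k := fun k hk => by simp [hp', hk]
  have hj' : p' j = p j * (1 + s * r) := by simp [hp']
  have hA' : M.Admissible p' := by
    constructor
    · intro k
      by_cases hk : k = j
      · subst hk; rw [hj']; positivity
      · rw [hratio k hk]; exact hp.nonneg k
    · intro k hw
      by_cases hk : k = j
      · subst hk; rw [hj']; positivity
      · rw [hratio k hk]; exact hp.pos k hw
  have hq : p' j / p j - 1 = s * r := by rw [hj']; field_simp; ring
  have h1 := phi_sub_le hM hE hρE hp hA' (fun k hk => by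
    have : k ≠ j := by rintro rfl; exact hj.ne' hk
    rw [hratio k this, hk]) (fun k hw => by
    by_cases hk : k = j
    · subst hk; rw [hq]; exact hr1
    · rw [hratio k hk, div_self (hp.pos k hw).ne', sub_self, abs_zero]; exact hE26.le)
  rw [Finset.sum_eq_single j (fun k _ hk => by
    by_cases h0 : p k = 0
    · rw [h0, zero_mul]
    · rw [hratio k hk, div_self h0]; ring) (fun h => absurd (Finset.mem_univ j) h), hq] at h1
  have h2 := hmin r hr (hr'.trans (min_le_left _ _))
  have h3 := nonneg_of_mul_nonneg_right ((sub_nonneg.2 h2).trans h1) hj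
  have h4 : (s * r) ^ 2 = r ^ 2 := by rw [mul_pow, hs, one_mul]
  rw [h4] at h3
  linarith

/-- The minimizer of `φ` over a box of prices is an equilibrium, because the excess demands point
into the box. -/
theorem exists_isEquilibrium (hM : ∀ i, M.rho i < 1) : ∃ p, M.IsEquilibrium p := by
  classical
  have hb : 0 ≤ ∑ i, M.budget i := Finset.sum_nonneg fun i _ => (M.budget_pos i).le
  -- at the price `u` less than one unit of a good is demanded
  set u := 2 * ∑ i, M.budget i + 1 with hu
  have hu0 : 0 < u := by linarith
  obtain ⟨l', hl', hlow⟩ := exists_price_two_le_totalDemand hM hu0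
  set l := min l' (u / 2)
  have hl : 0 < l := lt_min hl' (by linarith)
  have hlu : l < u := (min_le_right _ _).trans_lt (by linarith)
  set lo : Fin n → ℝ := fun j => if M.Wanted j then l else 0 with hlo
  set hi : Fin n → ℝ := fun j => if M.Wanted j then u else 0 with hhi
  have hlohi : lo ≤ hi := by
    intro j
    simp only [hlo, hhi]
    split_ifs
    · exact hlu.le
    · exact le_rfl
  have hbox : ∀ p ∈ Icc lo hi, (∀ j, M.Wanted j → l ≤ p j ∧ p j ≤ u) ∧
      ∀ j, ¬ M.Wanted j → p j = 0 := by
    intro p hp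
    refine ⟨fun j hj => ?_, fun j hj => ?_⟩
    · have h1 := hp.1 j
      have h2 := hp.2 j
      simp only [hlo, hhi, if_pos hj] at h1 h2
      exact ⟨h1, h2⟩
    · have h1 := hp.1 j
      have h2 := hp.2 j
      simp only [hlo, hhi, if_neg hj] at h1 h2
      exact le_antisymm h2 h1
  have hadm : ∀ p ∈ Icc lo hi, M.Admissible p := by
    intro p hp
    have h1 := (hbox p hp).1
    refine ⟨fun j => ?_, fun j hj => hl.trans_le (h1 j hj).1⟩
    by_cases hj : M.Wanted j
    · exact hl.le.trans (h1 j hj).1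
    · exact ((hbox p hp).2 j hj).ge
  obtain ⟨p, hp, hmin⟩ := isCompact_Icc.exists_isMinOn (nonempty_Icc.2 hlohi)
    (continuousOn_phi hM hadm)
  have hA := hadm p hp
  have hpb := (hbox p hp).1
  refine ⟨p, (isEquilibrium_iff hM).2 ⟨hA, fun j hj => ?_, (hbox p hp).2⟩⟩
  have hpj := hA.pos j hj
  have hupd : ∀ v, l ≤ v → v ≤ u → M.phi p ≤ M.phi (Function.update p j v) := by
    intro v h1 h2
    refine hmin ⟨fun k => ?_, fun k => ?_⟩
    · by_cases hk : k = j
      · subst hk; simpa [hlo, hj] using h1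
      · simpa [hk] using hp.1 k
    · by_cases hk : k = j
      · subst hk; simpa [hhi, hj] using h2
      · simpa [hk] using hp.2 k
  have hup : p j < u → M.totalDemand p j ≤ 1 := by
    intro h
    have := excess_mul_sign_nonpos hM hA hpj (s := 1) (r₀ := (u - p j) / p j) (by norm_num)
      (div_pos (by linarith) hpj) fun r hr hr' => by
        rw [le_div_iff₀ hpj] at hr'
        exact hupd _ (by nlinarith [(hpb j hj).1]) (by linarith)
    linarith
  have hdown : l < p j → 1 ≤ M.totalDemand p j := by
    intro h
    have := excess_mul_sign_nonpos hM hA hpj (s := -1) (r₀ := (p j - l) / p j) (by norm_num)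
      (div_pos (by linarith) hpj) fun r hr hr' => by
        rw [le_div_iff₀ hpj] at hr'
        exact hupd _ (by linarith) (by nlinarith [(hpb j hj).2])
    linarith
  rcases (hpb j hj).2.eq_or_lt with h | h
  · have h1 := hdown (by rw [h]; exact hlu)
    have h2 := price_mul_totalDemand_le hM hA j
    rw [h] at h2
    nlinarith
  · rcases (hpb j hj).1.eq_or_lt with h' | h'
    · have h1 := hup h
      have h2 := hlow p hA (fun k hk => (hpb k hk).2) j hj
        (fun k hk => by linarith [(hpb k hk).1]) (h' ▸ min_le_left _ _)
      linarith
    · exact le_antisymm (hup h) (hdown h')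

end CESMarket

/-! ### Update schedules -/

/-- A sequence of update times that starts at time `0`, has gaps at most `1`, and has finitely many
terms in bounded time. -/
structure IsSchedule (u : ℕ → ℝ) : Prop where
  zero : u 0 = 0
  strictMono : StrictMono u
  tendsto : Tendsto u atTop atTop
  gap : ∀ k, u (k + 1) - u k ≤ 1

/-- The number of updates at times `≤ t`; the update number `k` takes place at time `u (k + 1)`. -/
def countLE (u : ℕ → ℝ) (t : ℝ) : ℕ := sInf {k | t < u (k + 1)}

/-- The number of updates at times `< t`. -/
def countLT (u : ℕ → ℝ) (t : ℝ) : ℕ := sInf {k | t ≤ u (k + 1)}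

namespace IsSchedule

variable {u : ℕ → ℝ} {s t : ℝ} {k : ℕ}

lemma lt_countLE_iff (hu : IsSchedule u) : k < countLE u t ↔ u (k + 1) ≤ t := by
  constructor
  · intro h
    have := Nat.notMem_of_lt_sInf h
    simpa using this
  · intro h
    have hne : {k | t < u (k + 1)}.Nonempty := by
      obtain ⟨N, hN⟩ := (hu.tendsto.eventually_gt_atTop t).exists
      exact ⟨N, hN.trans (hu.strictMono N.lt_succ_self)⟩
    have hm : t < u (countLE u t + 1) := Nat.sInf_mem hne
    by_contra! hk
    have := hu.strictMono.monotone (Nat.add_le_add_right hk 1)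
    linarith

lemma lt_countLT_iff (hu : IsSchedule u) : k < countLT u t ↔ u (k + 1) < t := by
  constructor
  · intro h
    have := Nat.notMem_of_lt_sInf h
    simpa using this
  · intro h
    have hne : {k | t ≤ u (k + 1)}.Nonempty := by
      obtain ⟨N, hN⟩ := (hu.tendsto.eventually_gt_atTop t).exists
      exact ⟨N, (hN.trans (hu.strictMono N.lt_succ_self)).le⟩
    have hm : t ≤ u (countLT u t + 1) := Nat.sInf_mem hne
    by_contra! hk
    have := hu.strictMono.monotone (Nat.add_le_add_right hk 1)
    linarith

lemma lt_time_countLE_succ (hu : IsSchedule u) (t : ℝ) : t < u (countLE u t + 1) := by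
  by_contra! h
  exact lt_irrefl _ (hu.lt_countLE_iff.2 h)

lemma le_time_countLT_succ (hu : IsSchedule u) (t : ℝ) : t ≤ u (countLT u t + 1) := by
  by_contra! h
  exact lt_irrefl _ (hu.lt_countLT_iff.2 h)

lemma time_countLE_le (hu : IsSchedule u) (ht : 0 ≤ t) : u (countLE u t) ≤ t := by
  rcases Nat.eq_zero_or_pos (countLE u t) with h | h
  · rw [h, hu.zero]; exact ht
  · obtain ⟨k, hk⟩ := Nat.exists_eq_succ_of_ne_zero h.ne'
    rw [hk]
    exact hu.lt_countLE_iff.1 (hk ▸ k.lt_succ_self)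

lemma time_countLT_lt (hu : IsSchedule u) (ht : 0 < t) : u (countLT u t) < t := by
  rcases Nat.eq_zero_or_pos (countLT u t) with h | h
  · rw [h, hu.zero]; exact ht
  · obtain ⟨k, hk⟩ := Nat.exists_eq_succ_of_ne_zero h.ne'
    rw [hk]
    exact hu.lt_countLT_iff.1 (hk ▸ k.lt_succ_self)

lemma sub_one_lt_time_countLE (hu : IsSchedule u) (t : ℝ) : t - 1 < u (countLE u t) := by
  linarith [hu.lt_time_countLE_succ t, hu.gap (countLE u t)]

lemma sub_one_le_time_countLT (hu : IsSchedule u) (t : ℝ) : t - 1 ≤ u (countLT u t) := by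
  linarith [hu.le_time_countLT_succ t, hu.gap (countLT u t)]

lemma countLE_mono (hu : IsSchedule u) (h : s ≤ t) : countLE u s ≤ countLE u t := by
  by_contra! hlt
  exact lt_irrefl _ (hu.lt_countLE_iff.2 ((hu.lt_countLE_iff.1 hlt).trans h))

lemma countLT_mono (hu : IsSchedule u) (h : s ≤ t) : countLT u s ≤ countLT u t := by
  by_contra! hlt
  exact lt_irrefl _ (hu.lt_countLT_iff.2 ((hu.lt_countLT_iff.1 hlt).trans_le h))

lemma countLT_le_countLE (hu : IsSchedule u) (t : ℝ) : countLT u t ≤ countLE u t := by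
  by_contra! hlt
  exact lt_irrefl _ (hu.lt_countLE_iff.2 (hu.lt_countLT_iff.1 hlt).le)

lemma countLE_le_countLT (hu : IsSchedule u) (h : s < t) : countLE u s ≤ countLT u t := by
  by_contra! hlt
  exact lt_irrefl _ (hu.lt_countLT_iff.2 ((hu.lt_countLE_iff.1 hlt).trans_lt h))

lemma countLE_time (hu : IsSchedule u) (k : ℕ) : countLE u (u k) = k := by
  apply le_antisymm
  · by_contra! h
    exact lt_irrefl _ ((hu.strictMono k.lt_succ_self).trans_le (hu.lt_countLE_iff.1 h))
  · rcases Nat.eq_zero_or_pos k with h | h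
    · omega
    · obtain ⟨l, rfl⟩ := Nat.exists_eq_succ_of_ne_zero h.ne'
      exact hu.lt_countLE_iff.2 le_rfl

lemma countLT_time_succ (hu : IsSchedule u) (k : ℕ) : countLT u (u (k + 1)) = k := by
  apply le_antisymm
  · by_contra! h
    exact lt_irrefl _ (hu.lt_countLT_iff.1 h)
  · by_contra! h
    have := hu.le_time_countLT_succ (u (k + 1))
    have h2 := hu.strictMono (Nat.add_lt_add_right h 1)
    linarith

lemma time_nonneg (hu : IsSchedule u) (k : ℕ) : 0 ≤ u k := by
  rw [← hu.zero]; exact hu.strictMono.monotone k.zero_le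

end IsSchedule

/-! ### Asynchronous tatonnement -/

/-- The time between the updates number `k - 1` and `k` to the price of good `j`. -/
def dur (time : Fin n → ℕ → ℝ) (j : Fin n) (k : ℕ) : ℝ := time j (k + 1) - time j k

/-- The relative change of the price of good `j` in the update number `k`. -/
def relStep (time : Fin n → ℕ → ℝ) (p : ℝ → Fin n → ℝ) (j : Fin n) (k : ℕ) : ℝ :=
  (p (time j (k + 1)) j - p (time j k) j) / p (time j k) j

/-- The prices just before time `t`. -/
def leftPrice (time : Fin n → ℕ → ℝ) (p : ℝ → Fin n → ℝ) (t : ℝ) (j : Fin n) : ℝ :=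
  p (time j (countLT (time j) t)) j

namespace CESMarket.IsAsyncTatonnement

variable {M : CESMarket n m} {lam : ℝ} {p₀ : Fin n → ℝ} {time : Fin n → ℕ → ℝ}
  {p : ℝ → Fin n → ℝ}

lemma isSchedule (H : M.IsAsyncTatonnement lam p₀ time p) (j : Fin n) : IsSchedule (time j) :=
  ⟨H.time_zero j, H.time_strictMono j, H.time_tendsto j, H.time_gap j⟩

/-- The price of good `j` at time `t` was set by the latest update up to time `t`. -/
lemma price_eq (H : M.IsAsyncTatonnement lam p₀ time p) {t : ℝ} (ht : 0 ≤ t) (j : Fin n) :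
    p t j = p (time j (countLE (time j) t)) j :=
  H.const j _ t ⟨(H.isSchedule j).time_countLE_le ht, (H.isSchedule j).lt_time_countLE_succ t⟩

lemma dur_pos (H : M.IsAsyncTatonnement lam p₀ time p) (j : Fin n) (k : ℕ) : 0 < dur time j k :=
  sub_pos.2 (H.time_strictMono j k.lt_succ_self)

lemma dur_le_one (H : M.IsAsyncTatonnement lam p₀ time p) (j : Fin n) (k : ℕ) :
    dur time j k ≤ 1 := H.time_gap j k

lemma sum_dur {k l : ℕ} (h : k ≤ l) (j : Fin n) :
    ∑ i ∈ Finset.Ico k l, dur time j i = time j l - time j k := by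
  simp only [dur]; exact Finset.sum_Ico_sub _ h

/-- A property of prices that holds initially, and is preserved by each update provided that it
held at all earlier times, holds at all times. -/
lemma forall_price (H : M.IsAsyncTatonnement lam p₀ time p) {B : Fin n → ℝ → Prop}
    (h0 : ∀ j, B j (p₀ j))
    (hstep : ∀ j k, (∀ t, 0 ≤ t → t < time j (k + 1) → ∀ i, B i (p t i)) →
      B j (p (time j (k + 1)) j)) {t : ℝ} (ht : 0 ≤ t) (j : Fin n) : B j (p t j) := by
  have key : ∀ N : ℕ, ∀ t : ℝ, 0 ≤ t → ∑ i, countLE (time i) t = N → ∀ j, B j (p t j) := by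
    intro N
    induction N using Nat.strong_induction_on with
    | _ N ih =>
      intro t ht hN j
      rw [H.price_eq ht j]
      have hu := H.isSchedule j
      have hle := hu.time_countLE_le ht
      rcases Nat.eq_zero_or_pos (countLE (time j) t) with hk | hk
      · rw [hk, hu.zero, H.initial]; exact h0 j
      · obtain ⟨k, hk'⟩ := Nat.exists_eq_succ_of_ne_zero hk.ne'
        rw [hk'] at hle ⊢
        refine hstep j k fun s hs hst => ?_
        refine ih (∑ i, countLE (time i) s) ?_ s hs rfl
        rw [← hN]
        refine Finset.sum_lt_sum
          (fun i _ => (H.isSchedule i).countLE_mono (hst.le.trans hle)) ⟨j, Finset.mem_univ j, ?_⟩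
        rw [hk', Nat.lt_succ_iff]
        have := hu.countLE_le_countLT hst
        rwa [hu.countLT_time_succ] at this
  exact key _ t ht rfl j

lemma price_pos (H : M.IsAsyncTatonnement lam p₀ time p) (hlam : 0 < lam) (hlam1 : lam < 1)
    (hp₀ : ∀ j, 0 < p₀ j) {t : ℝ} (ht : 0 ≤ t) (j : Fin n) : 0 < p t j := by
  refine H.forall_price (B := fun _ x => 0 < x) hp₀ (fun j k hprev => ?_) ht j
  obtain ⟨zt, ⟨s, -, z, hz, hzt⟩, -, hupd⟩ := H.update j k
  have h1 : -1 ≤ min zt 1 := le_min ((hz.ge_neg_one j).trans hzt) (by norm_num)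
  have hd := H.dur_pos j k
  have hd1 := H.dur_le_one j k
  rw [hupd]
  refine mul_pos (hprev _ ((H.isSchedule j).time_nonneg k) (H.time_strictMono j k.lt_succ_self) j)
    ?_
  have : -(lam * dur time j k) ≤ lam * min zt 1 * dur time j k := by
    nlinarith [mul_pos hlam hd]
  rw [dur] at this hd hd1
  nlinarith

/-- The update rule, with the excess demands in closed form. -/
lemma update_spec (H : M.IsAsyncTatonnement lam p₀ time p) (hM : ∀ i, M.rho i < 1)
    (hlam : 0 < lam) (hlam1 : lam < 1) (hp₀ : ∀ j, 0 < p₀ j) (j : Fin n) (k : ℕ) :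
    ∃ zt : ℝ, -1 ≤ zt ∧
      (∃ s ∈ Ioo (time j k) (time j (k + 1)), M.totalDemand (p s) j - 1 ≤ zt) ∧
      (∃ s ∈ Ioo (time j k) (time j (k + 1)), zt ≤ M.totalDemand (p s) j - 1) ∧
      relStep time p j k = lam * min zt 1 * dur time j k := by
  have hpos : ∀ s ∈ Ioo (time j k) (time j (k + 1)), ∀ i, 0 < p s i := fun s hs i =>
    H.price_pos hlam hlam1 hp₀ (((H.isSchedule j).time_nonneg k).trans hs.1.le) i
  obtain ⟨zt, ⟨s, hs, z, hz, hzt⟩, ⟨s', hs', z', hz', hzt'⟩, hupd⟩ := H.update j k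
  refine ⟨zt, (hz.ge_neg_one j).trans hzt, ⟨s, hs, ?_⟩, ⟨s', hs', ?_⟩, ?_⟩
  · rwa [← hz.eq hM (Admissible.of_pos (hpos s hs)) (hpos s hs j)]
  · rwa [← hz'.eq hM (Admissible.of_pos (hpos s' hs')) (hpos s' hs' j)]
  · have := (H.price_pos hlam hlam1 hp₀ ((H.isSchedule j).time_nonneg k) j).ne'
    rw [relStep, hupd, dur]
    field_simp
    ring

lemma abs_relStep_le (H : M.IsAsyncTatonnement lam p₀ time p) (hM : ∀ i, M.rho i < 1)
    (hlam : 0 < lam) (hlam1 : lam < 1) (hp₀ : ∀ j, 0 < p₀ j) (j : Fin n) (k : ℕ) :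
    |relStep time p j k| ≤ lam * dur time j k := by
  obtain ⟨zt, hzt, -, -, hr⟩ := H.update_spec hM hlam hlam1 hp₀ j k
  have h1 : -1 ≤ min zt 1 := le_min hzt (by norm_num)
  have h2 : min zt 1 ≤ 1 := min_le_right _ _
  have := mul_pos hlam (H.dur_pos j k)
  rw [hr, abs_le]
  constructor <;> nlinarith

lemma leftPrice_pos (H : M.IsAsyncTatonnement lam p₀ time p) (hlam : 0 < lam) (hlam1 : lam < 1)
    (hp₀ : ∀ j, 0 < p₀ j) (t : ℝ) (j : Fin n) : 0 < leftPrice time p t j :=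
  H.price_pos hlam hlam1 hp₀ ((H.isSchedule j).time_nonneg _) j

lemma leftPrice_time (H : M.IsAsyncTatonnement lam p₀ time p) (j : Fin n) (k : ℕ) :
    leftPrice time p (time j (k + 1)) j = p (time j k) j := by
  rw [leftPrice, (H.isSchedule j).countLT_time_succ]

/-- The total relative change of a price bounds the change of its logarithm. -/
lemma abs_log_price_div_le (H : M.IsAsyncTatonnement lam p₀ time p) (hM : ∀ i, M.rho i < 1)
    (hlam : 0 < lam) (hlam1 : lam ≤ 1 / 26) (hp₀ : ∀ j, 0 < p₀ j) (j : Fin n) {k l : ℕ}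
    (h : k ≤ l) :
    |Real.log (p (time j l) j / p (time j k) j)| ≤
      21 / 20 * ∑ i ∈ Finset.Ico k l, |relStep time p j i| := by
  have hpos : ∀ i, 0 < p (time j i) j := fun i =>
    H.price_pos hlam (by linarith) hp₀ ((H.isSchedule j).time_nonneg i) j
  rw [Real.log_div (hpos l).ne' (hpos k).ne',
    ← Finset.sum_Ico_sub (fun i => Real.log (p (time j i) j)) h, Finset.mul_sum]
  refine (Finset.abs_sum_le_sum_abs _ _).trans (Finset.sum_le_sum fun i _ => ?_)
  rw [← Real.log_div (hpos _).ne' (hpos _).ne']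
  have h1 : p (time j (i + 1)) j / p (time j i) j = 1 + relStep time p j i := by
    have := (hpos i).ne'
    rw [relStep]; field_simp; ring
  rw [h1]
  refine abs_log_one_add_le ((H.abs_relStep_le hM hlam (by linarith) hp₀ j i).trans ?_)
  nlinarith [H.dur_le_one j i, H.dur_pos j i]

lemma sum_abs_relStep_le (H : M.IsAsyncTatonnement lam p₀ time p) (hM : ∀ i, M.rho i < 1)
    (hlam : 0 < lam) (hlam1 : lam < 1) (hp₀ : ∀ j, 0 < p₀ j) (j : Fin n) {k l : ℕ}
    (h : k ≤ l) :
    ∑ i ∈ Finset.Ico k l, |relStep time p j i| ≤ lam * (time j l - time j k) := by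
  rw [← sum_dur h, Finset.mul_sum]
  exact Finset.sum_le_sum fun i _ => H.abs_relStep_le hM hlam hlam1 hp₀ j i

/-- By the Cauchy-Schwarz inequality, the squared total change of a price is controlled by the
sum of `relStep ^ 2 / dur`. -/
lemma sq_sum_abs_relStep_le (H : M.IsAsyncTatonnement lam p₀ time p) (j : Fin n) {k l : ℕ}
    (h : k ≤ l) :
    (∑ i ∈ Finset.Ico k l, |relStep time p j i|) ^ 2 ≤
      (time j l - time j k) * ∑ i ∈ Finset.Ico k l, relStep time p j i ^ 2 / dur time j i := by
  rw [← sum_dur h]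
  refine Finset.sum_sq_le_sum_mul_sum_of_sq_le_mul _ (fun i _ => (H.dur_pos j i).le)
    (fun i _ => div_nonneg (sq_nonneg _) (H.dur_pos j i).le) fun i _ => le_of_eq ?_
  rw [sq_abs, mul_div_cancel₀ _ (H.dur_pos j i).ne']

/-! ### The change of `φ` along a run -/

/-- The bound for the change of `φ` in the update number `k` of the price of good `j`. -/
def stepBound (M : CESMarket n m) (E : ℝ) (time : Fin n → ℕ → ℝ) (p : ℝ → Fin n → ℝ)
    (j : Fin n) (k : ℕ) : ℝ :=
  p (time j k) j *
    (-(M.totalDemand (leftPrice time p (time j (k + 1))) j - 1) * relStep time p j k +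
      E * M.totalDemand (leftPrice time p (time j (k + 1))) j * relStep time p j k ^ 2)

/-- All updates that take place at the time `t`, which may affect several prices, together. -/
lemma phi_le_phi_leftPrice_add (H : M.IsAsyncTatonnement lam p₀ time p) (hM : ∀ i, M.rho i < 1)
    {E : ℝ} (hE : 1 ≤ E) (hρE : ∀ i, 1 / (1 - M.rho i) ≤ E)
    (hlam : 0 < lam) (hlamE : lam ≤ 1 / (26 * E)) (hp₀ : ∀ j, 0 < p₀ j) {t : ℝ} (ht : 0 < t) :
    M.phi (p t) ≤ M.phi (leftPrice time p t) +
      ∑ j, ∑ k ∈ Finset.Ico (countLT (time j) t) (countLE (time j) t),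
        stepBound M E time p j k := by
  have hE26 : 1 / (26 * E) ≤ 1 / 26 := by gcongr; linarith
  have hlam1 : lam < 1 := by linarith
  have hl := H.leftPrice_pos hlam hlam1 hp₀ t
  have hpt := fun j => H.price_pos hlam hlam1 hp₀ ht.le j
  -- either there is no update of good `j` at time `t`, or exactly one
  have hcase : ∀ j, (countLT (time j) t = countLE (time j) t ∧ p t j = leftPrice time p t j) ∨
      (countLE (time j) t = countLT (time j) t + 1 ∧ time j (countLT (time j) t + 1) = t) := by
    intro j
    have hu := H.isSchedule j
    rcases (hu.countLT_le_countLE t).eq_or_lt with h | h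
    · left; exact ⟨h, by rw [H.price_eq ht.le, leftPrice, h]⟩
    · right
      have h1 : time j (countLT (time j) t + 1) = t :=
        le_antisymm (hu.lt_countLE_iff.1 h) (hu.le_time_countLT_succ t)
      refine ⟨?_, h1⟩
      conv_lhs => rw [← h1]
      exact hu.countLE_time _
  have hratio : ∀ j, countLE (time j) t = countLT (time j) t + 1 →
      p t j / leftPrice time p t j - 1 = relStep time p j (countLT (time j) t) := by
    intro j hj
    have h2 := (hl j).ne'
    rw [leftPrice] at h2
    rw [H.price_eq ht.le, hj, leftPrice, relStep]
    field_simp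
  have h1 := phi_sub_le hM hE hρE (Admissible.of_pos hl) (Admissible.of_pos hpt)
    (fun j h => absurd h (hl j).ne') (fun j _ => by
      rcases hcase j with ⟨-, h⟩ | ⟨h, -⟩
      · rw [h, div_self (hl j).ne', sub_self, abs_zero]; positivity
      · rw [hratio j h]
        refine (H.abs_relStep_le hM hlam hlam1 hp₀ j _).trans ?_
        nlinarith [H.dur_le_one j (countLT (time j) t), H.dur_pos j (countLT (time j) t)])
  rw [sub_le_iff_le_add'] at h1
  refine h1.trans (add_le_add_right (Finset.sum_le_sum fun j _ => le_of_eq ?_) _)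
  rcases hcase j with ⟨h, h'⟩ | ⟨h, h'⟩
  · rw [h, Finset.Ico_self, Finset.sum_empty, h', div_self (hl j).ne']; ring
  · rw [hratio j h, h, Nat.Ico_succ_singleton, Finset.sum_singleton, stepBound, h', leftPrice]

lemma phi_le_phi_add_sum (H : M.IsAsyncTatonnement lam p₀ time p) (hM : ∀ i, M.rho i < 1)
    {E : ℝ} (hE : 1 ≤ E) (hρE : ∀ i, 1 / (1 - M.rho i) ≤ E)
    (hlam : 0 < lam) (hlamE : lam ≤ 1 / (26 * E)) (hp₀ : ∀ j, 0 < p₀ j) {a : ℝ} (ha : 0 ≤ a) :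
    ∀ b, a ≤ b → M.phi (p b) ≤ M.phi (p a) +
      ∑ j, ∑ k ∈ Finset.Ico (countLE (time j) a) (countLE (time j) b),
        stepBound M E time p j k := by
  have hu := H.isSchedule
  have key : ∀ N : ℕ, ∀ b, a ≤ b → ∑ i, countLE (time i) b = N → M.phi (p b) ≤ M.phi (p a) +
      ∑ j, ∑ k ∈ Finset.Ico (countLE (time j) a) (countLE (time j) b),
        stepBound M E time p j k := by
    intro N
    induction N using Nat.strong_induction_on with
    | _ N ih =>
      intro b hab hN
      have hb : 0 ≤ b := ha.trans hab
      by_cases hall : ∀ j, countLE (time j) b = countLE (time j) a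
      · have : p b = p a := by
          funext j; rw [H.price_eq hb, H.price_eq ha, hall]
        simp [this, hall]
      push Not at hall
      obtain ⟨j₀, hj₀⟩ := hall
      have hj₀' : countLE (time j₀) a < countLE (time j₀) b :=
        lt_of_le_of_ne ((hu j₀).countLE_mono hab) (Ne.symm hj₀)
      -- `τ` is the time of the last update up to `b`
      have hne : (Finset.univ : Finset (Fin n)).Nonempty := ⟨j₀, Finset.mem_univ _⟩
      obtain ⟨j₁, -, hj₁⟩ := Finset.exists_max_image Finset.univ
        (fun j => time j (countLE (time j) b)) hne
      set τ := time j₁ (countLE (time j₁) b) with hτ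
      have hτb : τ ≤ b := (hu j₁).time_countLE_le hb
      have haτ : a < τ := by
        refine lt_of_lt_of_le ?_ (hj₁ j₀ (Finset.mem_univ _))
        exact ((hu j₀).lt_time_countLE_succ a).trans_le ((hu j₀).strictMono.monotone hj₀')
      have hτ0 : 0 < τ := ha.trans_lt haτ
      have hcτ : ∀ j, countLE (time j) τ = countLE (time j) b := fun j =>
        le_antisymm ((hu j).countLE_mono hτb) (by
          have := (hu j).countLE_mono (hj₁ j (Finset.mem_univ _))
          rwa [(hu j).countLE_time] at this)
      have hpb : p b = p τ := by
        funext j; rw [H.price_eq hb, H.price_eq hτ0.le, hcτ]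
      -- at the time `b'` all updates before `τ` have been made
      obtain ⟨j₂, -, hj₂⟩ := Finset.exists_max_image Finset.univ
        (fun j => time j (countLT (time j) τ)) hne
      set b' := max a (time j₂ (countLT (time j₂) τ)) with hb'
      have hb'τ : b' < τ := max_lt haτ ((hu j₂).time_countLT_lt hτ0)
      have hab' : a ≤ b' := le_max_left _ _
      have hcb' : ∀ j, countLE (time j) b' = countLT (time j) τ := fun j =>
        le_antisymm ((hu j).countLE_le_countLT hb'τ) (by
          have := (hu j).countLE_mono
            ((hj₂ j (Finset.mem_univ _)).trans (le_max_right a _))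
          rwa [(hu j).countLE_time] at this)
      have hpb' : p b' = leftPrice time p τ := by
        funext j; rw [H.price_eq (ha.trans hab'), hcb', leftPrice]
      have hlt : ∑ i, countLE (time i) b' < N := by
        rw [← hN]
        refine Finset.sum_lt_sum (fun i _ => (hu i).countLE_mono (hb'τ.le.trans hτb))
          ⟨j₁, Finset.mem_univ _, ?_⟩
        by_contra! h
        have h1 := (hu j₁).strictMono.monotone h
        have h2 := (hu j₁).time_countLE_le (ha.trans hab')
        linarith
      have h1 := ih _ hlt b' hab' rfl
      have h2 := H.phi_le_phi_leftPrice_add hM hE hρE hlam hlamE hp₀ hτ0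
      rw [← hpb', ← hpb] at h2
      refine (h2.trans (add_le_add_left h1 _)).trans (le_of_eq ?_)
      rw [add_assoc, ← Finset.sum_add_distrib]
      congr 1
      refine Finset.sum_congr rfl fun j _ => ?_
      rw [hcb', hcτ]
      exact Finset.sum_Ico_consecutive _ (hcb' j ▸ (hu j).countLE_mono hab')
        (hcτ j ▸ (hu j).countLT_le_countLE τ)
  exact fun b hab => key _ b hab rfl

end CESMarket.IsAsyncTatonnement

/-! ### Sensitivity of the total demand -/

lemma abs_priceExp_le {ρ E : ℝ} {a : Fin n → ℝ} (h : IsCES ρ a) (hE : 1 ≤ E)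
    (hρE : 1 / (1 - ρ) ≤ E) : |priceExp ρ| ≤ E := by
  have h1 := one_sub_priceExp h
  have h2 := priceExp_lt_one h
  rw [abs_le]
  constructor <;> linarith

namespace CESMarket

variable {M : CESMarket n m} {q q' : Fin n → ℝ}

/-- The strength of the interaction of the goods `j` and `k`: the sum over all buyers of the
budget times the product of the spending shares. -/
def interaction (M : CESMarket n m) (q : Fin n → ℝ) (j k : Fin n) : ℝ :=
  ∑ i, M.budget i * (M.buyerShare i q j * M.buyerShare i q k)

lemma interaction_nonneg (hM : ∀ i, M.rho i < 1) (hq : M.Admissible q) (j k : Fin n) :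
    0 ≤ M.interaction q j k := Finset.sum_nonneg fun i _ => mul_nonneg (M.budget_pos i).le
  (mul_nonneg (buyerShare_nonneg hM hq i j) (buyerShare_nonneg hM hq i k))

lemma sum_interaction (hM : ∀ i, M.rho i < 1) (hq : M.Admissible q) (k : Fin n) :
    ∑ j, M.interaction q j k = q k * M.totalDemand q k := by
  rw [price_mul_totalDemand hM hq]
  simp only [interaction]
  rw [Finset.sum_comm]
  refine Finset.sum_congr rfl fun i _ => ?_
  rw [← Finset.mul_sum, ← Finset.sum_mul,
    show ∑ j, M.buyerShare i q j = 1 from share_sum (isCES hM i) (hq.pos_of_coeff i), one_mul]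

lemma abs_totalDemand_sub_le (hM : ∀ i, M.rho i < 1) {E : ℝ} (hE : 1 ≤ E)
    (hρE : ∀ i, 1 / (1 - M.rho i) ≤ E) (hq : M.Admissible q) (hq' : M.Admissible q')
    {r : ℝ} {R : Fin n → ℝ} (hEr : E * r ≤ 1 / 12) (hRr : ∀ k, R k ≤ r)
    (hR : ∀ k, |Real.log (q' k / q k)| ≤ R k) {j : Fin n} (hj : q' j = q j) :
    |M.totalDemand q' j - M.totalDemand q j| ≤
      3 / 2 * E * ∑ i, M.demand i q j * ∑ k, M.buyerShare i q k * R k := by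
  rw [totalDemand, totalDemand, ← Finset.sum_sub_distrib, Finset.mul_sum]
  refine (Finset.abs_sum_le_sum_abs _ _).trans (Finset.sum_le_sum fun i _ => ?_)
  have h := abs_share_sub_le (isCES hM i) (hq.pos_of_coeff i) (hq'.pos_of_coeff i)
    (abs_priceExp_le (isCES hM i) hE (hρE i)) hEr hRr hR hj
  have hb : 0 ≤ M.budget i / q j := div_nonneg (M.budget_pos i).le (hq.nonneg j)
  have e1 : M.demand i q' j - M.demand i q j =
      M.budget i / q j * (M.buyerShare i q' j - M.buyerShare i q j) := by
    rw [demand, demand, hj]; ring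
  rw [e1, abs_mul, abs_of_nonneg hb]
  refine (mul_le_mul_of_nonneg_left h hb).trans (le_of_eq ?_)
  simp only [demand, buyerShare]; ring

lemma sum_buyerShare_mul_le (hM : ∀ i, M.rho i < 1) (hq : M.Admissible q) {r : ℝ}
    {R : Fin n → ℝ} (hRr : ∀ k, R k ≤ r) (i : Fin m) :
    ∑ k, M.buyerShare i q k * R k ≤ r := by
  calc _ ≤ ∑ k, M.buyerShare i q k * r := Finset.sum_le_sum fun k _ =>
        mul_le_mul_of_nonneg_left (hRr k) (buyerShare_nonneg hM hq i k)
    _ = r := by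
        rw [← Finset.sum_mul,
          show ∑ j, M.buyerShare i q j = 1 from share_sum (isCES hM i) (hq.pos_of_coeff i),
          one_mul]

lemma price_mul_sq_sum_demand_le (hM : ∀ i, M.rho i < 1) (hq : M.Admissible q)
    (R : Fin n → ℝ) (j : Fin n) :
    q j * (∑ i, M.demand i q j * ∑ k, M.buyerShare i q k * R k) ^ 2 ≤
      M.totalDemand q j * ∑ k, M.interaction q j k * R k ^ 2 := by
  have hsh := fun i k => buyerShare_nonneg hM hq i k
  have hd := fun i => demand_nonneg hM hq i j
  have h1 : ∀ i, (∑ k, M.buyerShare i q k * R k) ^ 2 ≤ ∑ k, M.buyerShare i q k * R k ^ 2 := by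
    intro i
    have := Finset.sum_sq_le_sum_mul_sum_of_sq_le_mul Finset.univ
      (r := fun k => M.buyerShare i q k * R k) (f := fun k => M.buyerShare i q k)
      (g := fun k => M.buyerShare i q k * R k ^ 2) (fun k _ => hsh i k)
      (fun k _ => mul_nonneg (hsh i k) (sq_nonneg _)) (fun k _ => le_of_eq (by ring))
    rwa [show ∑ j, M.buyerShare i q j = 1 from share_sum (isCES hM i) (hq.pos_of_coeff i),
      one_mul] at this
  have h2 := Finset.sum_sq_le_sum_mul_sum_of_sq_le_mul Finset.univ
    (r := fun i => M.demand i q j * ∑ k, M.buyerShare i q k * R k) (f := fun i => M.demand i q j)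
    (g := fun i => M.demand i q j * ∑ k, M.buyerShare i q k * R k ^ 2) (fun i _ => hd i)
    (fun i _ => mul_nonneg (hd i) ((sq_nonneg _).trans (h1 i)))
    (fun i _ => by
      rw [mul_pow]
      nlinarith [mul_le_mul_of_nonneg_left (h1 i) (mul_nonneg (hd i) (hd i))])
  refine (mul_le_mul_of_nonneg_left h2 (hq.nonneg j)).trans (le_of_eq ?_)
  rw [← totalDemand, mul_left_comm]
  congr 1
  simp only [interaction, Finset.sum_mul]
  rw [Finset.sum_comm, Finset.mul_sum]
  refine Finset.sum_congr rfl fun i _ => ?_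
  rw [← mul_assoc, mul_comm (q j), demand_mul_price hM hq, Finset.mul_sum]
  exact Finset.sum_congr rfl fun k _ => by ring

lemma interaction_le (hM : ∀ i, M.rho i < 1) {E : ℝ} (hE : 1 ≤ E)
    (hρE : ∀ i, 1 / (1 - M.rho i) ≤ E) (hq : M.Admissible q) (hq' : M.Admissible q')
    {r : ℝ} (hEr : E * r ≤ 1 / 12) (hr : ∀ k, |Real.log (q' k / q k)| ≤ r) (j k : Fin n) :
    M.interaction q' j k ≤ 36 / 25 * M.interaction q j k := by
  rw [interaction, interaction, Finset.mul_sum]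
  refine Finset.sum_le_sum fun i _ => ?_
  have hexp : Real.exp (2 * |priceExp (M.rho i)| * r) ≤ 6 / 5 := by
    have hr0 : 0 ≤ r := (abs_nonneg _).trans (hr j)
    have h1 : 2 * |priceExp (M.rho i)| * r ≤ 1 / 6 := by
      nlinarith [abs_priceExp_le (isCES hM i) hE (hρE i)]
    refine (Real.exp_le_exp.2 h1).trans ?_
    have := Real.exp_bound_div_one_sub_of_interval (x := 1 / 6) (by norm_num) (by norm_num)
    norm_num at this ⊢
    exact this
  have h1 : ∀ l, M.buyerShare i q' l ≤ 6 / 5 * M.buyerShare i q l := fun l =>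
    (share_le_exp_mul (isCES hM i) (hq.pos_of_coeff i) (hq'.pos_of_coeff i)
      (fun l _ => hr l) l).trans
      (mul_le_mul_of_nonneg_right hexp (buyerShare_nonneg hM hq i l))
  have h2 : M.buyerShare i q' j * M.buyerShare i q' k ≤
      6 / 5 * M.buyerShare i q j * (6 / 5 * M.buyerShare i q k) :=
    mul_le_mul (h1 j) (h1 k) (buyerShare_nonneg hM hq' i k)
      (mul_nonneg (by norm_num) (buyerShare_nonneg hM hq i j))
  nlinarith [mul_le_mul_of_nonneg_left h2 (M.budget_pos i).le]

end CESMarket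

/-! ### Amortized analysis of the updates -/

/-- The progress made by one update. Here `x` is the total demand just before the update, and
`zt` the value used by it, which differs from the current excess demand `x - 1` by at most `Δ`. -/
lemma update_progress {x x₁ x₂ zt Δ r lam d E C : ℝ} (hd : 0 < d) (hd1 : d ≤ 1)
    (hlam : 0 < lam) (hElam : E * lam ≤ 1 / 26) (hx : 0 ≤ x)
    (hr : r = lam * min zt 1 * d)
    (hx₁ : |x₁ - x| ≤ Δ) (hx₁z : x₁ - 1 ≤ zt) (hx₂ : |x₂ - x| ≤ Δ) (hx₂z : zt ≤ x₂ - 1)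
    (hΔ : Δ ≤ x / 8) (hC0 : 0 ≤ C) (hC : x ≤ 16 / 7 → lam * (Δ ^ 2 / 2) ≤ C) :
    -(x - 1) * r + E * x * r ^ 2 ≤ -(1 / 10 * ((1 + x) * (r ^ 2 / (lam * d)))) + C := by
  have hld : 0 < lam * d := mul_pos hlam hd
  set w := min zt 1 with hw
  have e1 : r ^ 2 / (lam * d) = lam * d * w ^ 2 := by rw [hr]; field_simp
  have e2 : E * x * r ^ 2 = lam * d * (E * lam * d * x * w ^ 2) := by rw [hr]; ring
  have hEd : E * lam * d ≤ 1 / 26 := by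
    nlinarith [mul_le_mul_of_nonneg_right hElam hd.le]
  have hq : E * lam * d * x * w ^ 2 ≤ 1 / 26 * x * w ^ 2 := by gcongr
  rw [e1, e2, hr]
  rw [abs_le] at hx₁ hx₂
  -- it suffices to compare after division by `lam * d`
  suffices hs : -(x - 1) * w + 1 / 26 * x * w ^ 2 ≤ -(1 / 10 * (1 + x) * w ^ 2) + C / (lam * d) by
    have := mul_le_mul_of_nonneg_left hs hld.le
    rw [mul_add (lam * d) _ (C / (lam * d)), mul_div_cancel₀ _ hld.ne'] at this
    nlinarith
  rcases le_or_gt 1 zt with h | h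
  -- a capped update: the current demand `x ≥ 16 / 9` is so large that the error does not matter
  · have hw1 : w = 1 := min_eq_right h
    have : 0 ≤ C / (lam * d) := div_nonneg hC0 hld.le
    rw [hw1]
    linarith
  -- an update that is not capped: `x` is bounded, and the error is quadratic in `Δ`
  · have hw1 : w = zt := min_eq_left h.le
    have hx16 : x ≤ 16 / 7 := by linarith
    have h1 : Δ ^ 2 / 2 ≤ C / (lam * d) := by
      rw [le_div_iff₀ hld]
      nlinarith [hC hx16, mul_nonneg (mul_nonneg hlam.le (sq_nonneg Δ)) (sub_nonneg.2 hd1)]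
    have h2 : |zt - (x - 1)| ≤ Δ := abs_le.2 ⟨by linarith, by linarith⟩
    have h3 : (zt - (x - 1)) ^ 2 ≤ Δ ^ 2 := by
      rw [← sq_abs]; exact pow_le_pow_left₀ (abs_nonneg _) h2 2
    rw [hw1]
    nlinarith [sq_nonneg (zt - (zt - (x - 1))), sq_nonneg zt,
      mul_nonneg (sub_nonneg.2 hx16) (sq_nonneg zt)]

lemma sum_Ico_sum_Ico {u : ℕ → ℕ} (hu : Monotone u) (f : ℕ → ℝ) {k l : ℕ} (h : k ≤ l) :
    ∑ i ∈ Finset.Ico k l, ∑ e ∈ Finset.Ico (u i) (u (i + 1)), f e =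
      ∑ e ∈ Finset.Ico (u k) (u l), f e := by
  induction l, h using Nat.le_induction with
  | base => simp
  | succ l h ih =>
    rw [Finset.sum_Ico_succ_top h, ih]
    exact Finset.sum_Ico_consecutive _ (hu h) (hu l.le_succ)

/-- The energy of the update number `k` of the price of good `j`: an update
with exact information would decrease `φ` by at least a tenth of it. -/
def energy (M : CESMarket n m) (lam : ℝ) (time : Fin n → ℕ → ℝ) (p : ℝ → Fin n → ℝ)
    (j : Fin n) (k : ℕ) : ℝ :=
  p (time j k) j * ((1 + M.totalDemand (leftPrice time p (time j (k + 1))) j) *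
    (relStep time p j k ^ 2 / (lam * dur time j k)))

/-- The total energy of the updates at the times in `(a, b]`. -/
def totalEnergy (M : CESMarket n m) (lam : ℝ) (time : Fin n → ℕ → ℝ) (p : ℝ → Fin n → ℝ)
    (a b : ℝ) : ℝ :=
  ∑ j, ∑ k ∈ Finset.Ico (countLE (time j) a) (countLE (time j) b), energy M lam time p j k

/-- The part of the energy of the update number `l` of the price of good `k` that pays for the
outdated information which it causes in the next update of the price of good `j`. -/
def charge (M : CESMarket n m) (lam : ℝ) (time : Fin n → ℕ → ℝ) (p : ℝ → Fin n → ℝ)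
    (j k : Fin n) (l : ℕ) : ℝ :=
  1 / 40 * (relStep time p k l ^ 2 / (lam * dur time k l) *
    M.interaction (leftPrice time p (time k (l + 1))) j k)

namespace CESMarket.IsAsyncTatonnement

variable {M : CESMarket n m} {lam : ℝ} {p₀ : Fin n → ℝ} {time : Fin n → ℕ → ℝ}
  {p : ℝ → Fin n → ℝ}

lemma charge_nonneg (H : M.IsAsyncTatonnement lam p₀ time p) (hM : ∀ i, M.rho i < 1)
    (hlam : 0 < lam) (hlam1 : lam < 1) (hp₀ : ∀ j, 0 < p₀ j) (j k : Fin n) (l : ℕ) :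
    0 ≤ charge M lam time p j k l :=
  mul_nonneg (by norm_num) (mul_nonneg (div_nonneg (sq_nonneg _)
    (mul_nonneg hlam.le (H.dur_pos k l).le)) (interaction_nonneg hM
      (Admissible.of_pos (H.leftPrice_pos hlam hlam1 hp₀ _)) j k))

lemma energy_nonneg (H : M.IsAsyncTatonnement lam p₀ time p) (hM : ∀ i, M.rho i < 1)
    (hlam : 0 < lam) (hlam1 : lam < 1) (hp₀ : ∀ j, 0 < p₀ j) (j : Fin n) (k : ℕ) :
    0 ≤ energy M lam time p j k := by
  have h1 := totalDemand_nonneg hM (Admissible.of_pos (M := M)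
    (H.leftPrice_pos hlam hlam1 hp₀ (time j (k + 1)))) j
  exact mul_nonneg (H.price_pos hlam hlam1 hp₀ ((H.isSchedule j).time_nonneg k) j).le
    (mul_nonneg (by linarith) (div_nonneg (sq_nonneg _)
      (mul_nonneg hlam.le (H.dur_pos j k).le)))

lemma sum_charge_le (H : M.IsAsyncTatonnement lam p₀ time p) (hM : ∀ i, M.rho i < 1)
    (hlam : 0 < lam) (hlam1 : lam < 1) (hp₀ : ∀ j, 0 < p₀ j) (k : Fin n) (l : ℕ) :
    ∑ j, charge M lam time p j k l ≤ 1 / 40 * energy M lam time p k l := by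
  have hA := Admissible.of_pos (M := M) (H.leftPrice_pos hlam hlam1 hp₀ (time k (l + 1)))
  have hr : 0 ≤ relStep time p k l ^ 2 / (lam * dur time k l) :=
    div_nonneg (sq_nonneg _) (mul_nonneg hlam.le (H.dur_pos k l).le)
  have hP := (H.price_pos hlam hlam1 hp₀ ((H.isSchedule k).time_nonneg l) k).le
  simp only [charge]
  rw [← Finset.mul_sum, ← Finset.mul_sum, sum_interaction hM hA, H.leftPrice_time, energy]
  nlinarith [mul_nonneg hr hP]

/-- The prices within the window of an update compared to those at its end. -/
lemma abs_log_price_div_leftPrice_le (H : M.IsAsyncTatonnement lam p₀ time p)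
    (hM : ∀ i, M.rho i < 1) (hlam : 0 < lam) (hlam1 : lam ≤ 1 / 26) (hp₀ : ∀ j, 0 < p₀ j)
    {a s t : ℝ} (ha : 0 ≤ a) (has : a ≤ s) (hst : s < t) (j : Fin n) :
    |Real.log (p s j / leftPrice time p t j)| ≤
      21 / 20 * ∑ i ∈ Finset.Ico (countLE (time j) a) (countLT (time j) t),
        |relStep time p j i| := by
  have hu := H.isSchedule j
  have hs : 0 ≤ s := ha.trans has
  rw [H.price_eq hs, leftPrice, ← inv_div, Real.log_inv, abs_neg]
  refine (H.abs_log_price_div_le hM hlam hlam1 hp₀ j (hu.countLE_le_countLT hst)).trans ?_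
  refine mul_le_mul_of_nonneg_left (Finset.sum_le_sum_of_subset_of_nonneg
    (Finset.Ico_subset_Ico_left (hu.countLE_mono has)) fun _ _ _ => abs_nonneg _) (by norm_num)

lemma abs_log_leftPrice_div_le (H : M.IsAsyncTatonnement lam p₀ time p)
    (hM : ∀ i, M.rho i < 1) (hlam : 0 < lam) (hlam1 : lam ≤ 1 / 26) (hp₀ : ∀ j, 0 < p₀ j)
    {s t : ℝ} (hs : 0 < s) (hst : s ≤ t) (hts : t - s ≤ 1) (j : Fin n) :
    |Real.log (leftPrice time p t j / leftPrice time p s j)| ≤ 21 / 10 * lam := by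
  have hu := H.isSchedule j
  refine (H.abs_log_price_div_le hM hlam hlam1 hp₀ j (hu.countLT_mono hst)).trans ?_
  have h1 := H.sum_abs_relStep_le hM hlam (by linarith) hp₀ j (hu.countLT_mono hst)
  have h2 := (hu.time_countLT_lt (hs.trans_le hst)).le
  have h3 := hu.sub_one_le_time_countLT s
  nlinarith

/-- The change of `φ` in one update is at most minus a tenth of its energy, up to charges to the
updates of other prices that it was not informed about. -/
lemma stepBound_le (H : M.IsAsyncTatonnement lam p₀ time p) (hM : ∀ i, M.rho i < 1)
    {E : ℝ} (hE : 1 ≤ E) (hρE : ∀ i, 1 / (1 - M.rho i) ≤ E)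
    (hlam : 0 < lam) (hlamE : lam ≤ 1 / (26 * E)) (hp₀ : ∀ j, 0 < p₀ j) (j : Fin n) (k : ℕ) :
    stepBound M E time p j k ≤ -(1 / 10 * energy M lam time p j k) +
      ∑ i, ∑ l ∈ Finset.Ico (countLE (time i) (time j k)) (countLT (time i) (time j (k + 1))),
        charge M lam time p j i l := by
  have hElam : E * lam ≤ 1 / 26 := by
    rw [le_div_iff₀ (by positivity)] at hlamE; linarith
  have hlam26 : lam ≤ 1 / 26 := by nlinarith
  have hlam1 : lam < 1 := by linarith
  have hu := H.isSchedule
  set τ := time j (k + 1) with hτ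
  set q := leftPrice time p τ with hq
  have htk : 0 ≤ time j k := (hu j).time_nonneg k
  have hkτ : time j k < τ := H.time_strictMono j k.lt_succ_self
  have hτ0 : 0 < τ := htk.trans_lt hkτ
  have hgap : τ - time j k ≤ 1 := H.time_gap j k
  have hqpos := H.leftPrice_pos hlam hlam1 hp₀ τ
  have hA : M.Admissible q := Admissible.of_pos hqpos
  have hqj : q j = p (time j k) j := H.leftPrice_time j k
  set W : Fin n → Finset ℕ := fun i =>
    Finset.Ico (countLE (time i) (time j k)) (countLT (time i) τ) with hW
  set R : Fin n → ℝ := fun i => 21 / 20 * ∑ l ∈ W i, |relStep time p i l| with hR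
  set T : Fin n → ℝ := fun i => ∑ l ∈ W i, relStep time p i l ^ 2 / dur time i l with hT
  -- the updates of good `i` in the window of length at most `1` refer to a time of length at most
  -- `2`, because the first of them looks back into the time before the window
  have hspan : ∀ i, time i (countLT (time i) τ) - time i (countLE (time i) (time j k)) ≤ 2 := by
    intro i
    linarith [(hu i).time_countLT_lt hτ0, (hu i).sub_one_lt_time_countLE (time j k)]
  have hWle : ∀ i, countLE (time i) (time j k) ≤ countLT (time i) τ := fun i =>
    (hu i).countLE_le_countLT hkτ
  have hRr : ∀ i, R i ≤ 21 / 10 * lam := by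
    intro i
    have := H.sum_abs_relStep_le hM hlam hlam1 hp₀ i (hWle i)
    have h2 := hspan i
    simp only [hR, hW]
    nlinarith
  have hEr : E * (21 / 10 * lam) ≤ 1 / 12 := by linarith
  have hT0 : ∀ i, 0 ≤ T i := fun i => Finset.sum_nonneg fun l _ =>
    div_nonneg (sq_nonneg _) (H.dur_pos i l).le
  have hR2 : ∀ i, R i ^ 2 ≤ 441 / 200 * T i := by
    intro i
    have h1 := H.sq_sum_abs_relStep_le i (hWle i)
    have h2 : (∑ l ∈ W i, |relStep time p i l|) ^ 2 ≤ 2 * T i :=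
      h1.trans (mul_le_mul_of_nonneg_right (hspan i) (hT0 i))
    simp only [hR]
    nlinarith
  set x := M.totalDemand q j with hx
  have hx0 : 0 ≤ x := totalDemand_nonneg hM hA j
  set S := ∑ i, M.demand i q j * ∑ l, M.buyerShare i q l * R l with hS
  have hSx : S ≤ x * (21 / 10 * lam) := by
    rw [hS, hx, totalDemand, Finset.sum_mul]
    exact Finset.sum_le_sum fun i _ => mul_le_mul_of_nonneg_left
      (sum_buyerShare_mul_le hM hA hRr i) (demand_nonneg hM hA i j)
  have hvar : ∀ s ∈ Ioo (time j k) τ, |M.totalDemand (p s) j - x| ≤ 3 / 2 * E * S := by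
    intro s hs
    have hs0 : 0 ≤ s := htk.trans hs.1.le
    refine abs_totalDemand_sub_le hM hE hρE hA
      (Admissible.of_pos (H.price_pos hlam hlam1 hp₀ hs0)) hEr hRr
      (fun i => H.abs_log_price_div_leftPrice_le hM hlam hlam26 hp₀ htk hs.1.le hs.2 i) ?_
    rw [hqj]
    exact H.const j k s ⟨hs.1.le, hs.2⟩
  have hΔ : 3 / 2 * E * S ≤ x / 8 := by
    have : E * S ≤ x * (1 / 12) := by
      calc E * S ≤ E * (x * (21 / 10 * lam)) := by gcongr
        _ = x * (E * (21 / 10 * lam)) := by ring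
        _ ≤ _ := by gcongr
    linarith
  set C := ∑ i, ∑ l ∈ W i, charge M lam time p j i l with hC
  have hC0 : 0 ≤ C := Finset.sum_nonneg fun i _ => Finset.sum_nonneg fun l _ =>
    H.charge_nonneg hM hlam hlam1 hp₀ j i l
  have hP := hqpos j
  -- the error caused by the outdated information is paid by the charges
  have hcharge : x ≤ 16 / 7 → lam * ((3 / 2 * E * S) ^ 2 / 2) ≤ C / q j := by
    intro hx16
    rw [le_div_iff₀ hP]
    have h1 := price_mul_sq_sum_demand_le hM hA R j
    have h2 : ∑ i, M.interaction q j i * R i ^ 2 ≤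
        441 / 200 * ∑ i, M.interaction q j i * T i := by
      rw [Finset.mul_sum]
      refine Finset.sum_le_sum fun i _ => ?_
      have := mul_le_mul_of_nonneg_left (hR2 i) (interaction_nonneg hM hA j i)
      linarith
    have h20 : 0 ≤ ∑ i, M.interaction q j i * T i := Finset.sum_nonneg fun i _ =>
      mul_nonneg (interaction_nonneg hM hA j i) (hT0 i)
    have h3 : q j * S ^ 2 ≤ 16 / 7 * (441 / 200 * ∑ i, M.interaction q j i * T i) :=
      h1.trans (mul_le_mul hx16 h2 (Finset.sum_nonneg fun i _ =>
        mul_nonneg (interaction_nonneg hM hA j i) (sq_nonneg _)) (by norm_num))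
    have h4 : (E * lam) ^ 2 ≤ (1 / 26) ^ 2 := by gcongr
    have h5 : 6 * (lam * E ^ 2) * ∑ i, M.interaction q j i * T i ≤ C := by
      rw [hC, Finset.mul_sum]
      refine Finset.sum_le_sum fun i _ => ?_
      simp only [hT]
      rw [Finset.mul_sum, Finset.mul_sum]
      refine Finset.sum_le_sum fun l hl => ?_
      rw [hW, Finset.mem_Ico] at hl
      have hl1 : time j k < time i (l + 1) := by
        by_contra! h
        have := (hu i).lt_countLE_iff.2 h
        omega
      have hl2 : time i (l + 1) < τ := (hu i).lt_countLT_iff.1 hl.2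
      have hA' : M.Admissible (leftPrice time p (time i (l + 1))) :=
        Admissible.of_pos (H.leftPrice_pos hlam hlam1 hp₀ _)
      -- the interactions at the end of the window are close to those at the time of the update `l`
      have h6 := interaction_le hM hE hρE hA' hA hEr (fun i' =>
        H.abs_log_leftPrice_div_le hM hlam hlam26 hp₀ (htk.trans_lt hl1) hl2.le (by linarith) i')
        j i
      have h7 := interaction_nonneg hM hA' j i
      have h8 : 0 ≤ relStep time p i l ^ 2 / dur time i l :=
        div_nonneg (sq_nonneg _) (H.dur_pos i l).le
      set I' := M.interaction (leftPrice time p (time i (l + 1))) j i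
      set Y := relStep time p i l ^ 2 / dur time i l
      rw [charge, mul_comm lam (dur time i l), ← div_div]
      calc 6 * (lam * E ^ 2) * (M.interaction q j i * Y)
          ≤ 6 * (lam * E ^ 2) * (36 / 25 * I' * Y) := by gcongr
        _ = 216 / 25 * (E * lam) ^ 2 * (Y / lam * I') := by field_simp; ring
        _ ≤ 216 / 25 * (1 / 26) ^ 2 * (Y / lam * I') := by gcongr
        _ ≤ 1 / 40 * (Y / lam * I') := by
            have : 0 ≤ Y / lam * I' := by positivity
            linarith
    have h6 := mul_le_mul_of_nonneg_left h3 (show 0 ≤ 9 / 8 * (lam * E ^ 2) by positivity)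
    have h7 : 0 ≤ lam * E ^ 2 * ∑ i, M.interaction q j i * T i := by positivity
    linarith
  obtain ⟨zt, -, ⟨s₁, hs₁, hz₁⟩, ⟨s₂, hs₂, hz₂⟩, hr⟩ := H.update_spec hM hlam hlam1 hp₀ j k
  have hmain := update_progress (H.dur_pos j k) (H.dur_le_one j k) hlam hElam hx0 hr
    (hvar s₁ hs₁) hz₁ (hvar s₂ hs₂) hz₂ hΔ (div_nonneg hC0 hP.le) hcharge
  rw [stepBound, energy, ← hτ, ← hq, ← hx, ← hqj]
  have h9 := mul_le_mul_of_nonneg_left hmain hP.le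
  rw [mul_add (q j) _ (C / q j), mul_div_cancel₀ _ hP.ne'] at h9
  refine h9.trans (le_of_eq ?_)
  ring

/-- The charges to the updates in `(a - 1, b]`, made by the updates in `(a, b]`, amount to at most
a fortieth of their energy, since an update occurs in at most one window of each other good. -/
lemma sum_sum_charge_le (H : M.IsAsyncTatonnement lam p₀ time p) (hM : ∀ i, M.rho i < 1)
    (hlam : 0 < lam) (hlam1 : lam < 1) (hp₀ : ∀ j, 0 < p₀ j) {a b : ℝ} (ha : 0 ≤ a)
    (hab : a ≤ b) :
    ∑ j, ∑ k ∈ Finset.Ico (countLE (time j) a) (countLE (time j) b), ∑ i,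
      ∑ l ∈ Finset.Ico (countLE (time i) (time j k)) (countLT (time i) (time j (k + 1))),
        charge M lam time p j i l ≤ 1 / 40 * totalEnergy M lam time p (a - 1) b := by
  have hu := H.isSchedule
  have hb : 0 ≤ b := ha.trans hab
  have hc := H.charge_nonneg hM hlam hlam1 hp₀
  have h1 : ∀ j i, ∑ k ∈ Finset.Ico (countLE (time j) a) (countLE (time j) b),
      ∑ l ∈ Finset.Ico (countLE (time i) (time j k)) (countLT (time i) (time j (k + 1))),
        charge M lam time p j i l ≤
      ∑ l ∈ Finset.Ico (countLE (time i) (a - 1)) (countLE (time i) b),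
        charge M lam time p j i l := by
    intro j i
    calc _ ≤ ∑ k ∈ Finset.Ico (countLE (time j) a) (countLE (time j) b),
          ∑ l ∈ Finset.Ico (countLE (time i) (time j k)) (countLE (time i) (time j (k + 1))),
            charge M lam time p j i l :=
          Finset.sum_le_sum fun k _ => Finset.sum_le_sum_of_subset_of_nonneg
            (Finset.Ico_subset_Ico_right ((hu i).countLT_le_countLE _)) fun l _ _ => hc j i l
      _ = ∑ l ∈ Finset.Ico (countLE (time i) (time j (countLE (time j) a)))
            (countLE (time i) (time j (countLE (time j) b))), charge M lam time p j i l :=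
          sum_Ico_sum_Ico (u := fun k => countLE (time i) (time j k))
            (fun k l hkl => (hu i).countLE_mono ((hu j).strictMono.monotone hkl)) _
            ((hu j).countLE_mono hab)
      _ ≤ _ := Finset.sum_le_sum_of_subset_of_nonneg (Finset.Ico_subset_Ico
            ((hu i).countLE_mono ((hu j).sub_one_lt_time_countLE a).le)
            ((hu i).countLE_mono ((hu j).time_countLE_le hb))) fun l _ _ => hc j i l
  calc _ ≤ ∑ j, ∑ i, ∑ l ∈ Finset.Ico (countLE (time i) (a - 1)) (countLE (time i) b),
        charge M lam time p j i l := by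
        refine Finset.sum_le_sum fun j _ => ?_
        rw [Finset.sum_comm]
        exact Finset.sum_le_sum fun i _ => h1 j i
    _ = ∑ i, ∑ l ∈ Finset.Ico (countLE (time i) (a - 1)) (countLE (time i) b),
        ∑ j, charge M lam time p j i l := by
        rw [Finset.sum_comm]
        exact Finset.sum_congr rfl fun i _ => Finset.sum_comm
    _ ≤ _ := by
        rw [totalEnergy, Finset.mul_sum]
        refine Finset.sum_le_sum fun i _ => ?_
        rw [Finset.mul_sum]
        exact Finset.sum_le_sum fun l _ => H.sum_charge_le hM hlam hlam1 hp₀ i l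

/-- The amortized descent inequality. -/
theorem phi_le_sub_totalEnergy (H : M.IsAsyncTatonnement lam p₀ time p) (hM : ∀ i, M.rho i < 1)
    {E : ℝ} (hE : 1 ≤ E) (hρE : ∀ i, 1 / (1 - M.rho i) ≤ E)
    (hlam : 0 < lam) (hlamE : lam ≤ 1 / (26 * E)) (hp₀ : ∀ j, 0 < p₀ j) {a b : ℝ} (ha : 0 ≤ a)
    (hab : a ≤ b) :
    M.phi (p b) ≤ M.phi (p a) - 1 / 10 * totalEnergy M lam time p a b +
      1 / 40 * totalEnergy M lam time p (a - 1) b := by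
  have hE26 : 1 / (26 * E) ≤ 1 / 26 := by gcongr; linarith
  have h1 := H.phi_le_phi_add_sum hM hE hρE hlam hlamE hp₀ ha b hab
  have h2 := H.sum_sum_charge_le hM hlam (by linarith) hp₀ ha hab
  have h3 := Finset.sum_le_sum fun j (_ : j ∈ Finset.univ) => Finset.sum_le_sum
    fun k (_ : k ∈ Finset.Ico (countLE (time j) a) (countLE (time j) b)) =>
      H.stepBound_le hM hE hρE hlam hlamE hp₀ j k
  simp only [Finset.sum_add_distrib, Finset.sum_neg_distrib, ← Finset.mul_sum] at h3
  rw [← totalEnergy] at h3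
  linarith

end CESMarket.IsAsyncTatonnement

namespace CESMarket

/-! ### Bounds on a box of prices -/

/-- The prices lie between `0` and `u`, and those of the wanted goods are at least `l`. -/
structure InBox (M : CESMarket n m) (l u : ℝ) (q : Fin n → ℝ) : Prop where
  nonneg : ∀ j, 0 ≤ q j
  le : ∀ j, q j ≤ u
  ge : ∀ j, M.Wanted j → l ≤ q j

variable {M : CESMarket n m} {q q' : Fin n → ℝ} {l u : ℝ}

lemma InBox.admissible (hl : 0 < l) (hq : M.InBox l u q) : M.Admissible q :=
  ⟨hq.nonneg, fun j hj => hl.trans_le (hq.ge j hj)⟩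

lemma sum_budget_nonneg (M : CESMarket n m) : 0 ≤ ∑ i, M.budget i :=
  Finset.sum_nonneg fun i _ => (M.budget_pos i).le

lemma InBox.totalDemand_le (hM : ∀ i, M.rho i < 1) (hl : 0 < l) (hq : M.InBox l u q)
    (j : Fin n) : M.totalDemand q j ≤ (∑ i, M.budget i) / l := by
  by_cases hj : M.Wanted j
  · rw [le_div_iff₀ hl]
    have h1 := price_mul_totalDemand_le hM (hq.admissible hl) j
    nlinarith [hq.ge j hj, totalDemand_nonneg hM (hq.admissible hl) j]
  · rw [totalDemand_of_not_wanted hM hj]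
    exact div_nonneg M.sum_budget_nonneg hl.le

lemma exists_totalDemand_lower_bound (hM : ∀ i, M.rho i < 1) (hl : 0 < l) (hu : 0 < u) :
    ∃ δ > 0, ∀ q, M.InBox l u q → ∀ j, M.Wanted j → δ ≤ M.totalDemand q j := by
  obtain ⟨E, hE, hρE⟩ := exists_elasticity_bound hM
  have hpos : M.Admissible fun _ => l := Admissible.of_pos fun _ => hl
  have h : ∀ j, ∃ δ > 0, ∀ δ', 0 < δ' → δ' ≤ δ →
      ∀ q, M.InBox l u q → M.Wanted j → δ' ≤ M.totalDemand q j := by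
    intro j
    by_cases hj : M.Wanted j
    · obtain ⟨i, hi⟩ := hj
      have hC := isCES hM i
      have hsh : 0 < M.buyerShare i (fun _ => l) j := share_pos hC (hpos.pos_of_coeff i) hi
      refine ⟨M.budget i * (M.buyerShare i (fun _ => l) j /
        Real.exp (2 * |priceExp (M.rho i)| * |Real.log (u / l)|)) / u, by
          have := M.budget_pos i; positivity, fun δ' _ hδ' q hq _ => hδ'.trans ?_⟩
      have hA := hq.admissible hl
      have h1 := share_le_exp_mul hC (hA.pos_of_coeff i) (hpos.pos_of_coeff i)
        (r := |Real.log (u / l)|) (fun k hk => by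
          have h2 := hq.ge k ⟨i, hk⟩
          rw [← inv_div, Real.log_inv, abs_neg,
            abs_of_nonneg (Real.log_nonneg ((one_le_div hl).2 h2))]
          refine le_trans (Real.log_le_log (div_pos (hl.trans_le h2) hl) ?_) (le_abs_self _)
          gcongr; exact hq.le k) j
      refine le_trans ?_ (Finset.single_le_sum (fun i _ => demand_nonneg hM hA i j)
        (Finset.mem_univ i))
      rw [demand]
      have h3 : M.buyerShare i (fun _ => l) j /
          Real.exp (2 * |priceExp (M.rho i)| * |Real.log (u / l)|) ≤ M.buyerShare i q j := by
        rw [div_le_iff₀ (Real.exp_pos _), mul_comm]; exact h1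
      have := M.budget_pos i
      have := buyerShare_nonneg hM hA i j
      have := hA.pos_of_coeff i j hi
      have := hq.le j
      gcongr
    · exact ⟨1, one_pos, fun _ _ _ _ _ h => absurd h hj⟩
  obtain ⟨δ, hδ, hP⟩ := exists_pos_forall h
  exact ⟨δ, hδ, fun q hq j hj => hP j q hq hj⟩

/-- On a box of prices the total demand is Lipschitz continuous in the logarithms of the prices of
the wanted goods. -/
lemma exists_totalDemand_lipschitz (hM : ∀ i, M.rho i < 1) (hl : 0 < l) :
    ∃ L : ℝ, 0 ≤ L ∧ ∀ q q', M.InBox l u q → M.InBox l u q' → ∀ r, 0 ≤ r → r ≤ 1 →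
      (∀ k, M.Wanted k → |Real.log (q' k / q k)| ≤ r) →
        ∀ j, |M.totalDemand q' j - M.totalDemand q j| ≤ L * r := by
  obtain ⟨E, hE, hρE⟩ := exists_elasticity_bound hM
  set D := (∑ i, M.budget i) / l
  have hD : 0 ≤ D := div_nonneg M.sum_budget_nonneg hl.le
  have hfac : ∀ q q', M.InBox l u q → M.InBox l u q' → ∀ r, 0 ≤ r →
      (∀ k, M.Wanted k → |Real.log (q' k / q k)| ≤ r) → ∀ j,
      M.totalDemand q' j ≤ Real.exp ((2 * E + 1) * r) * M.totalDemand q j := by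
    intro q q' hq hq' r hr0 hr j
    have hA := hq.admissible hl
    have hA' := hq'.admissible hl
    rw [totalDemand, totalDemand, Finset.mul_sum]
    refine Finset.sum_le_sum fun i _ => ?_
    rcases (M.coeff_nonneg i j).eq_or_lt with h0 | h0
    · rw [demand_of_coeff_eq_zero hM h0.symm, demand_of_coeff_eq_zero hM h0.symm, mul_zero]
    · have h1 : M.buyerShare i q' j ≤ Real.exp (2 * E * r) * M.buyerShare i q j := by
        refine (share_le_exp_mul (isCES hM i) (hA.pos_of_coeff i) (hA'.pos_of_coeff i)
          (fun k hk => hr k ⟨i, hk⟩) j).trans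
          (mul_le_mul_of_nonneg_right (Real.exp_le_exp.2 ?_) (buyerShare_nonneg hM hA i j))
        have := abs_priceExp_le (isCES hM i) hE (hρE i)
        gcongr
      have hqj := hA.pos_of_coeff i j h0
      have hqj' := hA'.pos_of_coeff i j h0
      have h2 : q j ≤ Real.exp r * q' j := by
        have h3 := (abs_le.1 (hr j ⟨i, h0⟩)).1
        rw [Real.log_div hqj'.ne' hqj.ne'] at h3
        rw [← Real.exp_log hqj, ← Real.exp_log hqj', ← Real.exp_add]
        exact Real.exp_le_exp.2 (by linarith)
      rw [demand, demand, div_le_iff₀ hqj']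
      have hb := M.budget_pos i
      have hs := buyerShare_nonneg hM hA i j
      calc M.budget i * M.buyerShare i q' j
          ≤ M.budget i * (Real.exp (2 * E * r) * M.buyerShare i q j) := by gcongr
        _ = Real.exp (2 * E * r) * (M.budget i * M.buyerShare i q j / q j) * q j := by
            field_simp
        _ ≤ Real.exp (2 * E * r) * (M.budget i * M.buyerShare i q j / q j) *
            (Real.exp r * q' j) := by gcongr
        _ = _ := by
            rw [show (2 * E + 1) * r = 2 * E * r + r by ring, Real.exp_add]; ring
  have hone : ∀ q q', M.InBox l u q → M.InBox l u q' → ∀ r, 0 ≤ r → r ≤ 1 →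
      (∀ k, M.Wanted k → |Real.log (q' k / q k)| ≤ r) → ∀ j,
      M.totalDemand q' j - M.totalDemand q j ≤
        (D * (2 * E + 1) * Real.exp (2 * E + 1)) * r := by
    intro q q' hq hq' r hr0 hr1 hr j
    have h1 := hfac q q' hq hq' r hr0 hr j
    have h2 := hq.totalDemand_le hM hl j
    have h3 := totalDemand_nonneg hM (hq.admissible hl) j
    set y := (2 * E + 1) * r with hy
    have hy0 : 0 ≤ y := by positivity
    have hyE : y ≤ 2 * E + 1 := by nlinarith
    have h4 : Real.exp y - 1 ≤ y * Real.exp (2 * E + 1) := by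
      have h5 := Real.add_one_le_exp (-y)
      have h6 : Real.exp y * Real.exp (-y) = 1 := by rw [← Real.exp_add]; simp
      have h7 := Real.exp_le_exp.2 hyE
      have h8 := Real.exp_pos y
      nlinarith
    calc _ ≤ (Real.exp y - 1) * M.totalDemand q j := by linarith
      _ ≤ (y * Real.exp (2 * E + 1)) * D := by
          have : 0 ≤ y * Real.exp (2 * E + 1) := by positivity
          gcongr
      _ = _ := by rw [hy]; ring
  refine ⟨D * (2 * E + 1) * Real.exp (2 * E + 1), by positivity,
    fun q q' hq hq' r hr0 hr1 hr j => abs_le.2 ⟨?_, hone q q' hq hq' r hr0 hr1 hr j⟩⟩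
  have := hone q' q hq' hq r hr0 hr1 (fun k hk => by
    rw [← inv_div, Real.log_inv, abs_neg]; exact hr k hk) j
  linarith

/-- On a box of prices the error `φ q - φ p` is bounded by the squared excess demands. -/
lemma IsEquilibrium.exists_phi_sub_le (hM : ∀ i, M.rho i < 1) (hl : 0 < l) (hu : 0 < u)
    {p : Fin n → ℝ} (hp : M.IsEquilibrium p) (hpb : M.InBox l u p) :
    ∃ K > 0, ∀ q, M.InBox l u q →
      M.phi q - M.phi p ≤ K * ∑ j, q j * (M.totalDemand q j - 1) ^ 2 := by
  obtain ⟨κ, hκ, hκ1, hρκ⟩ := exists_convexity_constant hM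
  obtain ⟨δ, hδ, hlow⟩ := exists_totalDemand_lower_bound hM hl hu
  refine ⟨1 + u / (κ * δ * l), by positivity, fun q hq => ?_⟩
  have h1 := phi_sub_ge hM hκ1 hρκ (hq.admissible hl) (hpb.admissible hl)
  have h2 : M.phi q - M.phi p ≤ -∑ j, (-(M.totalDemand q j - 1) * (p j - q j) +
      κ * M.totalDemand q j * (√(p j) - √(q j)) ^ 2) := by linarith
  refine h2.trans ?_
  rw [← Finset.sum_neg_distrib, Finset.mul_sum]
  refine Finset.sum_le_sum fun j _ => ?_
  have hq0 := hq.nonneg j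
  by_cases hj : M.Wanted j
  · have hx := hlow q hq j hj
    have hlq := hq.ge j hj
    set x := M.totalDemand q j
    have hx0 : 0 < x := hδ.trans_le hx
    have hsp := Real.sq_sqrt (hpb.nonneg j)
    have hsq := Real.sq_sqrt hq0
    set α := √(p j)
    set β := √(q j)
    have hS : (α + β) ^ 2 ≤ 4 * u := by
      nlinarith [sq_nonneg (α - β), hpb.le j, hq.le j]
    -- the arithmetic-geometric mean inequality
    have h3 : (x - 1) * ((α - β) * (α + β)) ≤
        κ * x * (α - β) ^ 2 + (x - 1) ^ 2 * (α + β) ^ 2 / (4 * (κ * x)) := by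
      have hκx : 0 < κ * x := mul_pos hκ hx0
      have e : κ * x * (α - β) ^ 2 + (x - 1) ^ 2 * (α + β) ^ 2 / (4 * (κ * x)) -
          (x - 1) * ((α - β) * (α + β)) =
          (2 * (κ * x) * (α - β) - (x - 1) * (α + β)) ^ 2 / (4 * (κ * x)) := by
        field_simp; ring
      have : 0 ≤ (2 * (κ * x) * (α - β) - (x - 1) * (α + β)) ^ 2 / (4 * (κ * x)) := by
        positivity
      linarith
    have h4 : (x - 1) ^ 2 * (α + β) ^ 2 / (4 * (κ * x)) ≤
        u / (κ * δ * l) * (q j * (x - 1) ^ 2) := by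
      calc _ ≤ (x - 1) ^ 2 * (4 * u) / (4 * (κ * δ)) := by gcongr
        _ = u / (κ * δ * l) * (l * (x - 1) ^ 2) := by field_simp
        _ ≤ _ := by gcongr
    have h5 : 0 ≤ q j * (x - 1) ^ 2 := by positivity
    have h6 : (α - β) * (α + β) = p j - q j := by rw [← hsp, ← hsq]; ring
    rw [h6] at h3
    nlinarith
  · have h0 : p j = 0 := ((isEquilibrium_iff hM).1 hp).2.2 j hj
    rw [totalDemand_of_not_wanted hM hj, h0]
    have : 0 ≤ u / (κ * δ * l) * q j := by positivity
    nlinarith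

end CESMarket

namespace CESMarket.IsAsyncTatonnement

variable {M : CESMarket n m} {lam : ℝ} {p₀ : Fin n → ℝ} {time : Fin n → ℕ → ℝ}
  {p : ℝ → Fin n → ℝ}

/-! ### Invariant price bounds -/

lemma price_succ (H : M.IsAsyncTatonnement lam p₀ time p) (hlam : 0 < lam) (hlam1 : lam < 1)
    (hp₀ : ∀ j, 0 < p₀ j) (j : Fin n) (k : ℕ) :
    p (time j (k + 1)) j = p (time j k) j * (1 + relStep time p j k) := by
  have := (H.price_pos hlam hlam1 hp₀ ((H.isSchedule j).time_nonneg k) j).ne'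
  rw [relStep]; field_simp; ring

/-- Prices above the sum of the budgets do not rise. -/
lemma price_le (H : M.IsAsyncTatonnement lam p₀ time p) (hM : ∀ i, M.rho i < 1)
    (hlam : 0 < lam) (hlam1 : lam ≤ 1 / 26) (hp₀ : ∀ j, 0 < p₀ j) {u : ℝ}
    (hu : 2 * ∑ i, M.budget i ≤ u) (hu₀ : ∀ j, p₀ j ≤ u) {t : ℝ} (ht : 0 ≤ t) (j : Fin n) :
    p t j ≤ u := by
  have hl1 : lam < 1 := by linarith
  refine H.forall_price (B := fun _ x => x ≤ u) hu₀ (fun j k hprev => ?_) ht j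
  have htk := (H.isSchedule j).time_nonneg k
  have h1 := hprev _ htk (H.time_strictMono j k.lt_succ_self) j
  have hP := H.price_pos hlam hl1 hp₀ htk j
  have hr := (abs_le.1 (H.abs_relStep_le hM hlam hl1 hp₀ j k)).2
  have hd := H.dur_pos j k
  have hd1 := H.dur_le_one j k
  rw [H.price_succ hlam hl1 hp₀]
  rcases le_or_gt (p (time j k) j) (u / 2) with h | h
  · have h2 : relStep time p j k ≤ 1 := by nlinarith
    have h3 := mul_le_mul_of_nonneg_left h2 hP.le
    linarith
  · obtain ⟨zt, -, -, ⟨s, hs, hz⟩, hrs⟩ := H.update_spec hM hlam hl1 hp₀ j k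
    have hA : M.Admissible (p s) :=
      Admissible.of_pos (H.price_pos hlam hl1 hp₀ (htk.trans hs.1.le))
    have h2 := price_mul_totalDemand_le hM hA j
    rw [H.const j k s ⟨hs.1.le, hs.2⟩] at h2
    have h3 : M.totalDemand (p s) j ≤ 1 := by
      by_contra! h3
      nlinarith
    have h4 : min zt 1 ≤ 0 := (min_le_left _ _).trans (by linarith)
    have h5 : relStep time p j k ≤ 0 := by
      rw [hrs]; nlinarith [mul_pos hlam hd]
    nlinarith

/-- A wanted good whose price is close to a small lower bound of all prices of wanted goods is in
great demand, so that its price rises. -/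
lemma le_price (H : M.IsAsyncTatonnement lam p₀ time p) (hM : ∀ i, M.rho i < 1)
    (hlam : 0 < lam) (hlam1 : lam ≤ 1 / 26) (hp₀ : ∀ j, 0 < p₀ j) {u l : ℝ}
    (hpu : ∀ t, 0 ≤ t → ∀ j, p t j ≤ u) (hl₀ : ∀ j, l ≤ p₀ j) (hl : 0 < l)
    (hlow : ∀ q, M.Admissible q → (∀ k, M.Wanted k → q k ≤ u) →
      ∀ j, M.Wanted j → (∀ k, M.Wanted k → q j ≤ 2 * q k) → q j ≤ 2 * l →
        2 ≤ M.totalDemand q j)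
    {t : ℝ} (ht : 0 ≤ t) (j : Fin n) : M.Wanted j → l ≤ p t j := by
  have hl1 : lam < 1 := by linarith
  refine H.forall_price (B := fun j x => M.Wanted j → l ≤ x) (fun j _ => hl₀ j)
    (fun j k hprev hj => ?_) ht j
  have htk := (H.isSchedule j).time_nonneg k
  have h1 := hprev _ htk (H.time_strictMono j k.lt_succ_self) j hj
  have hP := H.price_pos hlam hl1 hp₀ htk j
  have hr := (abs_le.1 (H.abs_relStep_le hM hlam hl1 hp₀ j k)).1
  have hd := H.dur_pos j k
  have hd1 := H.dur_le_one j k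
  rw [H.price_succ hlam hl1 hp₀]
  rcases le_or_gt (p (time j k) j) (2 * l) with h | h
  · obtain ⟨zt, -, ⟨s, hs, hz⟩, -, hrs⟩ := H.update_spec hM hlam hl1 hp₀ j k
    have hs0 : 0 ≤ s := htk.trans hs.1.le
    have hA : M.Admissible (p s) := Admissible.of_pos (H.price_pos hlam hl1 hp₀ hs0)
    have hps := H.const j k s ⟨hs.1.le, hs.2⟩
    have h3 := hlow (p s) hA (fun i _ => hpu s hs0 i) j hj
      (fun i hi => by have := hprev s hs0 hs.2 i hi; rw [hps]; linarith) (by rw [hps]; exact h)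
    have h4 : 0 ≤ min zt 1 := le_min (by linarith) (by norm_num)
    have h5 : 0 ≤ relStep time p j k := by
      rw [hrs]; positivity
    nlinarith
  · have : -(1 / 26) ≤ relStep time p j k := by nlinarith
    nlinarith

/-- All runs from the same initial prices stay in a common box, which contains a given
equilibrium. -/
lemma exists_inBox (hM : ∀ i, M.rho i < 1) (hlam : 0 < lam) (hlam1 : lam ≤ 1 / 26)
    (hp₀ : ∀ j, 0 < p₀ j) {q : Fin n → ℝ} (hq : M.IsEquilibrium q) :
    ∃ l u, 0 < l ∧ 0 < u ∧ M.InBox l u q ∧ ∀ time p, M.IsAsyncTatonnement lam p₀ time p →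
      ∀ t, 0 ≤ t → M.InBox l u (p t) := by
  have hA := hq.admissible hM
  have hb := M.sum_budget_nonneg
  have hs₀ : 0 ≤ ∑ j, p₀ j := Finset.sum_nonneg fun j _ => (hp₀ j).le
  have hsq : 0 ≤ ∑ j, q j := Finset.sum_nonneg fun j _ => hA.nonneg j
  set u := 2 * ∑ i, M.budget i + ∑ j, p₀ j + ∑ j, q j + 1 with hu
  have hu0 : 0 < u := by linarith
  have hup : ∀ j, p₀ j ≤ u := fun j => by
    have := Finset.single_le_sum (fun i _ => (hp₀ i).le) (Finset.mem_univ j)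
    linarith
  have huq : ∀ j, q j ≤ u := fun j => by
    have := Finset.single_le_sum (fun i _ => hA.nonneg i) (Finset.mem_univ j)
    linarith
  obtain ⟨l₁, hl₁, hlow⟩ := exists_price_two_le_totalDemand hM hu0
  obtain ⟨l₂, hl₂, h2⟩ := exists_pos_forall (ι := Fin n)
    (P := fun j l => l ≤ p₀ j ∧ (M.Wanted j → l ≤ q j)) fun j => by
      by_cases hj : M.Wanted j
      · exact ⟨min (p₀ j) (q j), lt_min (hp₀ j) (hA.pos j hj), fun l' _ h =>
          ⟨h.trans (min_le_left _ _), fun _ => h.trans (min_le_right _ _)⟩⟩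
      · exact ⟨p₀ j, hp₀ j, fun l' _ h => ⟨h, fun h' => absurd h' hj⟩⟩
  have hl : 0 < min (l₁ / 2) l₂ := lt_min (by linarith) hl₂
  have hll₁ : min (l₁ / 2) l₂ ≤ l₁ / 2 := min_le_left _ _
  have hll₂ : min (l₁ / 2) l₂ ≤ l₂ := min_le_right _ _
  refine ⟨min (l₁ / 2) l₂, u, hl, hu0,
    ⟨hA.nonneg, huq, fun j hj => hll₂.trans ((h2 j).2 hj)⟩, fun time p H t ht => ?_⟩
  have hpu : ∀ t, 0 ≤ t → ∀ j, p t j ≤ u := fun t ht j =>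
    H.price_le hM hlam hlam1 hp₀ (by linarith) hup ht j
  exact ⟨fun j => (H.price_pos hlam (by linarith) hp₀ ht j).le, hpu t ht,
    fun j => H.le_price hM hlam hlam1 hp₀ hpu (fun j => hll₂.trans (h2 j).1) hl
      (fun q hq h1 j hj h2 h3 => hlow q hq h1 j hj h2 (by linarith)) ht j⟩

/-! ### The energy bounds the error -/

lemma totalEnergy_nonneg (H : M.IsAsyncTatonnement lam p₀ time p) (hM : ∀ i, M.rho i < 1)
    (hlam : 0 < lam) (hlam1 : lam < 1) (hp₀ : ∀ j, 0 < p₀ j) (a b : ℝ) :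
    0 ≤ totalEnergy M lam time p a b :=
  Finset.sum_nonneg fun j _ => Finset.sum_nonneg fun k _ =>
    H.energy_nonneg hM hlam hlam1 hp₀ j k

lemma totalEnergy_add (H : M.IsAsyncTatonnement lam p₀ time p) {a b c : ℝ} (hab : a ≤ b)
    (hbc : b ≤ c) :
    totalEnergy M lam time p a b + totalEnergy M lam time p b c =
      totalEnergy M lam time p a c := by
  rw [totalEnergy, totalEnergy, totalEnergy, ← Finset.sum_add_distrib]
  exact Finset.sum_congr rfl fun j _ => Finset.sum_Ico_consecutive _
    ((H.isSchedule j).countLE_mono hab) ((H.isSchedule j).countLE_mono hbc)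

lemma totalEnergy_neg_one_zero (H : M.IsAsyncTatonnement lam p₀ time p) :
    totalEnergy M lam time p (-1) 0 = 0 := by
  refine Finset.sum_eq_zero fun j _ => ?_
  have : countLE (time j) 0 = 0 := by
    have := (H.isSchedule j).countLE_time 0
    rwa [H.time_zero] at this
  rw [this, Finset.Ico_eq_empty_of_le (Nat.zero_le _), Finset.sum_empty]

lemma sum_energy_le_totalEnergy (H : M.IsAsyncTatonnement lam p₀ time p)
    (hM : ∀ i, M.rho i < 1) (hlam : 0 < lam) (hlam1 : lam < 1) (hp₀ : ∀ j, 0 < p₀ j) {a b c : ℝ}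
    (hab : a ≤ b) (j : Fin n) :
    ∑ k ∈ Finset.Ico (countLE (time j) b) (countLE (time j) c), energy M lam time p j k ≤
      totalEnergy M lam time p a c := by
  have he := H.energy_nonneg hM hlam hlam1 hp₀
  refine (Finset.sum_le_sum_of_subset_of_nonneg (Finset.Ico_subset_Ico_left
    ((H.isSchedule j).countLE_mono hab)) fun k _ _ => he j k).trans ?_
  exact Finset.single_le_sum (f := fun j => ∑ k ∈ Finset.Ico (countLE (time j) a)
    (countLE (time j) c), energy M lam time p j k)
    (fun i _ => Finset.sum_nonneg fun k _ => he i k) (Finset.mem_univ j)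

lemma price_mul_sq_div_le_energy (H : M.IsAsyncTatonnement lam p₀ time p)
    (hM : ∀ i, M.rho i < 1) (hlam : 0 < lam) (hlam1 : lam < 1) (hp₀ : ∀ j, 0 < p₀ j) (j : Fin n)
    (k : ℕ) :
    p (time j k) j * (relStep time p j k ^ 2 / (lam * dur time j k)) ≤
      energy M lam time p j k := by
  have h1 := totalDemand_nonneg hM (Admissible.of_pos (M := M)
    (H.leftPrice_pos hlam hlam1 hp₀ (time j (k + 1)))) j
  have h2 : 0 ≤ relStep time p j k ^ 2 / (lam * dur time j k) := div_nonneg (sq_nonneg _)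
    (mul_nonneg hlam.le (H.dur_pos j k).le)
  refine mul_le_mul_of_nonneg_left ?_
    (H.price_pos hlam hlam1 hp₀ ((H.isSchedule j).time_nonneg k) j).le
  nlinarith

lemma abs_log_price_div_price_le (H : M.IsAsyncTatonnement lam p₀ time p)
    (hM : ∀ i, M.rho i < 1) (hlam : 0 < lam) (hlam1 : lam ≤ 1 / 26) (hp₀ : ∀ j, 0 < p₀ j)
    {a b s t : ℝ} (hs0 : 0 ≤ s) (ht0 : 0 ≤ t) (has : a ≤ s) (hsb : s ≤ b) (hat : a ≤ t)
    (htb : t ≤ b) (j : Fin n) :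
    |Real.log (p s j / p t j)| ≤
      21 / 20 * ∑ i ∈ Finset.Ico (countLE (time j) a) (countLE (time j) b),
        |relStep time p j i| := by
  have hu := H.isSchedule j
  have main : ∀ {s t : ℝ}, 0 ≤ s → 0 ≤ t → a ≤ t → s ≤ b → t ≤ s →
      |Real.log (p s j / p t j)| ≤
      21 / 20 * ∑ i ∈ Finset.Ico (countLE (time j) a) (countLE (time j) b),
        |relStep time p j i| := by
    intro s t hs0 ht0 hat hsb hts
    rw [H.price_eq hs0, H.price_eq ht0]
    refine (H.abs_log_price_div_le hM hlam hlam1 hp₀ j (hu.countLE_mono hts)).trans ?_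
    exact mul_le_mul_of_nonneg_left (Finset.sum_le_sum_of_subset_of_nonneg
      (Finset.Ico_subset_Ico (hu.countLE_mono hat) (hu.countLE_mono hsb))
      fun _ _ _ => abs_nonneg _) (by norm_num)
  rcases le_total t s with h | h
  · exact main hs0 ht0 hat hsb h
  · rw [← inv_div, Real.log_inv, abs_neg]
    exact main ht0 hs0 has htb h

/-- The energy of the updates within a few units of time around `T` bounds the squared excess
demands at time `T`, because each good is updated for at least one unit of time after `T`, using
excess demands that differ little from those at time `T` unless much energy is spent. -/
lemma exists_price_mul_sq_excess_le (hM : ∀ i, M.rho i < 1) (hlam : 0 < lam)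
    (hlam1 : lam ≤ 1 / 26) (hp₀ : ∀ j, 0 < p₀ j) {l u : ℝ} (hl : 0 < l) (hu : 0 < u) :
    ∃ K > 0, ∀ time p, M.IsAsyncTatonnement lam p₀ time p →
      (∀ t, 0 ≤ t → M.InBox l u (p t)) → ∀ T, 0 ≤ T → ∀ j,
        p T j * (M.totalDemand (p T) j - 1) ^ 2 ≤
          K * totalEnergy M lam time p (T - 1) (T + 2) := by
  have hl1 : lam < 1 := by linarith
  obtain ⟨L, hL, hLip⟩ := exists_totalDemand_lipschitz (M := M) (u := u) hM hl
  set Z := 1 + (∑ i, M.budget i) / l with hZ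
  have hZ1 : 1 ≤ Z := by
    have : 0 ≤ (∑ i, M.budget i) / l := div_nonneg M.sum_budget_nonneg hl.le
    linarith
  refine ⟨4 * Z ^ 2 / lam + 6 * u * L ^ 2 * (5 * lam / l), by positivity,
    fun time p H hbox T hT j => ?_⟩
  set G := totalEnergy M lam time p (T - 1) (T + 2) with hG
  have hG0 : 0 ≤ G := H.totalEnergy_nonneg hM hlam hl1 hp₀ _ _
  have hsch := H.isSchedule
  have hT2 : 0 ≤ T + 2 := by linarith
  set V : Fin n → ℝ := fun k =>
    ∑ i ∈ Finset.Ico (countLE (time k) (T - 1)) (countLE (time k) (T + 2)), |relStep time p k i|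
    with hV
  have hmono : ∀ k, countLE (time k) (T - 1) ≤ countLE (time k) (T + 2) := fun k =>
    (hsch k).countLE_mono (by linarith)
  have hspan : ∀ k, time k (countLE (time k) (T + 2)) - time k (countLE (time k) (T - 1)) ≤ 4 :=
    fun k => by
      linarith [(hsch k).time_countLE_le hT2, (hsch k).sub_one_lt_time_countLE (T - 1)]
  have hV1 : ∀ k, V k ≤ 4 * lam := by
    intro k
    have := H.sum_abs_relStep_le hM hlam hl1 hp₀ k (hmono k)
    have h2 := hspan k
    simp only [hV]
    nlinarith
  have hV0 : ∀ k, 0 ≤ V k := fun k => Finset.sum_nonneg fun _ _ => abs_nonneg _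
  have hV2 : ∀ k, M.Wanted k → V k ^ 2 ≤ 4 * (lam / l * G) := by
    intro k hk
    have h1 := H.sq_sum_abs_relStep_le k (hmono k)
    have h2 : ∑ i ∈ Finset.Ico (countLE (time k) (T - 1)) (countLE (time k) (T + 2)),
        relStep time p k i ^ 2 / dur time k i ≤ lam / l * G := by
      refine le_trans ?_ (mul_le_mul_of_nonneg_left
        (H.sum_energy_le_totalEnergy hM hlam hl1 hp₀ le_rfl k) (by positivity))
      rw [Finset.mul_sum]
      refine Finset.sum_le_sum fun i _ => ?_
      have h3 := H.price_mul_sq_div_le_energy hM hlam hl1 hp₀ k i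
      have hd := H.dur_pos k i
      have h4 : l ≤ p (time k i) k := (hbox _ ((hsch k).time_nonneg i)).ge k hk
      calc relStep time p k i ^ 2 / dur time k i
          = lam / l * (l * (relStep time p k i ^ 2 / (lam * dur time k i))) := by field_simp
        _ ≤ lam / l * (p (time k i) k * (relStep time p k i ^ 2 / (lam * dur time k i))) := by
            gcongr
        _ ≤ _ := by gcongr
    refine h1.trans (mul_le_mul (hspan k) h2 (Finset.sum_nonneg fun i _ =>
      div_nonneg (sq_nonneg _) (H.dur_pos k i).le) (by norm_num))
  -- a common bound for the changes of the logarithms of all prices of wanted goods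
  set r := min 1 (√(5 * lam / l * G)) with hr
  have hrG : 0 ≤ 5 * lam / l * G := by positivity
  have hr0 : 0 ≤ r := le_min zero_le_one (Real.sqrt_nonneg _)
  have hr1 : r ≤ 1 := min_le_left _ _
  have hr2 : r ^ 2 ≤ 5 * lam / l * G := by
    calc r ^ 2 ≤ √(5 * lam / l * G) ^ 2 := pow_le_pow_left₀ hr0 (min_le_right _ _) 2
      _ = _ := Real.sq_sqrt hrG
  have hVr : ∀ k, M.Wanted k → 21 / 20 * V k ≤ r := by
    intro k hk
    refine le_min ?_ (Real.le_sqrt_of_sq_le ?_)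
    · linarith [hV1 k]
    · have : 5 * lam / l * G = 5 * (lam / l * G) := by ring
      rw [this]
      have h1 : 0 ≤ lam / l * G := by positivity
      nlinarith [hV2 k hk]
  set z := M.totalDemand (p T) j - 1 with hz
  have hPT : 0 ≤ p T j := (hbox T hT).nonneg j
  have hPTu : p T j ≤ u := (hbox T hT).le j
  -- the contribution of a single update
  have hev : ∀ e ∈ Finset.Ico (countLE (time j) T) (countLE (time j) (T + 2)),
      dur time j e * (p T j * z ^ 2) ≤
        4 * Z ^ 2 / lam * energy M lam time p j e + 2 * u * L ^ 2 * r ^ 2 * dur time j e := by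
    intro e he
    rw [Finset.mem_Ico] at he
    have hte : T - 1 < time j e := ((hsch j).sub_one_lt_time_countLE T).trans_le
      ((hsch j).strictMono.monotone he.1)
    have hte' : time j (e + 1) ≤ T + 2 := (hsch j).lt_countLE_iff.1 he.2
    have hte0 := (hsch j).time_nonneg e
    have hlt : time j e < time j (e + 1) := H.time_strictMono j e.lt_succ_self
    obtain ⟨zt, -, ⟨s₁, hs₁, hz₁⟩, ⟨s₂, hs₂, hz₂⟩, hrs⟩ :=
      H.update_spec hM hlam hl1 hp₀ j e
    have hclose : ∀ s ∈ Ioo (time j e) (time j (e + 1)),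
        |M.totalDemand (p s) j - M.totalDemand (p T) j| ≤ L * r := by
      intro s hs
      have hs0 : 0 ≤ s := hte0.trans hs.1.le
      refine hLip (p T) (p s) (hbox T hT) (hbox s hs0) r hr0 hr1 (fun k hk => ?_) j
      exact (H.abs_log_price_div_price_le hM hlam hlam1 hp₀ hs0 hT (hte.trans hs.1).le
        (hs.2.le.trans hte') (by linarith) (by linarith) k).trans (hVr k hk)
    have h1 := abs_le.1 (hclose s₁ hs₁)
    have h2 := abs_le.1 (hclose s₂ hs₂)
    have h3 : (z - zt) ^ 2 ≤ (L * r) ^ 2 := by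
      rw [← sq_abs]
      exact pow_le_pow_left₀ (abs_nonneg _) (abs_le.2 ⟨by linarith, by linarith⟩) 2
    have h4 : zt ^ 2 ≤ Z ^ 2 * min zt 1 ^ 2 := by
      rcases le_total zt 1 with h | h
      · rw [min_eq_left h]
        nlinarith [sq_nonneg zt, mul_nonneg (sub_nonneg.2 hZ1) (sub_nonneg.2 hZ1)]
      · rw [min_eq_right h]
        have := (hbox s₂ (hte0.trans hs₂.1.le)).totalDemand_le hM hl j
        nlinarith
    -- `z` is close to `zt`, whose cap at `1` costs at most the factor `Z`
    have h5 : z ^ 2 ≤ 2 * (Z ^ 2 * min zt 1 ^ 2) + 2 * (L ^ 2 * r ^ 2) := by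
      nlinarith [sq_nonneg (z - zt - zt)]
    have hPe := H.price_pos hlam hl1 hp₀ hte0 j
    have h6 : p T j ≤ 2 * p (time j e) j := by
      have h7 := (abs_le.1 (H.abs_log_price_div_price_le hM hlam hlam1 hp₀ (a := T - 1)
        (b := T + 2) (s := T) (t := time j e)
        hT hte0 (by linarith) (by linarith) hte.le (by linarith) j)).2
      have h8 := hV1 j
      have hPT' := H.price_pos hlam hl1 hp₀ hT j
      have h9 : Real.log (p T j / p (time j e) j) ≤ Real.log 2 := by
        have := Real.log_two_gt_d9
        simp only [hV] at h8
        linarith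
      have := (Real.log_le_log_iff (by positivity) (by norm_num)).1 h9
      rwa [div_le_iff₀ hPe] at this
    have hd := H.dur_pos j e
    have h10 := H.price_mul_sq_div_le_energy hM hlam hl1 hp₀ j e
    have h11 : relStep time p j e ^ 2 / (lam * dur time j e) =
        lam * dur time j e * min zt 1 ^ 2 := by rw [hrs]; field_simp
    rw [h11] at h10
    calc dur time j e * (p T j * z ^ 2)
        ≤ dur time j e * (p T j * (2 * (Z ^ 2 * min zt 1 ^ 2) + 2 * (L ^ 2 * r ^ 2))) := by
          gcongr
      _ = dur time j e * (2 * p T j * (Z ^ 2 * min zt 1 ^ 2)) +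
          2 * p T j * L ^ 2 * r ^ 2 * dur time j e := by ring
      _ ≤ dur time j e * (2 * (2 * p (time j e) j) * (Z ^ 2 * min zt 1 ^ 2)) +
          2 * u * L ^ 2 * r ^ 2 * dur time j e := by gcongr
      _ = 4 * Z ^ 2 / lam * (p (time j e) j * (lam * dur time j e * min zt 1 ^ 2)) +
          2 * u * L ^ 2 * r ^ 2 * dur time j e := by field_simp; ring
      _ ≤ _ := by gcongr
  have hsum := Finset.sum_le_sum hev
  have hm := (hsch j).countLE_mono (show T ≤ T + 2 by linarith)
  rw [← Finset.sum_mul, Finset.sum_add_distrib, ← Finset.mul_sum, ← Finset.mul_sum,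
    sum_dur hm] at hsum
  have h1 : 1 ≤ time j (countLE (time j) (T + 2)) - time j (countLE (time j) T) := by
    linarith [(hsch j).sub_one_lt_time_countLE (T + 2), (hsch j).time_countLE_le hT]
  have h3 : time j (countLE (time j) (T + 2)) - time j (countLE (time j) T) ≤ 3 := by
    linarith [(hsch j).sub_one_lt_time_countLE T, (hsch j).time_countLE_le hT2]
  have h4 := H.sum_energy_le_totalEnergy hM hlam hl1 hp₀ (c := T + 2)
    (show T - 1 ≤ T by linarith) j
  calc p T j * z ^ 2
      ≤ (time j (countLE (time j) (T + 2)) - time j (countLE (time j) T)) * (p T j * z ^ 2) :=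
        le_mul_of_one_le_left (by positivity) h1
    _ ≤ _ := hsum
    _ ≤ 4 * Z ^ 2 / lam * G + 2 * u * L ^ 2 * (5 * lam / l * G) * 3 := by gcongr
    _ = _ := by ring

end CESMarket.IsAsyncTatonnement

/-! ### Linear convergence -/

/-- Linear decay of a quantity `F` that is related to nonnegative energies `g` by an amortized
descent inequality and an error bound. -/
lemma amortized_linear_decay {F g : ℕ → ℝ} {K : ℝ} (hK : 0 < K) (hg : ∀ N, 0 ≤ g N)
    (hdesc : ∀ N, F (N + 1) ≤ F N - 1 / 10 * g (N + 1) + 1 / 40 * (g N + g (N + 1)))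
    (herr : ∀ N, F N ≤ K * (g N + g (N + 1) + g (N + 2))) (N : ℕ) :
    F (2 * N) + 1 / 20 * g (2 * N) ≤
      (1 - 1 / (40 * K + 2)) ^ N * (F 0 + 1 / 20 * g 0) := by
  have hη : 0 ≤ 1 - 1 / (40 * K + 2) := by
    rw [sub_nonneg, div_le_one (by positivity)]; linarith
  induction N with
  | zero => simp
  | succ N ih =>
    have h1 := hdesc (2 * N)
    have h2 := hdesc (2 * N + 1)
    have h3 := herr (2 * N)
    have h4 : (F (2 * N) + 1 / 20 * g (2 * N)) / (40 * K + 2) ≤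
        1 / 40 * (g (2 * N) + g (2 * N + 1) + g (2 * N + 2)) := by
      rw [div_le_iff₀ (by positivity)]
      nlinarith [hg (2 * N), hg (2 * N + 1), hg (2 * N + 2)]
    have h5 : F (2 * (N + 1)) + 1 / 20 * g (2 * (N + 1)) ≤
        (1 - 1 / (40 * K + 2)) * (F (2 * N) + 1 / 20 * g (2 * N)) := by
      rw [show 2 * (N + 1) = 2 * N + 2 by ring]
      rw [show 2 * N + 1 + 1 = 2 * N + 2 by ring] at h2
      have e : (1 - 1 / (40 * K + 2)) * (F (2 * N) + 1 / 20 * g (2 * N)) =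
        (F (2 * N) + 1 / 20 * g (2 * N)) -
          (F (2 * N) + 1 / 20 * g (2 * N)) / (40 * K + 2) := by ring
      rw [e]
      linarith [hg (2 * N), hg (2 * N + 1), hg (2 * N + 2)]
    calc _ ≤ _ := h5
      _ ≤ (1 - 1 / (40 * K + 2)) *
          ((1 - 1 / (40 * K + 2)) ^ N * (F 0 + 1 / 20 * g 0)) := by gcongr
      _ = _ := by rw [pow_succ]; ring

namespace CESMarket.IsAsyncTatonnement

variable {M : CESMarket n m} {lam : ℝ} {p₀ : Fin n → ℝ} {time : Fin n → ℕ → ℝ}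
  {p : ℝ → Fin n → ℝ}

/-- An error bound by the energy within a few units of time implies geometric decay of the error. -/
lemma phi_sub_le_pow (H : M.IsAsyncTatonnement lam p₀ time p) (hM : ∀ i, M.rho i < 1)
    {E : ℝ} (hE : 1 ≤ E) (hρE : ∀ i, 1 / (1 - M.rho i) ≤ E)
    (hlam : 0 < lam) (hlamE : lam ≤ 1 / (26 * E)) (hp₀ : ∀ j, 0 < p₀ j) {K φ₀ : ℝ} (hK : 0 < K)
    (herr : ∀ T, 0 ≤ T → M.phi (p T) - φ₀ ≤ K * totalEnergy M lam time p (T - 1) (T + 2))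
    {t : ℝ} {N : ℕ} (hN : 2 * N ≤ t) :
    M.phi (p t) - φ₀ ≤ (1 - 1 / (40 * K + 2)) ^ N * (M.phi p₀ - φ₀) := by
  have hE26 : 1 / (26 * E) ≤ 1 / 26 := by gcongr; linarith
  have hl1 : lam < 1 := by linarith
  have hg := H.totalEnergy_nonneg hM hlam hl1 hp₀
  set g : ℕ → ℝ := fun N => totalEnergy M lam time p (N - 1) N with hgdef
  have h0 : g 0 = 0 := by
    simp only [hgdef, Nat.cast_zero, zero_sub]; exact H.totalEnergy_neg_one_zero
  have hmain := amortized_linear_decay (F := fun N : ℕ => M.phi (p N) - φ₀) (g := g) hK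
    (fun N => hg _ _) (fun N => by
      have h1 := H.phi_le_sub_totalEnergy hM hE hρE hlam hlamE hp₀ (a := N) (b := N + 1)
        N.cast_nonneg (by linarith)
      have h2 := H.totalEnergy_add (M := M) (a := (N : ℝ) - 1) (b := N) (c := N + 1)
        (by linarith) (by linarith)
      simp only [hgdef, Nat.cast_add, Nat.cast_one, add_sub_cancel_right]
      linarith) (fun N => by
      refine (herr N N.cast_nonneg).trans (le_of_eq ?_)
      have h2 := H.totalEnergy_add (M := M) (a := (N : ℝ) - 1) (b := N) (c := N + 1)
        (by linarith) (by linarith)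
      have h3 := H.totalEnergy_add (M := M) (a := (N : ℝ) - 1) (b := N + 1) (c := N + 2)
        (by linarith) (by linarith)
      simp only [hgdef, Nat.cast_add, Nat.cast_one, add_sub_cancel_right, Nat.cast_ofNat]
      rw [show (N : ℝ) + 2 - 1 = N + 1 by ring, ← h3, ← h2]) N
  simp only [h0, mul_zero, add_zero, Nat.cast_zero, H.initial] at hmain
  refine le_trans ?_ hmain
  have hN0 : (0 : ℝ) ≤ ((2 * N : ℕ) : ℝ) := Nat.cast_nonneg _
  have hNt : ((2 * N : ℕ) : ℝ) ≤ t := by push_cast; exact hN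
  have h1 := H.phi_le_sub_totalEnergy hM hE hρE hlam hlamE hp₀ hN0 hNt
  have h2 := H.totalEnergy_add (M := M) (a := ((2 * N : ℕ) : ℝ) - 1) (b := ((2 * N : ℕ) : ℝ))
    (c := t) (by linarith) hNt
  have h3 := hg ((2 * N : ℕ) : ℝ) t
  have h4 := hg (((2 * N : ℕ) : ℝ) - 1) ((2 * N : ℕ) : ℝ)
  simp only [hgdef]
  linarith

/-- Linear convergence, with constants that do not depend on the run. -/
lemma exists_linear_convergence (hM : ∀ i, M.rho i < 1)
    {E : ℝ} (hE : 1 ≤ E) (hρE : ∀ i, 1 / (1 - M.rho i) ≤ E)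
    (hlam : 0 < lam) (hlamE : lam ≤ 1 / (26 * E)) (hp₀ : ∀ j, 0 < p₀ j) {q : Fin n → ℝ}
    (hq : M.IsEquilibrium q) :
    ∃ C γ : ℝ, 0 < C ∧ 0 < γ ∧ γ < 1 ∧ ∀ time p, M.IsAsyncTatonnement lam p₀ time p →
      ∀ t : ℝ, 0 ≤ t → M.phi (p t) - M.phi q ≤ C * γ ^ t * (M.phi p₀ - M.phi q) ∧
        ∀ j, |p t j - q j| ≤ C * γ ^ t := by
  have hE26 : 1 / (26 * E) ≤ 1 / 26 := by gcongr; linarith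
  have hlam26 : lam ≤ 1 / 26 := hlamE.trans hE26
  obtain ⟨l, u, hl, hu, hqb, hbox⟩ := exists_inBox hM hlam hlam26 hp₀ hq
  obtain ⟨K₁, hK₁, herr₁⟩ := hq.exists_phi_sub_le hM hl hu hqb
  obtain ⟨K₂, hK₂, herr₂⟩ := exists_price_mul_sq_excess_le (M := M) hM hlam hlam26 hp₀ hl hu
  obtain ⟨κ, hκ, hκ1, hρκ⟩ := exists_convexity_constant hM
  have hA := hq.admissible hM
  set K := K₁ * (n * K₂) + 1 with hKdef
  have hK : 0 < K := by positivity
  set F₀ := M.phi p₀ - M.phi q with hF₀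
  have hF₀0 : 0 ≤ F₀ := (mul_nonneg hκ.le (Finset.sum_nonneg fun _ _ => sq_nonneg _)).trans
    (hq.quadratic_growth hM hκ1 hρκ (Admissible.of_pos hp₀))
  set θ := 1 - 1 / (40 * K + 2) with hθ
  have hθ1 : θ < 1 := by
    have : 0 < 1 / (40 * K + 2) := by positivity
    linarith
  have hθ0 : 0 < θ := by
    rw [hθ, sub_pos, div_lt_one (by positivity)]; linarith
  -- the prices converge with half the exponent of `φ`, so both statements use this smaller rate
  set C := θ⁻¹ + 2 * √u * √(θ⁻¹ * F₀ / κ) with hC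
  have hC1 : θ⁻¹ ≤ C := by
    have : 0 ≤ 2 * √u * √(θ⁻¹ * F₀ / κ) := by positivity
    linarith
  have hC2 : 2 * √u * √(θ⁻¹ * F₀ / κ) ≤ C := by
    have : 0 ≤ θ⁻¹ := by positivity
    linarith
  refine ⟨C, θ ^ (1 / 4 : ℝ), by positivity, by positivity,
    Real.rpow_lt_one hθ0.le hθ1 (by norm_num), fun time p H t ht => ?_⟩
  have hγ : (θ ^ (1 / 4 : ℝ)) ^ t = θ ^ (t / 4) := by
    rw [← Real.rpow_mul hθ0.le]; congr 1; ring
  have hF : M.phi (p t) - M.phi q ≤ θ⁻¹ * F₀ * θ ^ (t / 2) := by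
    have hfl : ((⌊t / 2⌋₊ : ℕ) : ℝ) ≤ t / 2 := Nat.floor_le (by positivity)
    have h1 := H.phi_sub_le_pow hM hE hρE hlam hlamE hp₀ hK (φ₀ := M.phi q) (fun T hT => by
      have h2 := herr₁ (p T) (hbox time p H T hT)
      have h3 := Finset.sum_le_sum fun j (_ : j ∈ Finset.univ) =>
        herr₂ time p H (hbox time p H) T hT j
      rw [Finset.sum_const, Finset.card_univ, Fintype.card_fin, nsmul_eq_mul] at h3
      have h4 := H.totalEnergy_nonneg hM hlam (by linarith) hp₀ (T - 1) (T + 2)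
      calc _ ≤ _ := h2
        _ ≤ K₁ * (n * (K₂ * totalEnergy M lam time p (T - 1) (T + 2))) := by gcongr
        _ ≤ _ := by rw [hKdef]; linarith) (N := ⌊t / 2⌋₊) (t := t) (by linarith)
    refine h1.trans ?_
    rw [← hθ, ← hF₀]
    have h5 : θ ^ ⌊t / 2⌋₊ ≤ θ⁻¹ * θ ^ (t / 2) := by
      rw [← Real.rpow_natCast, ← Real.rpow_neg_one, ← Real.rpow_add hθ0]
      refine Real.rpow_le_rpow_of_exponent_ge hθ0 hθ1.le ?_
      linarith [Nat.lt_floor_add_one (t / 2)]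
    calc _ ≤ θ⁻¹ * θ ^ (t / 2) * F₀ := by gcongr
      _ = _ := by ring
  rw [hγ]
  have hb := hbox time p H t ht
  have hgrow := hq.quadratic_growth hM hκ1 hρκ (hb.admissible hl)
  refine ⟨hF.trans ?_, fun j => ?_⟩
  · have h1 : θ ^ (t / 2) ≤ θ ^ (t / 4) :=
      Real.rpow_le_rpow_of_exponent_ge hθ0 hθ1.le (by linarith)
    calc θ⁻¹ * F₀ * θ ^ (t / 2) ≤ C * F₀ * θ ^ (t / 4) := by gcongr
      _ = _ := by ring
  · have h1 : (√(p t j) - √(q j)) ^ 2 ≤ θ⁻¹ * F₀ / κ * (θ ^ (t / 4)) ^ 2 := by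
      have h2 := Finset.single_le_sum (f := fun j => (√(p t j) - √(q j)) ^ 2)
        (fun _ _ => sq_nonneg _) (Finset.mem_univ j)
      have h3 : (θ ^ (t / 4)) ^ 2 = θ ^ (t / 2) := by
        rw [← Real.rpow_natCast, ← Real.rpow_mul hθ0.le]; congr 1; push_cast; ring
      rw [h3, div_mul_eq_mul_div, le_div_iff₀ hκ]
      nlinarith
    have h2 : |√(p t j) - √(q j)| ≤ √(θ⁻¹ * F₀ / κ) * θ ^ (t / 4) := by
      have h3 := Real.sqrt_le_sqrt h1
      rwa [Real.sqrt_sq_eq_abs, Real.sqrt_mul (by positivity),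
        Real.sqrt_sq (by positivity)] at h3
    have h3 : p t j - q j = (√(p t j) + √(q j)) * (√(p t j) - √(q j)) := by
      nlinarith [Real.sq_sqrt (hb.nonneg j), Real.sq_sqrt (hA.nonneg j)]
    have h4 : √(p t j) + √(q j) ≤ 2 * √u := by
      linarith [Real.sqrt_le_sqrt (hb.le j), Real.sqrt_le_sqrt (hqb.le j)]
    rw [h3, abs_mul, abs_of_nonneg (by positivity)]
    calc _ ≤ 2 * √u * (√(θ⁻¹ * F₀ / κ) * θ ^ (t / 4)) := by gcongr
      _ = 2 * √u * √(θ⁻¹ * F₀ / κ) * θ ^ (t / 4) := by ring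
      _ ≤ _ := by gcongr

end CESMarket.IsAsyncTatonnement

end FisherMarket

end

theorem theorem2 {n m : ℕ} (M : FisherMarket.CESMarket n m) (ρ : ℝ)
    (hρ : IsGreatest (Set.range M.rho) ρ) (hρ1 : ρ < 1)
    (lam : ℝ) (hlam : 0 < lam) (hlamE : lam ≤ 1 / (26 * max (1 / (1 - ρ)) 1)) :
    ∃ pstar : Fin n → ℝ, M.IsEquilibrium pstar ∧ (∀ q, M.IsEquilibrium q → q = pstar) ∧
      ∀ p₀ : Fin n → ℝ, (∀ j, 0 < p₀ j) →
        ∃ C γ : ℝ, 0 < C ∧ 0 < γ ∧ γ < 1 ∧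
          ∀ (time : Fin n → ℕ → ℝ) (p : ℝ → Fin n → ℝ),
            M.IsAsyncTatonnement lam p₀ time p →
              ∀ t : ℝ, 0 ≤ t →
                M.phi (p t) - M.phi pstar ≤ C * γ ^ t * (M.phi p₀ - M.phi pstar) ∧
                ∀ j, |p t j - pstar j| ≤ C * γ ^ t := by
  have hle : ∀ i, M.rho i ≤ ρ := fun i => hρ.2 ⟨i, rfl⟩
  have hM : ∀ i, M.rho i < 1 := fun i => (hle i).trans_lt hρ1
  have hρE : ∀ i, 1 / (1 - M.rho i) ≤ max (1 / (1 - ρ)) 1 := fun i => by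
    refine le_trans ?_ (le_max_left _ _)
    have := hle i
    have h1 : 0 < 1 - ρ := by linarith
    gcongr
  obtain ⟨q, hq⟩ := FisherMarket.CESMarket.exists_isEquilibrium hM
  exact ⟨q, hq, fun q' hq' => hq.unique hM hq', fun p₀ hp₀ =>
    FisherMarket.CESMarket.IsAsyncTatonnement.exists_linear_convergence hM (le_max_right _ _) hρE
      hlam hlamE hp₀ hq⟩
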